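/- Let $N\ge 2$ and let $\Omega\subset\mathbb R^N$ be a smooth bounded domain. Let $W^{1,1}(\Omega;\mathbb S^1)=\{u\in W^{1,1}(\Omega;\mathbb C):|u|=1\text{ a.e.}\}$, and for $u,v\in W^{1,1}(\Omega;\mathbb S^1)$ write $u\sim v$ if $u=e^{\imath\varphi}v$ a.e. for some $\varphi\in W^{1,1}(\Omega;\mathbb R)$; let $\mathcal E(u)$ be the equivalence class of $u$. Put $$\Sigma(u)=\inf_{\varphi\in W^{1,1}(\Omega;\mathbb R)}\int_\Omega|\nabla(ue^{-\imath\varphi})|,\qquad d_{W^{1,1}}(u,\mathcal E(v_0))=\inf_{v\sim v_0}\int_\Omega|\nabla(u-v)|,$$ $$\operatorname{Dist}_{W^{1,1}}(\mathcal E(u_0),\mathcal E(v_0))=\sup_{u\sim u_0}d_{W^{1,1}}(u,\mathcal E(v_0)).$$ For each integer $n\ge 3$ let $T_n:\mathbb S^1\to\mathbb S^1$ be the Lipschitz map of degree one given by $T_n(e^{\imath\theta})=e^{\imath\tau_n(\theta)}$ for $\theta\in[0,2\pi]$, where $\tau_n$ is continuous and piecewise linear on $[0,2\pi]$ with $\tau_n(0)=0$,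 $\tau_n'=n$ on $(2j\pi/n^2,(2j+1)\pi/n^2)$ and $\tau_n'=-(n-2)$ on $((2j+1)\pi/n^2,(2j+2)\pi/n^2)$ for $j=0,1,\dots,n^2-1$. Then $T_n\circ u_0\in W^{1,1}(\Omega;\mathbb S^1)$ for all $n\ge3$ and $u_0\in W^{1,1}(\Omega;\mathbb S^1)$, and $$\lim_{n\to\infty}\frac{d_{W^{1,1}}(T_n\circ u_0,\mathcal E(v_0))}{\Sigma(u_0\overline{v_0})}=1$$ for all $u_0,v_0\in W^{1,1}(\Omega;\mathbb S^1)$ with $u_0\not\sim v_0$, uniformly over all such pairs $(u_0,v_0)$. Consequently, $$\operatorname{Dist}_{W^{1,1}}(\mathcal E(u_0),\mathcal E(v_0))\ge\Sigma(u_0\overline{v_0})\qquad\text{for all }u_0,v_0\in W^{1,1}(\Omega;\mathbb S^1).$$ -/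

import Mathlib

open MeasureTheory Filter
open scoped ContDiff Topology

noncomputable section

namespace CircleSobolev

/-- `Ω` has smooth boundary: near each of its boundary points, `Ω` is the sublevel set
`{ρ < 0}` of a smooth function `ρ` with non-vanishing differential at that point. -/
def HasSmoothBoundary {N : ℕ} (Ω : Set (EuclideanSpace ℝ (Fin N))) : Prop :=
  ∀ x ∈ frontier Ω, ∃ U ∈ 𝓝 x, ∃ ρ : EuclideanSpace ℝ (Fin N) → ℝ,
    ContDiff ℝ ∞ ρ ∧ fderiv ℝ ρ x ≠ 0 ∧ ∀ y ∈ U, (y ∈ Ω ↔ ρ y < 0)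

/-- A smooth bounded domain of `ℝ^N`. -/
structure IsSmoothBoundedDomain {N : ℕ} (Ω : Set (EuclideanSpace ℝ (Fin N))) : Prop where
  isOpen : IsOpen Ω
  isConnected : IsConnected Ω
  isBounded : Bornology.IsBounded Ω
  smoothBoundary : HasSmoothBoundary Ω

/-- `g` is an integrable weak gradient of `u` on `Ω`: its `i`-th component `g x i` is the `i`-th
weak partial derivative, and `‖g x‖ = (∑ i, ‖∂ᵢ u x‖ ^ 2) ^ (1 / 2)`. -/
structure IsWeakGrad {N : ℕ} {F : Type*} [NormedAddCommGroup F] [NormedSpace ℝ F]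
    (Ω : Set (EuclideanSpace ℝ (Fin N))) (u : EuclideanSpace ℝ (Fin N) → F)
    (g : EuclideanSpace ℝ (Fin N) → PiLp 2 (fun _ : Fin N => F)) : Prop where
  integrableOn : IntegrableOn g Ω
  integral_eq : ∀ η : EuclideanSpace ℝ (Fin N) → ℝ,
    ContDiff ℝ ∞ η → HasCompactSupport η → tsupport η ⊆ Ω → ∀ i : Fin N,
      ∫ x in Ω, (fderiv ℝ η x (EuclideanSpace.single i 1)) • u x = -∫ x in Ω, η x • g x i

/-- `u` represents an element of `W^{1,1}(Ω; F)`. -/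
def MemW11 {N : ℕ} {F : Type*} [NormedAddCommGroup F] [NormedSpace ℝ F]
    (Ω : Set (EuclideanSpace ℝ (Fin N))) (u : EuclideanSpace ℝ (Fin N) → F) : Prop :=
  IntegrableOn u Ω ∧ ∃ g, IsWeakGrad Ω u g

open Classical in
/-- The weak gradient `∇u` (unique up to a null subset of `Ω`; `0` if there is none). -/
def weakGrad {N : ℕ} {F : Type*} [NormedAddCommGroup F] [NormedSpace ℝ F]
    (Ω : Set (EuclideanSpace ℝ (Fin N))) (u : EuclideanSpace ℝ (Fin N) → F) :
    EuclideanSpace ℝ (Fin N) → PiLp 2 (fun _ : Fin N => F) :=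
  if h : ∃ g, IsWeakGrad Ω u g then h.choose else 0

/-- `∫_Ω |∇u|`. -/
def gradL1 {N : ℕ} {F : Type*} [NormedAddCommGroup F] [NormedSpace ℝ F]
    (Ω : Set (EuclideanSpace ℝ (Fin N))) (u : EuclideanSpace ℝ (Fin N) → F) : ℝ :=
  ∫ x in Ω, ‖weakGrad Ω u x‖

/-- `W^{1,1}(Ω; 𝕊¹)`. A class of complex-valued functions with `|u| = 1` a.e. is given by a
representative that takes its values in the circle everywhere. -/
def W11Circle {N : ℕ} (Ω : Set (EuclideanSpace ℝ (Fin N))) :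
    Set (EuclideanSpace ℝ (Fin N) → Circle) :=
  {u | MemW11 Ω (fun x => (u x : ℂ))}

/-- `u ∼ v`: `u = e^{iφ} v` a.e. in `Ω` for some `φ ∈ W^{1,1}(Ω; ℝ)`. -/
def Equivalent {N : ℕ} (Ω : Set (EuclideanSpace ℝ (Fin N)))
    (u v : EuclideanSpace ℝ (Fin N) → Circle) : Prop :=
  ∃ φ : EuclideanSpace ℝ (Fin N) → ℝ, MemW11 Ω φ ∧
    ∀ᵐ x ∂(volume.restrict Ω), u x = Circle.exp (φ x) * v x

/-- The equivalence class `ℰ(u)` in `W^{1,1}(Ω; 𝕊¹)`. -/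
def eqClass {N : ℕ} (Ω : Set (EuclideanSpace ℝ (Fin N)))
    (u : EuclideanSpace ℝ (Fin N) → Circle) : Set (EuclideanSpace ℝ (Fin N) → Circle) :=
  {v | v ∈ W11Circle Ω ∧ Equivalent Ω v u}

/-- `Σ(u)`, the infimum of `∫_Ω |∇(u e^{-iφ})|` over `φ ∈ W^{1,1}(Ω; ℝ)`. -/
def Sigma {N : ℕ} (Ω : Set (EuclideanSpace ℝ (Fin N)))
    (u : EuclideanSpace ℝ (Fin N) → Circle) : ℝ :=
  ⨅ φ : {φ : EuclideanSpace ℝ (Fin N) → ℝ // MemW11 Ω φ},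
    gradL1 Ω (fun x => ((u x * Circle.exp (-φ.1 x) : Circle) : ℂ))

/-- `d_{W^{1,1}}(u, ℰ(v₀))`, the infimum of `∫_Ω |∇(u - v)|` over `v ∼ v₀`. -/
def distToClass {N : ℕ} (Ω : Set (EuclideanSpace ℝ (Fin N)))
    (u v₀ : EuclideanSpace ℝ (Fin N) → Circle) : ℝ :=
  ⨅ v : eqClass Ω v₀, gradL1 Ω (fun x => (u x : ℂ) - (v.1 x : ℂ))

/-- `Dist_{W^{1,1}}(ℰ(u₀), ℰ(v₀))`, the supremum of `d_{W^{1,1}}(u, ℰ(v₀))` over `u ∼ u₀`,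
taken in the extended reals. -/
def DistClasses {N : ℕ} (Ω : Set (EuclideanSpace ℝ (Fin N)))
    (u₀ v₀ : EuclideanSpace ℝ (Fin N) → Circle) : EReal :=
  ⨆ u ∈ eqClass Ω u₀, ((distToClass Ω u v₀ : ℝ) : EReal)

open Classical in
/-- The derivative `τₙ'` on `(0, 2π]`: it equals `n` on the intervals
`(2jπ/n², (2j+1)π/n²]` and `-(n-2)` on the intervals `((2j+1)π/n², (2j+2)π/n²]`,
for `j = 0, …, n² - 1`. -/
def tauSlope (n : ℕ) (θ : ℝ) : ℝ :=
  if ∃ j : ℕ, j < n ^ 2 ∧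
      θ ∈ Set.Ioc (2 * j * Real.pi / (n : ℝ) ^ 2) ((2 * j + 1) * Real.pi / (n : ℝ) ^ 2)
  then (n : ℝ) else -((n : ℝ) - 2)

/-- `τₙ` on `[0, 2π]`, with `τₙ(0) = 0`. -/
def tau (n : ℕ) (θ : ℝ) : ℝ := ∫ s in (0 : ℝ)..θ, tauSlope n s

/-- The zigzag map `Tₙ(e^{iθ}) = e^{iτₙ(θ)}`, where `θ ∈ [0, 2π)`. -/
def zigzag (n : ℕ) (z : Circle) : Circle :=
  Circle.exp (tau n (toIcoMod Real.two_pi_pos 0 (Complex.arg (z : ℂ))))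

end CircleSobolev

end

/-! The ratio is squeezed between bounds that do not depend on the pair `(u₀, v₀)`, which gives the
uniformity. Maps into the circle are handled through their phase gradients `X`, with `∂ᵢ u = i u Xᵢ`
(`HasPhase`): phases add under products, and the modulus of `∇u` is that of `X`.

Upper bound, `distToClass_le_Sigma`, valid for every `u ∼ u₀`. Let `w = u₀ v₀⁻¹ e^{-iφ}` be a
competitor for `Σ`. Cut the circle into `k` equal arcs, and let `S_j` stretch the `j`-th arc once
around the circle while collapsing the rest to `1`. Then `v = u / (S_j ∘ w)` is equivalent to `v₀`,
and `u - v` vanishes wherever `w` is off the `j`-th arc; on that arc its gradient is at most `2|∇u|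
+ k|∇w|`. Summing over `j` and dividing by `k` bounds the distance by `∫ |∇w| + (2/k) ∫ |∇u|`; let
`k → ∞`.

Lower bound, `eventually_Sigma_le`. Write `Tₙ ∘ u₀ = u₀ e^{ig}` and `v = u₀ e^{it}` with `v ∼ v₀`,
and let `A`, `Y` be the phase gradients of `Tₙ ∘ u₀` and of `v`. Here `|g| ≤ 2π/n`, while the phase
gradient of `u₀` is `mA` with `|m| ≤ 1/(n-2)`. The map `(u₀/v) e^{i g cos t}` is a competitor for
`Σ`; its phase gradient is `A cos t - Y` up to terms small with `g` and `m`, and this is essentially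
the component of `∇(Tₙ ∘ u₀ - v)` tangent to the circle at `v`. The small terms cannot be absorbed
where `sin t` is near zero, because `|∇(Tₙ ∘ u₀ - v)|` may degenerate there. A periodic kernel `κ`
of mean one, with `0 ≤ κ ≤ 1 + ε/2` and vanishing near the zeros of `sin` (`exists_kernel`), repairs
this: replace `g cos t` by `g κ(t) cos t + t - ∫₀ᵗ κ`, which is still periodic in `t`. The leading
term becomes `κ(t)(A cos t - Y)`, and `exists_threshold` compares the two gradients pointwise with
factor `1 + ε`.

Dividing by `Σ` requires `Σ > 0` for inequivalent maps (`equivalent_of_Sigma_eq_zero`). Along a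
minimizing sequence the gradients of the phases `φ_k` converge in `L¹`, and the Poincaré–Wirtinger
inequality (`exists_poincare`) makes the `φ_k` converge after subtraction of their means.

The nonsmooth maps `Tₙ` and `S_j` need a chain rule on the circle for Lipschitz maps with
left-continuous slope. It is proved for Fourier modes, extended by density to continuous slopes, and
then by left difference quotients (`HasPhase.comp_primitive_of_leftContinuous`). -/

namespace CircleSobolev

open Set

/-! ### Weak partial derivatives: linearity, uniqueness, limits -/

section Basics

variable {N : ℕ} {F F' : Type*} [NormedAddCommGroup F] [NormedSpace ℝ F]
  [NormedAddCommGroup F'] [NormedSpace ℝ F']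

/-- `u` and `g` are integrable on `Ω` and `g` is the `i`-th weak partial derivative of `u`. -/
structure HasWeakPartial (Ω : Set (EuclideanSpace ℝ (Fin N))) (i : Fin N)
    (u g : EuclideanSpace ℝ (Fin N) → F) : Prop where
  integrableOn_fun : IntegrableOn u Ω
  integrableOn_grad : IntegrableOn g Ω
  integral_eq : ∀ η : EuclideanSpace ℝ (Fin N) → ℝ,
    ContDiff ℝ ∞ η → HasCompactSupport η → tsupport η ⊆ Ω →
      ∫ x in Ω, (fderiv ℝ η x (EuclideanSpace.single i 1)) • u x = -∫ x in Ω, η x • g x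

variable {Ω : Set (EuclideanSpace ℝ (Fin N))} {i : Fin N}
  {u v g h : EuclideanSpace ℝ (Fin N) → F} {η : EuclideanSpace ℝ (Fin N) → ℝ}

lemma continuous_fderiv_test (hη : ContDiff ℝ ∞ η) (e : EuclideanSpace ℝ (Fin N)) :
    Continuous fun x => fderiv ℝ η x e :=
  (hη.continuous_fderiv (by simp)).clm_apply continuous_const

lemma exists_bound_test (hη : ContDiff ℝ ∞ η) (hc : HasCompactSupport η) :
    ∃ C, 0 ≤ C ∧ ∀ x, ‖η x‖ ≤ C := by
  obtain ⟨C, hC⟩ := hc.exists_bound_of_continuous hη.continuous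
  exact ⟨C, (norm_nonneg _).trans (hC 0), hC⟩

lemma exists_bound_fderiv_test (hη : ContDiff ℝ ∞ η) (hc : HasCompactSupport η)
    (e : EuclideanSpace ℝ (Fin N)) : ∃ C, 0 ≤ C ∧ ∀ x, ‖fderiv ℝ η x e‖ ≤ C := by
  obtain ⟨C, hC⟩ := (hc.fderiv_apply (𝕜 := ℝ) e).exists_bound_of_continuous
    (continuous_fderiv_test hη e)
  exact ⟨C, (norm_nonneg _).trans (hC 0), hC⟩

lemma integrable_test_smul {μ : Measure (EuclideanSpace ℝ (Fin N))}
    (hη : ContDiff ℝ ∞ η) (hc : HasCompactSupport η)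
    (hu : Integrable u μ) : Integrable (fun x => η x • u x) μ := by
  obtain ⟨C, -, hC⟩ := exists_bound_test hη hc
  exact hu.bdd_smul C hη.continuous.aestronglyMeasurable (Eventually.of_forall hC)

lemma integrable_fderiv_test_smul {μ : Measure (EuclideanSpace ℝ (Fin N))}
    (hη : ContDiff ℝ ∞ η) (hc : HasCompactSupport η)
    (e : EuclideanSpace ℝ (Fin N)) (hu : Integrable u μ) :
    Integrable (fun x => fderiv ℝ η x e • u x) μ := by
  obtain ⟨C, -, hC⟩ := exists_bound_fderiv_test hη hc e
  exact hu.bdd_smul C (continuous_fderiv_test hη e).aestronglyMeasurable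
    (Eventually.of_forall hC)

namespace HasWeakPartial

lemma add (hu : HasWeakPartial Ω i u g) (hv : HasWeakPartial Ω i v h) :
    HasWeakPartial Ω i (fun x => u x + v x) (fun x => g x + h x) where
  integrableOn_fun := hu.integrableOn_fun.add hv.integrableOn_fun
  integrableOn_grad := hu.integrableOn_grad.add hv.integrableOn_grad
  integral_eq η hη hc hs := by
    simp only [smul_add]
    rw [integral_add (integrable_fderiv_test_smul hη hc _ hu.integrableOn_fun)
        (integrable_fderiv_test_smul hη hc _ hv.integrableOn_fun),
      integral_add (integrable_test_smul hη hc hu.integrableOn_grad)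
        (integrable_test_smul hη hc hv.integrableOn_grad),
      hu.integral_eq η hη hc hs, hv.integral_eq η hη hc hs, neg_add]

lemma clm_comp [CompleteSpace F] [CompleteSpace F'] (L : F →L[ℝ] F')
    (hu : HasWeakPartial Ω i u g) :
    HasWeakPartial Ω i (fun x => L (u x)) (fun x => L (g x)) where
  integrableOn_fun := L.integrable_comp hu.integrableOn_fun
  integrableOn_grad := L.integrable_comp hu.integrableOn_grad
  integral_eq η hη hc hs := by
    simp only [← map_smul]
    rw [L.integral_comp_comm (integrable_fderiv_test_smul hη hc _ hu.integrableOn_fun),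
      L.integral_comp_comm (integrable_test_smul hη hc hu.integrableOn_grad),
      hu.integral_eq η hη hc hs, map_neg]

lemma neg (hu : HasWeakPartial Ω i u g) :
    HasWeakPartial Ω i (fun x => -u x) (fun x => -g x) where
  integrableOn_fun := hu.integrableOn_fun.neg
  integrableOn_grad := hu.integrableOn_grad.neg
  integral_eq η hη hc hs := by
    simp only [smul_neg, integral_neg, hu.integral_eq η hη hc hs]

lemma sub (hu : HasWeakPartial Ω i u g) (hv : HasWeakPartial Ω i v h) :
    HasWeakPartial Ω i (fun x => u x - v x) (fun x => g x - h x) := by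
  simpa only [sub_eq_add_neg] using hu.add hv.neg

lemma congr_ae (hu : HasWeakPartial Ω i u g) (h1 : u =ᵐ[volume.restrict Ω] v)
    (h2 : g =ᵐ[volume.restrict Ω] h) : HasWeakPartial Ω i v h where
  integrableOn_fun := hu.integrableOn_fun.congr h1
  integrableOn_grad := hu.integrableOn_grad.congr h2
  integral_eq η hη hc hs := by
    have e1 : ∫ x in Ω, (fderiv ℝ η x (EuclideanSpace.single i 1)) • v x =
        ∫ x in Ω, (fderiv ℝ η x (EuclideanSpace.single i 1)) • u x :=
      integral_congr_ae (h1.mono fun x hx => by simp only [hx])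
    have e2 : ∫ x in Ω, η x • h x = ∫ x in Ω, η x • g x :=
      integral_congr_ae (h2.mono fun x hx => by simp only [hx])
    rw [e1, e2, hu.integral_eq η hη hc hs]

lemma ae_eq [CompleteSpace F] (hΩ : IsOpen Ω) (hu : HasWeakPartial Ω i u g)
    (hu' : HasWeakPartial Ω i u h) : g =ᵐ[volume.restrict Ω] h := by
  have h0 := hΩ.ae_eq_zero_of_integral_contDiff_smul_eq_zero (μ := volume) (f := fun x => g x - h x)
    (hu.integrableOn_grad.sub hu'.integrableOn_grad).locallyIntegrableOn (by
      intro η hη hc hs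
      have hsub : ∫ x, η x • (g x - h x) = ∫ x in Ω, η x • (g x - h x) := by
        refine (setIntegral_eq_integral_of_forall_compl_eq_zero fun x hx => ?_).symm
        rw [image_eq_zero_of_notMem_tsupport fun hx' => hx (hs hx'), zero_smul]
      rw [hsub]
      simp only [smul_sub]
      rw [integral_sub (integrable_test_smul hη hc hu.integrableOn_grad)
        (integrable_test_smul hη hc hu'.integrableOn_grad), sub_eq_zero, ← neg_inj,
        ← hu.integral_eq η hη hc hs, ← hu'.integral_eq η hη hc hs])
  rw [← ae_restrict_iff' hΩ.measurableSet] at h0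
  exact h0.mono fun x hx => sub_eq_zero.1 hx

/-- Weak partial derivatives pass to `L¹` limits. -/
lemma of_tendsto {us gs : ℕ → EuclideanSpace ℝ (Fin N) → F}
    (hs : ∀ k, HasWeakPartial Ω i (us k) (gs k)) (hu : IntegrableOn u Ω) (hg : IntegrableOn g Ω)
    (h1 : Tendsto (fun k => ∫⁻ x in Ω, ‖us k x - u x‖ₑ) atTop (𝓝 0))
    (h2 : Tendsto (fun k => ∫⁻ x in Ω, ‖gs k x - g x‖ₑ) atTop (𝓝 0)) :
    HasWeakPartial Ω i u g where
  integrableOn_fun := hu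
  integrableOn_grad := hg
  integral_eq η hη hc hsupp := by
    have key : ∀ (ζ : EuclideanSpace ℝ (Fin N) → ℝ) (C : ℝ), Continuous ζ → (∀ x, ‖ζ x‖ ≤ C) →
        ∀ (fs : ℕ → EuclideanSpace ℝ (Fin N) → F) (f : EuclideanSpace ℝ (Fin N) → F),
        (∀ k, IntegrableOn (fs k) Ω) → IntegrableOn f Ω →
        Tendsto (fun k => ∫⁻ x in Ω, ‖fs k x - f x‖ₑ) atTop (𝓝 0) →
        Tendsto (fun k => ∫ x in Ω, ζ x • fs k x) atTop (𝓝 (∫ x in Ω, ζ x • f x)) := by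
      intro ζ C hζ hC fs f hfs hf hlim
      refine tendsto_integral_of_L1 _
        (hf.bdd_smul C hζ.aestronglyMeasurable (Eventually.of_forall hC)).1
        (Eventually.of_forall fun k => (hfs k).bdd_smul C hζ.aestronglyMeasurable
          (Eventually.of_forall hC)) ?_
      have h3 : Tendsto (fun k => ENNReal.ofReal C * ∫⁻ x in Ω, ‖fs k x - f x‖ₑ) atTop (𝓝 0) := by
        simpa using ENNReal.Tendsto.const_mul hlim (Or.inr (ENNReal.ofReal_ne_top (r := C)))
      refine tendsto_of_tendsto_of_tendsto_of_le_of_le tendsto_const_nhds h3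
        (fun _ => zero_le) fun k => ?_
      rw [← lintegral_const_mul' _ _ ENNReal.ofReal_ne_top]
      refine lintegral_mono fun x => ?_
      change ‖ζ x • fs k x - ζ x • f x‖ₑ ≤ _
      rw [← smul_sub, enorm_smul]
      gcongr
      rw [← ofReal_norm]
      exact ENNReal.ofReal_le_ofReal (hC x)
    obtain ⟨C, -, hC⟩ := exists_bound_test hη hc
    obtain ⟨C', -, hC'⟩ := exists_bound_fderiv_test hη hc (EuclideanSpace.single i 1)
    have l1 := key _ C' (continuous_fderiv_test hη _) hC' us u
      (fun k => (hs k).integrableOn_fun) hu h1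
    have l2 := (key _ C hη.continuous hC gs g (fun k => (hs k).integrableOn_grad) hg h2).neg
    refine tendsto_nhds_unique (l1.congr fun k => ?_) l2
    exact (hs k).integral_eq η hη hc hsupp

/-- Weak partial derivatives pass to dominated pointwise limits. -/
lemma of_tendsto_dominated {us gs : ℕ → EuclideanSpace ℝ (Fin N) → F}
    {b b' : EuclideanSpace ℝ (Fin N) → ℝ}
    (hs : ∀ k, HasWeakPartial Ω i (us k) (gs k))
    (hb : IntegrableOn b Ω) (hb' : IntegrableOn b' Ω)
    (hub : ∀ k, ∀ᵐ x ∂volume.restrict Ω, ‖us k x‖ ≤ b x)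
    (hgb : ∀ k, ∀ᵐ x ∂volume.restrict Ω, ‖gs k x‖ ≤ b' x)
    (h1 : ∀ᵐ x ∂volume.restrict Ω, Tendsto (fun k => us k x) atTop (𝓝 (u x)))
    (h2 : ∀ᵐ x ∂volume.restrict Ω, Tendsto (fun k => gs k x) atTop (𝓝 (g x))) :
    HasWeakPartial Ω i u g := by
  have key : ∀ (fs : ℕ → EuclideanSpace ℝ (Fin N) → F) (f : EuclideanSpace ℝ (Fin N) → F)
      (β : EuclideanSpace ℝ (Fin N) → ℝ), (∀ k, IntegrableOn (fs k) Ω) → IntegrableOn β Ω →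
      (∀ k, ∀ᵐ x ∂volume.restrict Ω, ‖fs k x‖ ≤ β x) →
      (∀ᵐ x ∂volume.restrict Ω, Tendsto (fun k => fs k x) atTop (𝓝 (f x))) →
      IntegrableOn f Ω ∧ Tendsto (fun k => ∫⁻ x in Ω, ‖fs k x - f x‖ₑ) atTop (𝓝 0) := by
    intro fs f β hfs hβ hbd hlim
    have hm : AEStronglyMeasurable f (volume.restrict Ω) :=
      aestronglyMeasurable_of_tendsto_ae atTop (fun k => (hfs k).1) hlim
    have hf : IntegrableOn f Ω := by
      refine Integrable.mono' hβ hm ?_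
      filter_upwards [hlim, ae_all_iff.2 hbd] with x hx hx'
      exact le_of_tendsto hx.norm (Eventually.of_forall hx')
    refine ⟨hf, ?_⟩
    have := tendsto_lintegral_norm_of_dominated_convergence (μ := volume.restrict Ω)
      (fun k => (hfs k).1) hβ.2 hbd hlim
    simpa only [ofReal_norm] using this
  obtain ⟨hu, l1⟩ := key us u b (fun k => (hs k).integrableOn_fun) hb hub h1
  obtain ⟨hg, l2⟩ := key gs g b' (fun k => (hs k).integrableOn_grad) hb' hgb h2
  exact of_tendsto hs hu hg l1 l2

end HasWeakPartial

lemma integral_fderiv_test_eq_zero (hη : ContDiff ℝ ∞ η) (hc : HasCompactSupport η)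
    (hs : tsupport η ⊆ Ω) (e : EuclideanSpace ℝ (Fin N)) : ∫ x in Ω, fderiv ℝ η x e = 0 := by
  rw [setIntegral_eq_integral_of_forall_compl_eq_zero fun x hx =>
    image_eq_zero_of_notMem_tsupport fun hx' => hx (hs (tsupport_fderiv_apply_subset ℝ e hx'))]
  have h1 : Integrable (fun x => fderiv ℝ η x e) :=
    (continuous_fderiv_test hη e).integrable_of_hasCompactSupport (hc.fderiv_apply (𝕜 := ℝ) e)
  have h2 : Integrable η := hη.continuous.integrable_of_hasCompactSupport hc
  have := integral_mul_fderiv_eq_neg_fderiv_mul_of_integrable (μ := volume) (f := fun _ => (1 : ℝ))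
    (g := η) (v := e) (by simp) (by simpa using h1) (by simpa using h2)
    (by simp) (fun x _ => (hη.differentiable (by simp)) x)
  simpa using this

lemma HasWeakPartial.const [CompleteSpace F] (hfin : volume Ω ≠ ⊤) (i : Fin N) (c : F) :
    HasWeakPartial Ω i (fun _ => c) (fun _ => 0) where
  integrableOn_fun := integrableOn_const hfin
  integrableOn_grad := integrableOn_zero
  integral_eq η hη hc hs := by
    rw [integral_smul_const, integral_fderiv_test_eq_zero hη hc hs]
    simp

lemma IsWeakGrad.hasWeakPartial {G : EuclideanSpace ℝ (Fin N) → PiLp 2 (fun _ : Fin N => F)}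
    (hG : IsWeakGrad Ω u G) (hu : IntegrableOn u Ω) (i : Fin N) :
    HasWeakPartial Ω i u (fun x => G x i) where
  integrableOn_fun := hu
  integrableOn_grad :=
    (PiLp.proj (𝕜 := ℝ) 2 (fun _ : Fin N => F) i).integrable_comp hG.integrableOn
  integral_eq η hη hc hs := hG.integral_eq η hη hc hs i

lemma integrableOn_toLp {G : Fin N → EuclideanSpace ℝ (Fin N) → F}
    (hG : ∀ i, IntegrableOn (G i) Ω) :
    IntegrableOn (fun x => WithLp.toLp 2 (fun i => G i x)) Ω := by
  have : Integrable (fun x i => G i x) (volume.restrict Ω) := Integrable.of_eval hG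
  exact (PiLp.continuousLinearEquiv 2 ℝ (fun _ : Fin N => F)).symm.toContinuousLinearMap
    |>.integrable_comp this

lemma isWeakGrad_toLp {G : Fin N → EuclideanSpace ℝ (Fin N) → F}
    (hG : ∀ i, HasWeakPartial Ω i u (G i)) :
    IsWeakGrad Ω u (fun x => WithLp.toLp 2 (fun i => G i x)) where
  integrableOn := integrableOn_toLp fun i => (hG i).integrableOn_grad
  integral_eq η hη hc hs i := (hG i).integral_eq η hη hc hs

lemma memW11_of_hasWeakPartial (hu : IntegrableOn u Ω)
    {G : Fin N → EuclideanSpace ℝ (Fin N) → F} (hG : ∀ i, HasWeakPartial Ω i u (G i)) :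
    MemW11 Ω u :=
  ⟨hu, _, isWeakGrad_toLp hG⟩

lemma MemW11.exists_hasWeakPartial (hu : MemW11 Ω u) :
    ∃ G : Fin N → EuclideanSpace ℝ (Fin N) → F, ∀ i, HasWeakPartial Ω i u (G i) := by
  obtain ⟨hu, g, hg⟩ := hu
  exact ⟨fun i x => g x i, fun i => hg.hasWeakPartial hu i⟩

/-- `weakGrad` is an arbitrary choice. Almost everywhere uniqueness of weak partial derivatives lets
any explicit family compute the integral. -/
lemma gradL1_eq [CompleteSpace F] (hΩ : IsOpen Ω) (hu : IntegrableOn u Ω)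
    {G : Fin N → EuclideanSpace ℝ (Fin N) → F} (hG : ∀ i, HasWeakPartial Ω i u (G i)) :
    gradL1 Ω u = ∫ x in Ω, ‖WithLp.toLp 2 (fun i => G i x)‖ := by
  have hex : ∃ g, IsWeakGrad Ω u g := ⟨_, isWeakGrad_toLp hG⟩
  have hw : IsWeakGrad Ω u (weakGrad Ω u) := by
    rw [weakGrad, dif_pos hex]
    exact hex.choose_spec
  refine integral_congr_ae ?_
  have : ∀ᵐ x ∂volume.restrict Ω, ∀ i, weakGrad Ω u x i = G i x :=
    ae_all_iff.2 fun i => (hw.hasWeakPartial hu i).ae_eq hΩ (hG i)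
  filter_upwards [this] with x hx
  congr 1
  ext i
  exact hx i

lemma gradL1_nonneg : 0 ≤ gradL1 Ω u := integral_nonneg fun _ => norm_nonneg _

end Basics

end CircleSobolev

namespace CircleSobolev

open Set ContinuousLinearMap
open scoped Convolution

/-! ### Mollification and `L¹` convergence of gradients on compact sets -/

section Mollification

variable {N : ℕ} {F : Type*} [NormedAddCommGroup F] [NormedSpace ℝ F]

/-- Fatou's lemma applied to `‖u_k‖ + ‖u‖ - ‖u_k - u‖`, which is nonnegative and tends to `2‖u‖`. As
`∫ ‖u_k‖` never exceeds `∫ ‖u‖`, nothing is left for `∫ ‖u_k - u‖` in the limit. -/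
lemma tendsto_lintegral_enorm_sub_of_ae {α H : Type*} [MeasurableSpace α] {μ : Measure α}
    [NormedAddCommGroup H] {us : ℕ → α → H} {u : α → H} (hus : ∀ k, Integrable (us k) μ) (hu : Integrable u μ)
    (hlim : ∀ᵐ x ∂μ, Tendsto (fun k => us k x) atTop (𝓝 (u x)))
    (hle : ∀ k, ∫⁻ x, ‖us k x‖ₑ ∂μ ≤ ∫⁻ x, ‖u x‖ₑ ∂μ) :
    Tendsto (fun k => ∫⁻ x, ‖us k x - u x‖ₑ ∂μ) atTop (𝓝 0) := by
  set A : ENNReal := (∫⁻ x, ‖u x‖ₑ ∂μ) + ∫⁻ x, ‖u x‖ₑ ∂μ with hA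
  have hAfin : A ≠ ⊤ := ENNReal.add_ne_top.2 ⟨hu.2.ne, hu.2.ne⟩
  set h : ℕ → α → ENNReal := fun k x => ‖us k x‖ₑ + ‖u x‖ₑ - ‖us k x - u x‖ₑ with hh
  have hmeas : ∀ k, AEMeasurable (h k) μ := fun k =>
    ((hus k).1.enorm.add hu.1.enorm).sub ((hus k).1.sub hu.1).enorm
  have hsum : ∀ k, (∫⁻ x, h k x ∂μ) + ∫⁻ x, ‖us k x - u x‖ₑ ∂μ ≤ A := by
    intro k
    rw [← lintegral_add_left' (hmeas k)]
    calc ∫⁻ x, h k x + ‖us k x - u x‖ₑ ∂μ = ∫⁻ x, ‖us k x‖ₑ + ‖u x‖ₑ ∂μ := by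
          refine lintegral_congr fun x => tsub_add_cancel_of_le ?_
          exact enorm_sub_le
      _ = (∫⁻ x, ‖us k x‖ₑ ∂μ) + ∫⁻ x, ‖u x‖ₑ ∂μ := lintegral_add_right' _ hu.1.enorm
      _ ≤ A := add_le_add_left (hle k) _
  have hfatou : A ≤ liminf (fun k => ∫⁻ x, h k x ∂μ) atTop := by
    refine le_trans (le_of_eq ?_) (lintegral_liminf_le' hmeas)
    rw [hA, ← lintegral_add_left' hu.1.enorm]
    refine lintegral_congr_ae ?_
    filter_upwards [hlim] with x hx
    have h0 : Tendsto (fun k => ‖us k x - u x‖ₑ) atTop (𝓝 0) := by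
      have : Tendsto (fun k => us k x - u x) atTop (𝓝 0) := by
        simpa using hx.sub (tendsto_const_nhds (x := u x))
      simpa using this.enorm
    have h1 : Tendsto (fun k => h k x) atTop (𝓝 (‖u x‖ₑ + ‖u x‖ₑ - 0)) :=
      ENNReal.Tendsto.sub (hx.enorm.add tendsto_const_nhds) h0 (Or.inr ENNReal.zero_ne_top)
    rw [tsub_zero] at h1
    exact h1.liminf_eq.symm
  have hlimh : Tendsto (fun k => ∫⁻ x, h k x ∂μ) atTop (𝓝 A) := by
    refine tendsto_of_le_liminf_of_limsup_le hfatou ?_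
    refine limsup_le_of_le (h := Eventually.of_forall fun k => ?_)
    exact le_self_add.trans (hsum k)
  have h2 : Tendsto (fun k => A - ∫⁻ x, h k x ∂μ) atTop (𝓝 (A - A)) :=
    ENNReal.Tendsto.sub tendsto_const_nhds hlimh (Or.inl hAfin)
  rw [tsub_self] at h2
  refine tendsto_of_tendsto_of_tendsto_of_le_of_le tendsto_const_nhds h2
    (fun _ => zero_le) fun k => ?_
  exact ENNReal.le_sub_of_add_le_left
    (ne_top_of_le_ne_top hAfin (le_self_add.trans (hsum k))) (hsum k)

/-- A standard sequence of smooth bumps shrinking to the origin. -/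
noncomputable def shrinkingBump (N k : ℕ) : ContDiffBump (0 : EuclideanSpace ℝ (Fin N)) where
  rIn := 1 / ((k : ℝ) + 1)
  rOut := 2 * (1 / ((k : ℝ) + 1))
  rIn_pos := Nat.one_div_pos_of_nat
  rIn_lt_rOut := by
    have : (0 : ℝ) < 1 / ((k : ℝ) + 1) := Nat.one_div_pos_of_nat
    linarith

/-- Convolution with the normalized `shrinkingBump`. -/
noncomputable def mollify (k : ℕ) (f : EuclideanSpace ℝ (Fin N) → F) :
    EuclideanSpace ℝ (Fin N) → F :=
  (shrinkingBump N k).normed volume ⋆[lsmul ℝ ℝ, volume] f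

lemma tendsto_shrinkingBump_rOut : Tendsto (fun k => (shrinkingBump N k).rOut) atTop (𝓝 0) := by
  simpa [shrinkingBump] using
    (tendsto_one_div_add_atTop_nhds_zero_nat (𝕜 := ℝ)).const_mul 2

variable {f : EuclideanSpace ℝ (Fin N) → F}

lemma mollify_apply (k : ℕ) (x : EuclideanSpace ℝ (Fin N)) :
    mollify k f x = ∫ y, (shrinkingBump N k).normed volume (x - y) • f y :=
  convolution_lsmul_swap

lemma ae_tendsto_mollify [CompleteSpace F] (hf : Integrable f) :
    ∀ᵐ x, Tendsto (fun k => mollify k f x) atTop (𝓝 (f x)) :=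
  ContDiffBump.ae_convolution_tendsto_right_of_locallyIntegrable (K := 2)
    tendsto_shrinkingBump_rOut (Eventually.of_forall fun _ => le_rfl) hf.locallyIntegrable

lemma integrable_mollify (k : ℕ) (hf : Integrable f) : Integrable (mollify k f) :=
  (shrinkingBump N k).integrable_normed.integrable_convolution _ hf

lemma lintegral_shrinkingBump (k : ℕ) (y : EuclideanSpace ℝ (Fin N)) :
    ∫⁻ x, ‖(shrinkingBump N k).normed volume (x - y)‖ₑ = 1 := by
  rw [lintegral_sub_right_eq_self (μ := volume)
    (fun x => ‖(shrinkingBump N k).normed volume x‖ₑ) y]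
  have h := ofReal_integral_eq_lintegral_ofReal (μ := volume)
    (shrinkingBump N k).integrable_normed
    (Eventually.of_forall (shrinkingBump N k).nonneg_normed)
  rw [(shrinkingBump N k).integral_normed, ENNReal.ofReal_one] at h
  rw [h]
  refine lintegral_congr fun x => ?_
  rw [← ofReal_norm, Real.norm_of_nonneg ((shrinkingBump N k).nonneg_normed x)]

/-- Young's inequality for a kernel of mass one, by Tonelli. -/
lemma lintegral_enorm_mollify_le (k : ℕ) (hf : Integrable f) :
    ∫⁻ x, ‖mollify k f x‖ₑ ≤ ∫⁻ x, ‖f x‖ₑ := by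
  calc ∫⁻ x, ‖mollify k f x‖ₑ
      ≤ ∫⁻ x, ∫⁻ y, ‖(shrinkingBump N k).normed volume (x - y)‖ₑ * ‖f y‖ₑ := by
        refine lintegral_mono fun x => ?_
        simp only [mollify_apply, ← enorm_smul]
        exact enorm_integral_le_lintegral_enorm _
    _ = ∫⁻ y, ∫⁻ x, ‖(shrinkingBump N k).normed volume (x - y)‖ₑ * ‖f y‖ₑ := by
        refine lintegral_lintegral_swap ?_
        refine AEMeasurable.mul ?_ (hf.1.enorm.comp_quasiMeasurePreserving
          Measure.quasiMeasurePreserving_snd)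
        exact (((shrinkingBump N k).continuous_normed.comp
          (continuous_fst.sub continuous_snd)).enorm).measurable.aemeasurable
    _ = ∫⁻ y, ‖f y‖ₑ := by
        refine lintegral_congr fun y => ?_
        rw [lintegral_mul_const' _ _ enorm_ne_top, lintegral_shrinkingBump, one_mul]

lemma tendsto_lintegral_mollify_sub [CompleteSpace F] (hf : Integrable f) :
    Tendsto (fun k => ∫⁻ x, ‖mollify k f x - f x‖ₑ) atTop (𝓝 0) :=
  tendsto_lintegral_enorm_sub_of_ae (fun k => integrable_mollify k hf) hf (ae_tendsto_mollify hf)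
    fun k => lintegral_enorm_mollify_le k hf

lemma contDiff_mollify (k : ℕ) (hf : Integrable f) : ContDiff ℝ ∞ (mollify k f) :=
  (shrinkingBump N k).hasCompactSupport_normed.contDiff_convolution_left _
    (shrinkingBump N k).contDiff_normed hf.locallyIntegrable

lemma norm_mollify_le {M : ℝ} (k : ℕ) (hM : ∀ᵐ x, ‖f x‖ ≤ M)
    (x : EuclideanSpace ℝ (Fin N)) : ‖mollify k f x‖ ≤ M := by
  rw [mollify_apply]
  have hint : Integrable fun y => (shrinkingBump N k).normed volume (x - y) :=
    (shrinkingBump N k).integrable_normed.comp_sub_left x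
  calc ‖∫ y, (shrinkingBump N k).normed volume (x - y) • f y‖
      ≤ ∫ y, (shrinkingBump N k).normed volume (x - y) * M := by
        refine norm_integral_le_of_norm_le (hint.mul_const M) (hM.mono fun y hy => ?_)
        rw [norm_smul, Real.norm_of_nonneg ((shrinkingBump N k).nonneg_normed _)]
        exact mul_le_mul_of_nonneg_left hy ((shrinkingBump N k).nonneg_normed _)
    _ = M := by
        rw [integral_mul_const, integral_sub_left_eq_self _ volume x,
          (shrinkingBump N k).integral_normed, one_mul]

variable {Ω : Set (EuclideanSpace ℝ (Fin N))} {i : Fin N} {u g : EuclideanSpace ℝ (Fin N) → F}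

lemma fderiv_mollify_apply (k : ℕ) (hf : Integrable f) (x e : EuclideanSpace ℝ (Fin N)) :
    fderiv ℝ (mollify k f) x e =
      ∫ y, fderiv ℝ ((shrinkingBump N k).normed volume) (x - y) e • f y := by
  set ψ := (shrinkingBump N k).normed (volume : Measure (EuclideanSpace ℝ (Fin N)))
  have hψc : HasCompactSupport ψ := (shrinkingBump N k).hasCompactSupport_normed
  have hψ : ContDiff ℝ 1 ψ := (shrinkingBump N k).contDiff_normed
  have h := hψc.hasFDerivAt_convolution_left (lsmul ℝ ℝ) hψ hf.locallyIntegrable x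
  have hex : ConvolutionExistsAt (fderiv ℝ ψ) f x
      ((lsmul ℝ ℝ : ℝ →L[ℝ] F →L[ℝ] F).precompL (EuclideanSpace ℝ (Fin N))) volume :=
    (hψc.fderiv ℝ).convolutionExists_left _ (hψ.continuous_fderiv one_ne_zero)
      hf.locallyIntegrable x
  rw [mollify, h.fderiv, convolution_eq_swap,
    ContinuousLinearMap.integral_apply hex.integrable_swap]
  rfl

/-- The translated and reflected bump `y ↦ ψ (x - y)` is an admissible test function once the closed
ball lies in `Ω`. Its reflection contributes a sign that cancels the one in the weak formulation. -/
lemma HasWeakPartial.fderiv_mollify (hΩ : MeasurableSet Ω) (hu : HasWeakPartial Ω i u g) (k : ℕ)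
    {x : EuclideanSpace ℝ (Fin N)}
    (hx : Metric.closedBall x (shrinkingBump N k).rOut ⊆ Ω) :
    fderiv ℝ (mollify k (Ω.indicator u)) x (EuclideanSpace.single i 1) =
      mollify k (Ω.indicator g) x := by
  rw [fderiv_mollify_apply k (hu.integrableOn_fun.integrable_indicator hΩ), mollify_apply]
  set ψ := (shrinkingBump N k).normed (volume : Measure (EuclideanSpace ℝ (Fin N))) with hψdef
  have hψ : ContDiff ℝ ∞ ψ := (shrinkingBump N k).contDiff_normed
  have hη : ContDiff ℝ ∞ fun y => ψ (x - y) := hψ.comp (contDiff_const.sub contDiff_id)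
  have hts : tsupport (fun y => ψ (x - y)) ⊆ Metric.closedBall x (shrinkingBump N k).rOut := by
    refine closure_minimal (fun y hy => ?_) Metric.isClosed_closedBall
    have : x - y ∈ Metric.ball (0 : EuclideanSpace ℝ (Fin N)) (shrinkingBump N k).rOut := by
      rw [← (shrinkingBump N k).support_normed_eq (μ := volume)]
      exact hy
    rw [mem_ball_zero_iff] at this
    rw [Metric.mem_closedBall, dist_comm, dist_eq_norm]
    exact this.le
  have hc : HasCompactSupport fun y => ψ (x - y) :=
    (isCompact_closedBall _ _).of_isClosed_subset (isClosed_tsupport _) hts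
  have key := hu.integral_eq _ hη hc (hts.trans hx)
  have hd : ∀ y, fderiv ℝ (fun y => ψ (x - y)) y (EuclideanSpace.single i 1) =
      -fderiv ℝ ψ (x - y) (EuclideanSpace.single i 1) := by
    intro y
    have h1 : HasFDerivAt (fun y => x - y)
        (-ContinuousLinearMap.id ℝ (EuclideanSpace ℝ (Fin N))) y :=
      (hasFDerivAt_id y).const_sub x
    have h2 := ((hψ.differentiable (by simp)) (x - y)).hasFDerivAt.comp y h1
    have h3 : fderiv ℝ (fun y => ψ (x - y)) y = _ := h2.fderiv
    rw [h3]
    simp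
  simp only [hd, neg_smul, integral_neg, neg_inj] at key
  have e1 : ∀ (a : EuclideanSpace ℝ (Fin N) → ℝ) (w : EuclideanSpace ℝ (Fin N) → F),
      ∫ y, a y • Ω.indicator w y = ∫ y in Ω, a y • w y := by
    intro a w
    rw [← integral_indicator hΩ]
    refine integral_congr_ae (Eventually.of_forall fun y => ?_)
    by_cases hy : y ∈ Ω <;> simp [hy]
  rw [e1, e1, key]

lemma eventually_closedBall_shrinkingBump_subset (hΩ : IsOpen Ω)
    {K : Set (EuclideanSpace ℝ (Fin N))} (hK : IsCompact K) (hKΩ : K ⊆ Ω) :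
    ∀ᶠ k in atTop, ∀ x ∈ K, Metric.closedBall x (shrinkingBump N k).rOut ⊆ Ω := by
  obtain ⟨δ, hδ, hsub⟩ := hK.exists_cthickening_subset_open hΩ hKΩ
  filter_upwards [tendsto_shrinkingBump_rOut.eventually (gt_mem_nhds hδ)] with k hk x hx
  exact ((Metric.closedBall_subset_closedBall hk.le).trans
    (Metric.closedBall_subset_cthickening hx δ)).trans hsub

lemma HasWeakPartial.tendsto_fderiv_mollify [CompleteSpace F] (hΩ : IsOpen Ω)
    (hu : HasWeakPartial Ω i u g)
    {K : Set (EuclideanSpace ℝ (Fin N))} (hK : IsCompact K) (hKΩ : K ⊆ Ω) :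
    Tendsto (fun k => ∫⁻ x in K, ‖fderiv ℝ (mollify k (Ω.indicator u)) x
      (EuclideanSpace.single i 1) - g x‖ₑ) atTop (𝓝 0) := by
  have h1 := tendsto_lintegral_mollify_sub
    (hu.integrableOn_grad.integrable_indicator hΩ.measurableSet)
  refine tendsto_of_tendsto_of_tendsto_of_le_of_le' tendsto_const_nhds h1
    (Eventually.of_forall fun _ => zero_le) ?_
  filter_upwards [eventually_closedBall_shrinkingBump_subset hΩ hK hKΩ] with k hk
  refine le_trans (le_of_eq ?_) (setLIntegral_le_lintegral K _)
  refine setLIntegral_congr_fun hK.measurableSet fun x hx => ?_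
  rw [hu.fderiv_mollify hΩ.measurableSet k (hk x hx), indicator_of_mem (hKΩ hx)]

end Mollification

/-! ### Chain and product rules for `C¹` outer functions -/

section ChainRule

variable {N : ℕ} {F G : Type*} [NormedAddCommGroup F] [NormedSpace ℝ F] [CompleteSpace F]
  [NormedAddCommGroup G] [NormedSpace ℝ G] [CompleteSpace G]
  {Ω : Set (EuclideanSpace ℝ (Fin N))} {i : Fin N} {u g : EuclideanSpace ℝ (Fin N) → F}

-- The set `S` contains the values of `u` and of all its mollifications, so bounds on `Φ` and its
-- derivative are needed on `S` only. Taking `S` to be a ball serves bounded `u` (products); taking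
-- everything serves bounded `Φ` (the exponential).
omit [CompleteSpace G] in
lemma HasWeakPartial.comp_of_mollify_mem (hΩ : IsOpen Ω) (hfin : volume Ω ≠ ⊤)
    (hu : HasWeakPartial Ω i u g)
    {Φ : F → G} (hΦ : ContDiff ℝ 1 Φ) {S : Set F} {B C : ℝ}
    (hB : ∀ y ∈ S, ‖Φ y‖ ≤ B) (hC : ∀ y ∈ S, ‖fderiv ℝ Φ y‖ ≤ C)
    (huS : ∀ᵐ x ∂volume.restrict Ω, u x ∈ S) (hmS : ∀ k x, mollify k (Ω.indicator u) x ∈ S) :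
    HasWeakPartial Ω i (fun x => Φ (u x)) (fun x => fderiv ℝ Φ (u x) (g x)) := by
  have : IsFiniteMeasure (volume.restrict Ω) := isFiniteMeasure_restrict.2 hfin
  have hdc : Continuous (fderiv ℝ Φ) := hΦ.continuous_fderiv one_ne_zero
  have hC0 : 0 ≤ C := (norm_nonneg _).trans (hC _ (hmS 0 0))
  have happ : ∀ (w h : EuclideanSpace ℝ (Fin N) → F) (μ : Measure (EuclideanSpace ℝ (Fin N))),
      AEStronglyMeasurable w μ → AEStronglyMeasurable h μ →
      AEStronglyMeasurable (fun x => fderiv ℝ Φ (w x) (h x)) μ := by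
    intro w h μ hw hh
    exact ContinuousLinearMap.aestronglyMeasurable_comp₂
      (ContinuousLinearMap.apply ℝ G : F →L[ℝ] (F →L[ℝ] G) →L[ℝ] G).flip
      (hdc.comp_aestronglyMeasurable hw) hh
  refine ⟨?_, ?_, ?_⟩
  · refine Integrable.mono' (integrable_const B)
      (hΦ.continuous.comp_aestronglyMeasurable hu.integrableOn_fun.1) ?_
    exact huS.mono fun x hx => hB _ hx
  · refine Integrable.mono' (hu.integrableOn_grad.norm.const_mul C)
      (happ _ _ _ hu.integrableOn_fun.1 hu.integrableOn_grad.1) ?_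
    filter_upwards [huS] with x hx
    exact (le_opNorm _ _).trans (mul_le_mul_of_nonneg_right (hC _ hx) (norm_nonneg _))
  intro η hη hc hs
  set K := tsupport η with hKdef
  have hK : IsCompact K := hc
  set us : ℕ → EuclideanSpace ℝ (Fin N) → F := fun k => mollify k (Ω.indicator u) with husdef
  set e : EuclideanSpace ℝ (Fin N) := EuclideanSpace.single i 1
  have hui := hu.integrableOn_fun.integrable_indicator hΩ.measurableSet
  have hsm : ∀ k, ContDiff ℝ ∞ (us k) := fun k => contDiff_mollify k hui
  have hlim : ∀ᵐ x ∂volume.restrict Ω, Tendsto (fun k => us k x) atTop (𝓝 (u x)) := by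
    rw [ae_restrict_iff' hΩ.measurableSet]
    filter_upwards [ae_tendsto_mollify hui] with x hx hxΩ
    simpa [indicator_of_mem hxΩ] using hx
  obtain ⟨Cη, hCη0, hCη⟩ := exists_bound_test hη hc
  obtain ⟨Cη', hCη0', hCη'⟩ := exists_bound_fderiv_test hη hc e
  have hΦus : ∀ k, ContDiff ℝ 1 fun x => Φ (us k x) := fun k =>
    hΦ.comp ((hsm k).of_le (by simp))
  have hparts : ∀ k, ∫ x in Ω, fderiv ℝ η x e • Φ (us k x) =
      -∫ x in Ω, η x • fderiv ℝ Φ (us k x) (fderiv ℝ (us k) x e) := by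
    intro k
    rw [setIntegral_eq_integral_of_forall_compl_eq_zero fun x hx => by
        rw [image_eq_zero_of_notMem_tsupport fun hx' => hx (hs (tsupport_fderiv_apply_subset ℝ e hx')),
          zero_smul],
      setIntegral_eq_integral_of_forall_compl_eq_zero fun x hx => by
        rw [image_eq_zero_of_notMem_tsupport fun hx' => hx (hs hx'), zero_smul]]
    have hfd : ∀ x, fderiv ℝ (fun x => Φ (us k x)) x e =
        fderiv ℝ Φ (us k x) (fderiv ℝ (us k) x e) := by
      intro x
      have h1 := ((hΦ.differentiable one_ne_zero) (us k x)).hasFDerivAt.comp x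
        (((hsm k).differentiable (by simp)) x).hasFDerivAt
      have h2 : fderiv ℝ (fun x => Φ (us k x)) x = _ := h1.fderiv
      rw [h2]; rfl
    have hcont : Continuous fun x => fderiv ℝ (fun x => Φ (us k x)) x e :=
      ((hΦus k).continuous_fderiv one_ne_zero).clm_apply continuous_const
    have := integral_smul_fderiv_eq_neg_fderiv_smul_of_integrable (μ := volume) (f := η)
      (g := fun x => Φ (us k x)) (v := e)
      (((continuous_fderiv_test hη e).smul (hΦus k).continuous).integrable_of_hasCompactSupport
        (hc.fderiv_apply (𝕜 := ℝ) e).smul_right)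
      ((hη.continuous.smul hcont).integrable_of_hasCompactSupport hc.smul_right)
      ((hη.continuous.smul (hΦus k).continuous).integrable_of_hasCompactSupport hc.smul_right)
      (fun x _ => (hη.differentiable (by simp)) x)
      (fun x _ => ((hΦus k).differentiable one_ne_zero) x)
    simp only [hfd] at this
    rw [this, neg_neg]
  have l1 : Tendsto (fun k => ∫ x in Ω, fderiv ℝ η x e • Φ (us k x)) atTop
      (𝓝 (∫ x in Ω, fderiv ℝ η x e • Φ (u x))) := by
    refine tendsto_integral_of_dominated_convergence (fun _ => Cη' * B) (fun k => ?_)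
      (integrable_const _) (fun k => ?_) ?_
    · exact ((continuous_fderiv_test hη e).smul (hΦus k).continuous).aestronglyMeasurable
    · refine Eventually.of_forall fun x => ?_
      rw [norm_smul]
      exact mul_le_mul (hCη' x) (hB _ (hmS k x)) (norm_nonneg _) hCη0'
    · filter_upwards [hlim] with x hx
      exact ((hΦ.continuous.tendsto _).comp hx).const_smul _
  -- The derivative of `Φ ∘ u_k` is split as `Φ'(u_k) g + Φ'(u_k)(∂u_k - g)`. The first summand
  -- converges by dominated convergence; the second (`l3`) is controlled by the `L¹` convergence of
  -- mollified gradients on the support of `η`.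
  have l2 : Tendsto (fun k => ∫ x in Ω, η x • fderiv ℝ Φ (us k x) (g x)) atTop
      (𝓝 (∫ x in Ω, η x • fderiv ℝ Φ (u x) (g x))) := by
    refine tendsto_integral_of_dominated_convergence (fun x => Cη * (C * ‖g x‖)) (fun k => ?_)
      ((hu.integrableOn_grad.norm.const_mul C).const_mul Cη) (fun k => ?_) ?_
    · exact hη.continuous.aestronglyMeasurable.smul
        (happ _ _ _ (hsm k).continuous.aestronglyMeasurable hu.integrableOn_grad.1)
    · refine Eventually.of_forall fun x => ?_
      rw [norm_smul]
      exact mul_le_mul (hCη x) ((le_opNorm _ _).trans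
        (mul_le_mul_of_nonneg_right (hC _ (hmS k x)) (norm_nonneg _))) (norm_nonneg _) hCη0
    · filter_upwards [hlim] with x hx
      have h1 : Tendsto (fun k => fderiv ℝ Φ (us k x)) atTop (𝓝 (fderiv ℝ Φ (u x))) :=
        (hdc.tendsto _).comp hx
      exact ((((ContinuousLinearMap.apply ℝ G (g x)).continuous.tendsto _).comp h1)).const_smul _
  have l3 : Tendsto (fun k => ∫ x in Ω, η x • fderiv ℝ Φ (us k x) (fderiv ℝ (us k) x e - g x))
      atTop (𝓝 0) := by
    have h0 := hu.tendsto_fderiv_mollify hΩ hK hs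
    have h3 : Tendsto (fun k => ENNReal.ofReal (Cη * C) * ∫⁻ x in K,
        ‖fderiv ℝ (us k) x e - g x‖ₑ) atTop (𝓝 0) := by
      simpa using ENNReal.Tendsto.const_mul h0 (Or.inr (ENNReal.ofReal_ne_top (r := Cη * C)))
    rw [tendsto_zero_iff_enorm_tendsto_zero]
    refine tendsto_of_tendsto_of_tendsto_of_le_of_le tendsto_const_nhds h3
      (fun _ => zero_le) fun k => ?_
    refine (enorm_integral_le_lintegral_enorm _).trans ?_
    rw [← lintegral_const_mul' _ _ ENNReal.ofReal_ne_top]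
    calc ∫⁻ x in Ω, ‖η x • fderiv ℝ Φ (us k x) (fderiv ℝ (us k) x e - g x)‖ₑ
        ≤ ∫⁻ x in Ω, K.indicator (fun x => ENNReal.ofReal (Cη * C) *
            ‖fderiv ℝ (us k) x e - g x‖ₑ) x := by
          refine lintegral_mono fun x => ?_
          by_cases hx : x ∈ K
          · rw [indicator_of_mem hx, ← ofReal_norm, ← ofReal_norm,
              ← ENNReal.ofReal_mul (mul_nonneg hCη0 hC0), norm_smul, mul_assoc]
            refine ENNReal.ofReal_le_ofReal ?_
            exact mul_le_mul (hCη x) ((le_opNorm _ _).trans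
              (mul_le_mul_of_nonneg_right (hC _ (hmS k x)) (norm_nonneg _))) (norm_nonneg _) hCη0
          · rw [image_eq_zero_of_notMem_tsupport hx, zero_smul, enorm_zero]
            exact zero_le
      _ ≤ ∫⁻ x, K.indicator (fun x => ENNReal.ofReal (Cη * C) *
            ‖fderiv ℝ (us k) x e - g x‖ₑ) x := setLIntegral_le_lintegral _ _
      _ = _ := lintegral_indicator hK.measurableSet _
  have l4 : Tendsto (fun k => ∫ x in Ω, η x • fderiv ℝ Φ (us k x) (fderiv ℝ (us k) x e))
      atTop (𝓝 (∫ x in Ω, η x • fderiv ℝ Φ (u x) (g x))) := by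
    have := l3.add l2
    rw [zero_add] at this
    refine this.congr fun k => ?_
    have i1 : Integrable (fun x => η x • fderiv ℝ Φ (us k x) (fderiv ℝ (us k) x e))
        (volume.restrict Ω) := by
      have hcont : Continuous fun x => η x • fderiv ℝ Φ (us k x) (fderiv ℝ (us k) x e) :=
        hη.continuous.smul ((hdc.comp (hsm k).continuous).clm_apply
          (((hsm k).continuous_fderiv (by simp)).clm_apply continuous_const))
      exact (hcont.integrable_of_hasCompactSupport hc.smul_right).restrict
    have i2 : Integrable (fun x => η x • fderiv ℝ Φ (us k x) (g x)) (volume.restrict Ω) := by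
      refine integrable_test_smul hη hc (Integrable.mono' (hu.integrableOn_grad.norm.const_mul C)
        (happ _ _ _ (hsm k).continuous.aestronglyMeasurable hu.integrableOn_grad.1) ?_)
      exact Eventually.of_forall fun x => (le_opNorm _ _).trans
        (mul_le_mul_of_nonneg_right (hC _ (hmS k x)) (norm_nonneg _))
    simp only [map_sub, smul_sub]
    rw [integral_sub i1 i2, sub_add_cancel]
  exact tendsto_nhds_unique (l1.congr hparts) l4.neg

omit [CompleteSpace G] in
/-- Chain rule for a bounded function. -/
lemma HasWeakPartial.comp_of_norm_le (hΩ : IsOpen Ω) (hfin : volume Ω ≠ ⊤)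
    (hu : HasWeakPartial Ω i u g) {Φ : F → G} (hΦ : ContDiff ℝ 1 Φ) {M B C : ℝ} (hM : 0 ≤ M)
    (huM : ∀ᵐ x ∂volume.restrict Ω, ‖u x‖ ≤ M)
    (hB : ∀ y, ‖y‖ ≤ M → ‖Φ y‖ ≤ B) (hC : ∀ y, ‖y‖ ≤ M → ‖fderiv ℝ Φ y‖ ≤ C) :
    HasWeakPartial Ω i (fun x => Φ (u x)) (fun x => fderiv ℝ Φ (u x) (g x)) := by
  refine hu.comp_of_mollify_mem hΩ hfin hΦ (S := {y | ‖y‖ ≤ M}) hB hC huM fun k x => ?_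
  refine norm_mollify_le k ?_ x
  rw [ae_restrict_iff' hΩ.measurableSet] at huM
  filter_upwards [huM] with y hy
  by_cases h : y ∈ Ω
  · simpa [indicator_of_mem h] using hy h
  · simpa [indicator_of_notMem h] using hM

omit [CompleteSpace G] in
/-- Chain rule for a bounded outer function with bounded derivative. -/
lemma HasWeakPartial.comp_of_bounded (hΩ : IsOpen Ω) (hfin : volume Ω ≠ ⊤)
    (hu : HasWeakPartial Ω i u g) {Φ : F → G} (hΦ : ContDiff ℝ 1 Φ) {B C : ℝ}
    (hB : ∀ y, ‖Φ y‖ ≤ B) (hC : ∀ y, ‖fderiv ℝ Φ y‖ ≤ C) :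
    HasWeakPartial Ω i (fun x => Φ (u x)) (fun x => fderiv ℝ Φ (u x) (g x)) :=
  hu.comp_of_mollify_mem hΩ hfin hΦ (S := univ) (fun y _ => hB y) (fun y _ => hC y)
    (Eventually.of_forall fun _ => mem_univ _) fun _ _ => mem_univ _

lemma HasWeakPartial.prodMk {v h : EuclideanSpace ℝ (Fin N) → G}
    (hu : HasWeakPartial Ω i u g) (hv : HasWeakPartial Ω i v h) :
    HasWeakPartial Ω i (fun x => (u x, v x)) (fun x => (g x, h x)) := by
  simpa using (hu.clm_comp (ContinuousLinearMap.inl ℝ F G)).add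
    (hv.clm_comp (ContinuousLinearMap.inr ℝ F G))

/-- Leibniz rule for bounded functions. -/
lemma HasWeakPartial.mul {A : Type*} [NormedRing A] [NormedAlgebra ℝ A] [CompleteSpace A]
    {u g v h : EuclideanSpace ℝ (Fin N) → A} (hΩ : IsOpen Ω) (hfin : volume Ω ≠ ⊤)
    (hu : HasWeakPartial Ω i u g) (hv : HasWeakPartial Ω i v h) {M : ℝ} (hM : 0 ≤ M)
    (huM : ∀ᵐ x ∂volume.restrict Ω, ‖u x‖ ≤ M) (hvM : ∀ᵐ x ∂volume.restrict Ω, ‖v x‖ ≤ M) :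
    HasWeakPartial Ω i (fun x => u x * v x) (fun x => u x * h x + g x * v x) := by
  have hΦ : ContDiff ℝ 1 fun p : A × A => p.1 * p.2 := contDiff_fst.mul contDiff_snd
  have hd : ∀ p q : A × A, fderiv ℝ (fun p : A × A => p.1 * p.2) p q =
      p.1 * q.2 + q.1 * p.2 := by
    intro p q
    have := (hasFDerivAt_fst (𝕜 := ℝ) (p := p)).mul' (hasFDerivAt_snd (𝕜 := ℝ) (p := p))
    have h2 : fderiv ℝ (fun p : A × A => p.1 * p.2) p = _ := this.fderiv
    rw [h2]
    simp
  have := (hu.prodMk hv).comp_of_norm_le hΩ hfin hΦ hM (B := M * M) (C := M + M) ?_ ?_ ?_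
  · simpa only [hd] using this
  · filter_upwards [huM, hvM] with x hx hx'
    exact max_le hx hx'
  · intro p hp
    exact (norm_mul_le _ _).trans (mul_le_mul ((norm_fst_le p).trans hp)
      ((norm_snd_le p).trans hp) (norm_nonneg _) hM)
  · intro p hp
    refine opNorm_le_bound _ (add_nonneg hM hM) fun q => ?_
    rw [hd, add_mul]
    refine (norm_add_le _ _).trans (add_le_add ?_ ?_)
    · exact (norm_mul_le _ _).trans (mul_le_mul ((norm_fst_le p).trans hp) (norm_snd_le q)
        (norm_nonneg _) hM)
    · rw [mul_comm M]
      exact (norm_mul_le _ _).trans (mul_le_mul (norm_fst_le q) ((norm_snd_le p).trans hp)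
        (norm_nonneg _) (norm_nonneg _))

/-- Chain rule for the complex exponential of a real function. -/
lemma HasWeakPartial.cexp_mul_I {φ Z : EuclideanSpace ℝ (Fin N) → ℝ} (hΩ : IsOpen Ω)
    (hfin : volume Ω ≠ ⊤) (hφ : HasWeakPartial Ω i φ Z) :
    HasWeakPartial Ω i (fun x => Complex.exp (φ x * Complex.I))
      (fun x => Complex.I * Complex.exp (φ x * Complex.I) * Z x) := by
  have hΦ : ContDiff ℝ 1 fun t : ℝ => Complex.exp (t * Complex.I) :=
    (Complex.ofRealCLM.contDiff.mul contDiff_const).cexp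
  have hd : ∀ t : ℝ, HasDerivAt (fun t : ℝ => Complex.exp (t * Complex.I))
      (Complex.exp (t * Complex.I) * (1 * Complex.I)) t := fun t =>
    ((Complex.ofRealCLM.hasDerivAt (x := t)).mul_const Complex.I).cexp
  have hf : ∀ t s : ℝ, fderiv ℝ (fun t : ℝ => Complex.exp (t * Complex.I)) t s =
      Complex.I * Complex.exp (t * Complex.I) * s := by
    intro t s
    rw [(hd t).hasFDerivAt.fderiv]
    simp
    ring
  have := hφ.comp_of_bounded hΩ hfin hΦ (B := 1) (C := 1)
    (fun t => (Complex.norm_exp_ofReal_mul_I t).le) ?_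
  · simpa only [hf] using this
  · intro t
    refine opNorm_le_bound _ zero_le_one fun s => ?_
    rw [hf, norm_mul, norm_mul, Complex.norm_I, Complex.norm_exp_ofReal_mul_I, Complex.norm_real]
    simp

end ChainRule

/-! ### Phase gradients of circle-valued maps -/

section Phase

variable {N : ℕ} {Ω : Set (EuclideanSpace ℝ (Fin N))} {i : Fin N}
  {u v : EuclideanSpace ℝ (Fin N) → Circle} {X Y : EuclideanSpace ℝ (Fin N) → ℝ}

/-- `X` is the `i`-th component of the phase gradient of `u`: `∂ᵢ u = i u X`. -/
structure HasPhase (Ω : Set (EuclideanSpace ℝ (Fin N))) (i : Fin N)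
    (u : EuclideanSpace ℝ (Fin N) → Circle) (X : EuclideanSpace ℝ (Fin N) → ℝ) : Prop where
  integrableOn : IntegrableOn X Ω
  weakPartial : HasWeakPartial Ω i (fun x => (u x : ℂ)) (fun x => Complex.I * u x * X x)

lemma norm_phase (z : Circle) (t : ℝ) : ‖Complex.I * z * t‖ = |t| := by simp [Circle.norm_coe]

lemma ae_norm_circle_le {μ : Measure (EuclideanSpace ℝ (Fin N))} :
    ∀ᵐ x ∂μ, ‖(u x : ℂ)‖ ≤ 1 := Eventually.of_forall fun _ => (Circle.norm_coe _).le

namespace HasPhase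

lemma mul (hΩ : IsOpen Ω) (hfin : volume Ω ≠ ⊤) (hu : HasPhase Ω i u X) (hv : HasPhase Ω i v Y) :
    HasPhase Ω i (fun x => u x * v x) (fun x => X x + Y x) where
  integrableOn := hu.integrableOn.add hv.integrableOn
  weakPartial := by
    have := hu.weakPartial.mul hΩ hfin hv.weakPartial zero_le_one
      ae_norm_circle_le ae_norm_circle_le
    refine this.congr_ae (Eventually.of_forall fun x => by simp) (Eventually.of_forall fun x => ?_)
    simp only [Circle.coe_mul, Complex.ofReal_add]
    ring

lemma inv (hu : HasPhase Ω i u X) : HasPhase Ω i (fun x => (u x)⁻¹) (fun x => -X x) where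
  integrableOn := hu.integrableOn.neg
  weakPartial := by
    have := hu.weakPartial.clm_comp Complex.conjCLE.toContinuousLinearMap
    refine this.congr_ae (Eventually.of_forall fun x => ?_) (Eventually.of_forall fun x => ?_)
    · simp only [Circle.coe_inv_eq_conj]; rfl
    · simp only [Circle.coe_inv_eq_conj]
      simp

lemma one (hfin : volume Ω ≠ ⊤) :
    HasPhase Ω i (fun _ => (1 : Circle)) (fun _ => 0) where
  integrableOn := integrableOn_zero
  weakPartial := by simpa using HasWeakPartial.const hfin i (1 : ℂ)

lemma exp (hΩ : IsOpen Ω) (hfin : volume Ω ≠ ⊤) (hX : HasWeakPartial Ω i X Y) :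
    HasPhase Ω i (fun x => Circle.exp (X x)) Y where
  integrableOn := hX.integrableOn_grad
  weakPartial := by simpa only [Circle.coe_exp] using hX.cexp_mul_I hΩ hfin

lemma congr_fun_ae (hu : HasPhase Ω i u X) (h : u =ᵐ[volume.restrict Ω] v) :
    HasPhase Ω i v X where
  integrableOn := hu.integrableOn
  weakPartial := hu.weakPartial.congr_ae (h.mono fun x hx => by simp [hx])
    (h.mono fun x hx => by simp [hx])

lemma congr_phase (hu : HasPhase Ω i u X) (h : ∀ x, X x = Y x) : HasPhase Ω i u Y := by
  rwa [← funext h]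

lemma pow (hΩ : IsOpen Ω) (hfin : volume Ω ≠ ⊤) (hu : HasPhase Ω i u X) (n : ℕ) :
    HasPhase Ω i (fun x => u x ^ n) (fun x => n * X x) := by
  induction n with
  | zero => simpa using one hfin
  | succ n ih =>
    simp only [pow_succ]
    exact (ih.mul hΩ hfin hu).congr_phase fun x => by push_cast; ring

lemma zpow (hΩ : IsOpen Ω) (hfin : volume Ω ≠ ⊤) (hu : HasPhase Ω i u X) (n : ℤ) :
    HasPhase Ω i (fun x => u x ^ n) (fun x => n * X x) := by
  obtain ⟨m, rfl | rfl⟩ := n.eq_nat_or_neg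
  · simpa using hu.pow hΩ hfin m
  · simpa using (hu.pow hΩ hfin m).inv

end HasPhase

/-- Differentiating `ū u = 1` shows that the real part of `ū ∂ᵢu` vanishes almost everywhere, so the
imaginary part carries the whole derivative. -/
lemma exists_hasPhase (hΩ : IsOpen Ω) (hfin : volume Ω ≠ ⊤) (hu : u ∈ W11Circle Ω) :
    ∃ X : Fin N → EuclideanSpace ℝ (Fin N) → ℝ, ∀ i, HasPhase Ω i u (X i) := by
  obtain ⟨G, hG⟩ := MemW11.exists_hasWeakPartial hu
  refine ⟨fun i x => ((starRingEnd ℂ) (u x) * G i x).im, fun i => ?_⟩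
  have hc := (hG i).clm_comp Complex.conjCLE.toContinuousLinearMap
  have hm := hc.mul hΩ hfin (hG i) zero_le_one
    (Eventually.of_forall fun x => by simp [Circle.norm_coe]) ae_norm_circle_le
  have h1 := (hm.congr_ae (v := fun _ => (1 : ℂ)) (Eventually.of_forall fun x => by
    simp [← Complex.normSq_eq_conj_mul_self]) EventuallyEq.rfl).ae_eq hΩ
      (HasWeakPartial.const hfin i (1 : ℂ))
  have hmeas : AEStronglyMeasurable (fun x => (starRingEnd ℂ) (u x) * G i x)
      (volume.restrict Ω) :=
    (Complex.continuous_conj.comp_aestronglyMeasurable (hG i).integrableOn_fun.1).mul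
      (hG i).integrableOn_grad.1
  refine ⟨?_, (hG i).congr_ae EventuallyEq.rfl ?_⟩
  · refine Integrable.mono (hG i).integrableOn_grad
      (Complex.continuous_im.comp_aestronglyMeasurable hmeas) (Eventually.of_forall fun x => ?_)
    refine (Complex.abs_im_le_norm _).trans ?_
    simp [Circle.norm_coe]
  · filter_upwards [h1] with x hx
    set w : ℂ := (starRingEnd ℂ) (u x) * G i x with hw
    have hre : w.re = 0 := by
      have h2 : w + (starRingEnd ℂ) w = 0 := by
        rw [← hx, hw]
        simp
        ring
      have := congrArg Complex.re h2
      simp at this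
      linarith
    have h3 : w = Complex.I * w.im := by
      conv_lhs => rw [← Complex.re_add_im w, hre]
      simp [mul_comm]
    have h4 : G i x = u x * w := by
      rw [hw, ← mul_assoc, Complex.mul_conj]
      simp
    rw [h4, mul_assoc, mul_comm Complex.I, mul_assoc, mul_comm _ Complex.I, ← h3]

lemma integrableOn_circle (hfin : volume Ω ≠ ⊤)
    (hu : AEStronglyMeasurable (fun x => (u x : ℂ)) (volume.restrict Ω)) :
    IntegrableOn (fun x => (u x : ℂ)) Ω := by
  have : IsFiniteMeasure (volume.restrict Ω) := isFiniteMeasure_restrict.2 hfin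
  exact Integrable.mono' (integrable_const 1) hu ae_norm_circle_le

end Phase

/-! ### Chain rule for Lipschitz maps on the circle -/

section CircleChainRule

variable {N : ℕ} {Ω : Set (EuclideanSpace ℝ (Fin N))} {i : Fin N}
  {u : EuclideanSpace ℝ (Fin N) → Circle} {X : EuclideanSpace ℝ (Fin N) → ℝ}

lemma fact_two_pi_pos : Fact (0 < 2 * Real.pi) := ⟨Real.two_pi_pos⟩

attribute [local instance] fact_two_pi_pos

/-- The mean of a function on the circle `ℝ / 2πℤ`. -/
noncomputable def circleMean (h : C(AddCircle (2 * Real.pi), ℂ)) : ℂ :=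
  (∫ s in (0 : ℝ)..2 * Real.pi, h s) / (2 * Real.pi)

/-- The primitive of `h` minus its mean. -/
noncomputable def circlePrimitive (h : C(AddCircle (2 * Real.pi), ℂ)) (a : ℝ) : ℂ :=
  ∫ s in (0 : ℝ)..a, (h s - circleMean h)

lemma intervalIntegrable_circle (h : C(AddCircle (2 * Real.pi), ℂ)) (a b : ℝ) :
    IntervalIntegrable (fun s : ℝ => h s) volume a b :=
  (h.continuous.comp (AddCircle.continuous_mk' _)).intervalIntegrable _ _

lemma circleMean_add (h k : C(AddCircle (2 * Real.pi), ℂ)) :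
    circleMean (h + k) = circleMean h + circleMean k := by
  simp only [circleMean, ContinuousMap.add_apply]
  rw [intervalIntegral.integral_add (intervalIntegrable_circle _ _ _)
    (intervalIntegrable_circle _ _ _), add_div]

lemma circleMean_smul (c : ℂ) (h : C(AddCircle (2 * Real.pi), ℂ)) :
    circleMean (c • h) = c * circleMean h := by
  simp only [circleMean, ContinuousMap.smul_apply, smul_eq_mul]
  rw [intervalIntegral.integral_const_mul, mul_div_assoc]

lemma circlePrimitive_add (h k : C(AddCircle (2 * Real.pi), ℂ)) (a : ℝ) :
    circlePrimitive (h + k) a = circlePrimitive h a + circlePrimitive k a := by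
  simp only [circlePrimitive]
  rw [← intervalIntegral.integral_add
    ((intervalIntegrable_circle _ _ _).sub intervalIntegrable_const)
    ((intervalIntegrable_circle _ _ _).sub intervalIntegrable_const)]
  refine intervalIntegral.integral_congr fun s _ => ?_
  simp only [ContinuousMap.add_apply, circleMean_add]
  ring

lemma circlePrimitive_smul (c : ℂ) (h : C(AddCircle (2 * Real.pi), ℂ)) (a : ℝ) :
    circlePrimitive (c • h) a = c * circlePrimitive h a := by
  simp only [circlePrimitive]
  rw [← intervalIntegral.integral_const_mul]
  refine intervalIntegral.integral_congr fun s _ => ?_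
  simp only [ContinuousMap.smul_apply, circleMean_smul, smul_eq_mul]
  ring

lemma norm_circleMean_le (h : C(AddCircle (2 * Real.pi), ℂ)) : ‖circleMean h‖ ≤ ‖h‖ := by
  have h1 : ‖∫ s in (0 : ℝ)..2 * Real.pi, h s‖ ≤ ‖h‖ * |2 * Real.pi - 0| :=
    intervalIntegral.norm_integral_le_of_norm_le_const fun s _ => h.norm_coe_le_norm s
  rw [sub_zero, abs_of_pos Real.two_pi_pos] at h1
  rw [circleMean, norm_div, div_le_iff₀ (by simp [Real.pi_pos.ne'])]
  simpa [abs_of_pos Real.pi_pos] using h1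

lemma norm_apply_sub_circleMean_le (h : C(AddCircle (2 * Real.pi), ℂ)) (s : ℝ) :
    ‖h s - circleMean h‖ ≤ 2 * ‖h‖ := by
  have := norm_sub_le (h s) (circleMean h)
  linarith [h.norm_coe_le_norm s, norm_circleMean_le h]

lemma norm_circlePrimitive_le (h : C(AddCircle (2 * Real.pi), ℂ)) {a : ℝ} (ha : |a| ≤ Real.pi) :
    ‖circlePrimitive h a‖ ≤ 2 * ‖h‖ * Real.pi := by
  have h1 : ‖circlePrimitive h a‖ ≤ 2 * ‖h‖ * |a - 0| :=
    intervalIntegral.norm_integral_le_of_norm_le_const fun s _ => norm_apply_sub_circleMean_le h s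
  rw [sub_zero] at h1
  exact h1.trans (mul_le_mul_of_nonneg_left ha (by positivity))

lemma cexp_arg (z : Circle) : Complex.exp (Complex.arg z * Complex.I) = z := by
  rw [← Circle.coe_exp, Circle.exp_arg]

/-- For `n ≠ 0` the mean is zero and the primitive at `arg u` is `(uⁿ - 1)/(in)`, so the product
rule for powers suffices; for `n = 0` the centred function is zero. The discontinuous function `arg`
is never differentiated. -/
lemma HasPhase.circlePrimitive_fourier (hΩ : IsOpen Ω) (hfin : volume Ω ≠ ⊤)
    (hu : HasPhase Ω i u X) (n : ℤ) :
    HasWeakPartial Ω i (fun x => circlePrimitive (fourier n) (Complex.arg (u x)))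
      (fun x => ((fourier n : C(AddCircle (2 * Real.pi), ℂ)) (Complex.arg (u x) : ℝ) -
        circleMean (fourier n)) * X x) := by
  have hpi : (Real.pi : ℂ) ≠ 0 := by exact_mod_cast Real.pi_pos.ne'
  have hf : ∀ s : ℝ, (fourier n : C(AddCircle (2 * Real.pi), ℂ)) s =
      Complex.exp (n * Complex.I * s) := by
    intro s
    rw [fourier_coe_apply]
    congr 1
    push_cast
    field_simp
  rcases eq_or_ne n 0 with rfl | hn
  · have hm : circleMean (fourier 0) = 1 := by
      simp only [circleMean, hf]
      simp
    have h1 : ∀ a, circlePrimitive (fourier 0) a = 0 := by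
      intro a
      simp [circlePrimitive, hm]
    simpa [h1, hm] using HasWeakPartial.const hfin i (0 : ℂ)
  · have hnI : (n : ℂ) * Complex.I ≠ 0 := mul_ne_zero (by exact_mod_cast hn) Complex.I_ne_zero
    have hm : circleMean (fourier n) = 0 := by
      simp only [circleMean, hf]
      rw [integral_exp_mul_complex hnI]
      have : Complex.exp (n * Complex.I * (2 * Real.pi : ℝ)) = 1 := by
        rw [Complex.exp_eq_one_iff]
        exact ⟨n, by push_cast; ring⟩
      rw [this]
      simp
    have hexp : ∀ x, Complex.exp (n * Complex.I * (Complex.arg (u x) : ℝ)) = ((u x ^ n : Circle) : ℂ) := by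
      intro x
      rw [Circle.coe_zpow, ← cexp_arg (u x), ← Complex.exp_int_mul, cexp_arg]
      congr 1
      ring
    have h1 : ∀ x, circlePrimitive (fourier n) (Complex.arg (u x)) =
        (n * Complex.I)⁻¹ * ((u x ^ n : Circle) : ℂ) - (n * Complex.I)⁻¹ := by
      intro x
      simp only [circlePrimitive, hm, sub_zero, hf]
      rw [integral_exp_mul_complex hnI, hexp]
      simp only [Complex.ofReal_zero, mul_zero, Complex.exp_zero]
      ring
    have h2 := ((hu.zpow hΩ hfin n).weakPartial.clm_comp
      (ContinuousLinearMap.mul ℝ ℂ (n * Complex.I)⁻¹)).sub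
      (HasWeakPartial.const hfin i (n * Complex.I : ℂ)⁻¹)
    refine h2.congr_ae (Eventually.of_forall fun x => ?_) (Eventually.of_forall fun x => ?_)
    · simp only [h1]; rfl
    · simp only [hm, hf, hexp, sub_zero, ContinuousLinearMap.mul_apply']
      push_cast
      field_simp

/-- The functions `h` for which the formula holds form a subspace. It is closed, because uniform
convergence of the `h` gives uniform convergence of slopes and, on `[-π, π]`, of primitives. It
contains the Fourier modes, whose span is dense. -/
lemma HasPhase.circlePrimitive (hΩ : IsOpen Ω) (hfin : volume Ω ≠ ⊤)
    (hu : HasPhase Ω i u X) (h : C(AddCircle (2 * Real.pi), ℂ)) :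
    HasWeakPartial Ω i (fun x => circlePrimitive h (Complex.arg (u x)))
      (fun x => (h (Complex.arg (u x) : ℝ) - circleMean h) * X x) := by
  have : IsFiniteMeasure (volume.restrict Ω) := isFiniteMeasure_restrict.2 hfin
  let V : Submodule ℂ C(AddCircle (2 * Real.pi), ℂ) :=
    { carrier := {h | HasWeakPartial Ω i
        (fun x => CircleSobolev.circlePrimitive h (Complex.arg (u x)))
        (fun x => (h (Complex.arg (u x) : ℝ) - circleMean h) * X x)}
      add_mem' := by
        intro h k hh hk
        refine (HasWeakPartial.add hh hk).congr_ae (Eventually.of_forall fun x => ?_)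
          (Eventually.of_forall fun x => ?_)
        · simp only [circlePrimitive_add]
        · simp only [circleMean_add, ContinuousMap.add_apply]; ring
      zero_mem' := by
        have h1 : ∀ a, CircleSobolev.circlePrimitive 0 a = 0 := fun a => by
          simpa using circlePrimitive_smul 0 0 a
        have h2 : circleMean 0 = 0 := by simpa using circleMean_smul 0 0
        simpa [h1, h2] using HasWeakPartial.const hfin i (0 : ℂ)
      smul_mem' := by
        intro c h hh
        refine (HasWeakPartial.clm_comp (ContinuousLinearMap.mul ℝ ℂ c) hh).congr_ae
          (Eventually.of_forall fun x => ?_) (Eventually.of_forall fun x => ?_)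
        · simp only [circlePrimitive_smul]; rfl
        · simp only [circleMean_smul, ContinuousMap.smul_apply, smul_eq_mul,
            ContinuousLinearMap.mul_apply']
          ring }
  have hV : IsClosed (V : Set C(AddCircle (2 * Real.pi), ℂ)) := by
    refine isClosed_of_closure_subset fun h hh => ?_
    obtain ⟨hs, hmem, hlim⟩ := mem_closure_iff_seq_limit.1 hh
    have hsub : Tendsto (fun k => ‖hs k - h‖) atTop (𝓝 0) := tendsto_iff_norm_sub_tendsto_zero.1 hlim
    obtain ⟨B, hB⟩ := hlim.norm.bddAbove_range
    have hB' : ∀ k, ‖hs k‖ ≤ B := fun k => hB ⟨k, rfl⟩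
    have hdec : ∀ k, hs k = h + (hs k - h) := fun k => by abel
    refine HasWeakPartial.of_tendsto_dominated (us := fun k x =>
        CircleSobolev.circlePrimitive (hs k) (Complex.arg (u x)))
      (gs := fun k x => (hs k (Complex.arg (u x) : ℝ) - circleMean (hs k)) * X x)
      (b := fun _ => 2 * B * Real.pi) (b' := fun x => 2 * B * ‖X x‖) hmem
      (integrable_const _) (hu.integrableOn.norm.const_mul _) ?_ ?_ ?_ ?_
    · intro k
      refine Eventually.of_forall fun x => (norm_circlePrimitive_le (hs k)
        (Complex.abs_arg_le_pi _)).trans ?_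
      gcongr
      exact hB' k
    · intro k
      refine Eventually.of_forall fun x => ?_
      rw [norm_mul, Complex.norm_real]
      gcongr
      exact (norm_apply_sub_circleMean_le _ _).trans (by linarith [hB' k])
    · refine Eventually.of_forall fun x => ?_
      rw [tendsto_iff_norm_sub_tendsto_zero]
      refine squeeze_zero (fun _ => norm_nonneg _) (g := fun k => 2 * ‖hs k - h‖ * Real.pi)
        (fun k => ?_) (by simpa using (hsub.const_mul 2).mul_const Real.pi)
      have : CircleSobolev.circlePrimitive (hs k) (Complex.arg (u x)) -
          CircleSobolev.circlePrimitive h (Complex.arg (u x)) =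
          CircleSobolev.circlePrimitive (hs k - h) (Complex.arg (u x)) := by
        conv_lhs => rw [hdec k]
        rw [circlePrimitive_add, add_sub_cancel_left]
      rw [this]
      exact norm_circlePrimitive_le _ (Complex.abs_arg_le_pi _)
    · refine Eventually.of_forall fun x => ?_
      refine Tendsto.mul_const _ ?_
      rw [tendsto_iff_norm_sub_tendsto_zero]
      refine squeeze_zero (fun _ => norm_nonneg _) (g := fun k => 2 * ‖hs k - h‖)
        (fun k => ?_) (by simpa using hsub.const_mul 2)
      have hm : circleMean (hs k) = circleMean h + circleMean (hs k - h) := by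
        conv_lhs => rw [hdec k]
        exact circleMean_add _ _
      have : hs k (Complex.arg (u x) : ℝ) - circleMean (hs k) -
          (h (Complex.arg (u x) : ℝ) - circleMean h) =
          (hs k - h) (Complex.arg (u x) : ℝ) - circleMean (hs k - h) := by
        rw [hm, ContinuousMap.sub_apply]
        ring
      rw [this]
      exact norm_apply_sub_circleMean_le _ _
  have hle : (Submodule.span ℂ (range (fourier (T := 2 * Real.pi)))).topologicalClosure ≤ V := by
    refine Submodule.topologicalClosure_minimal _ (Submodule.span_le.2 ?_) hV
    rintro _ ⟨n, rfl⟩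
    exact hu.circlePrimitive_fourier hΩ hfin n
  rw [span_fourier_closure_eq_top] at hle
  exact hle Submodule.mem_top

variable {G : ℝ → ℝ}

/-- Chain rule for a primitive, on the circle, of a continuous function of mean zero. -/
lemma HasPhase.comp_primitive_of_continuous (hΩ : IsOpen Ω) (hfin : volume Ω ≠ ⊤)
    (hu : HasPhase Ω i u X) (hG : Continuous G) (hper : Function.Periodic G (2 * Real.pi))
    (hmean : ∫ s in (0 : ℝ)..2 * Real.pi, G s = 0) :
    HasWeakPartial Ω i (fun x => ∫ s in (0 : ℝ)..Complex.arg (u x), G s)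
      (fun x => G (Complex.arg (u x)) * X x) := by
  have hper' : Function.Periodic (fun s => (G s : ℂ)) (2 * Real.pi) := fun s => by simp [hper s]
  let h : C(AddCircle (2 * Real.pi), ℂ) := ⟨hper'.lift,
    continuous_coinduced_dom.2 (Complex.continuous_ofReal.comp hG)⟩
  have hh : ∀ s : ℝ, h s = G s := fun s => hper'.lift_coe s
  have hm : circleMean h = 0 := by
    simp only [circleMean, hh]
    rw [intervalIntegral.integral_ofReal, hmean]
    simp
  have := (hu.circlePrimitive hΩ hfin h).clm_comp Complex.reCLM
  refine this.congr_ae (Eventually.of_forall fun x => ?_) (Eventually.of_forall fun x => ?_)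
  · simp only [CircleSobolev.circlePrimitive, hm, hh, sub_zero]
    rw [intervalIntegral.integral_ofReal]
    simp
  · simp [hh, hm]

/-- Chain rule for a continuously differentiable function on the circle. -/
lemma HasPhase.comp_periodic {P P' : ℝ → ℝ} (hΩ : IsOpen Ω) (hfin : volume Ω ≠ ⊤)
    (hu : HasPhase Ω i u X) (hP : ∀ t, HasDerivAt P (P' t) t) (hP' : Continuous P')
    (hper : Function.Periodic P (2 * Real.pi)) :
    HasWeakPartial Ω i (fun x => P (Complex.arg (u x)))
      (fun x => P' (Complex.arg (u x)) * X x) := by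
  have hint : ∀ a b, ∫ s in a..b, P' s = P b - P a := fun a b =>
    intervalIntegral.integral_eq_sub_of_hasDerivAt (fun t _ => hP t) (hP'.intervalIntegrable _ _)
  have hper' : Function.Periodic P' (2 * Real.pi) := by
    intro t
    have h1 : HasDerivAt (fun s => P (s + 2 * Real.pi)) (P' (t + 2 * Real.pi)) t :=
      (hP _).comp_add_const t _
    have h2 : (fun s => P (s + 2 * Real.pi)) = P := funext hper
    rw [h2] at h1
    exact h1.unique (hP t)
  have := (hu.comp_primitive_of_continuous hΩ hfin hP' hper' (by
    rw [hint, ← zero_add (2 * Real.pi), hper, sub_self])).add (HasWeakPartial.const hfin i (P 0))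
  simpa [hint] using this

lemma intervalIntegrable_of_bounded {C : ℝ} (hGm : Measurable G) (hGC : ∀ s, |G s| ≤ C)
    (a b : ℝ) : IntervalIntegrable G volume a b := by
  refine (intervalIntegrable_const (c := C)).mono_fun hGm.aestronglyMeasurable
    (Eventually.of_forall fun s => ?_)
  exact (hGC s).trans (le_abs_self C)

/-- Chain rule for a primitive, on the circle, of a bounded left-continuous function of mean
zero. -/
lemma HasPhase.comp_primitive_of_leftContinuous (hΩ : IsOpen Ω) (hfin : volume Ω ≠ ⊤)
    (hu : HasPhase Ω i u X) (hGm : Measurable G) {C : ℝ} (hGC : ∀ s, |G s| ≤ C)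
    (hper : Function.Periodic G (2 * Real.pi))
    (hG : ∀ s, ContinuousWithinAt G (Iic s) s)
    (hmean : ∫ s in (0 : ℝ)..2 * Real.pi, G s = 0) :
    HasWeakPartial Ω i (fun x => ∫ s in (0 : ℝ)..Complex.arg (u x), G s)
      (fun x => G (Complex.arg (u x)) * X x) := by
  have : IsFiniteMeasure (volume.restrict Ω) := isFiniteMeasure_restrict.2 hfin
  have hint := intervalIntegrable_of_bounded hGm hGC
  have hC0 : 0 ≤ C := (abs_nonneg _).trans (hGC 0)
  set H : ℝ → ℝ := fun a => ∫ s in (0 : ℝ)..a, G s with hH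
  have hHc : Continuous H := intervalIntegral.continuous_primitive hint 0
  have hHsub : ∀ a b, H b - H a = ∫ s in a..b, G s := fun a b =>
    intervalIntegral.integral_interval_sub_left (hint _ _) (hint _ _)
  have hHper : Function.Periodic H (2 * Real.pi) := by
    intro a
    have : H (a + 2 * Real.pi) - H a = 0 := by
      rw [hHsub, hper.intervalIntegral_add_eq a 0, zero_add, hmean]
    linarith
  set ε : ℕ → ℝ := fun k => 1 / ((k : ℝ) + 1) with hε
  have hεpos : ∀ k, 0 < ε k := fun k => Nat.one_div_pos_of_nat
  have hεlim : Tendsto ε atTop (𝓝 0) := tendsto_one_div_add_atTop_nhds_zero_nat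
  -- Left difference quotients of the primitive: continuous, periodic, of mean zero and bounded by
  -- `C`. Left continuity of `G` makes them converge to `G` at every point, so a level set of `u` of
  -- positive measure at a jump of `G` does no harm.
  set Gs : ℕ → ℝ → ℝ := fun k a => (H a - H (a - ε k)) / ε k with hGs
  have hGsc : ∀ k, Continuous (Gs k) := fun k =>
    (hHc.sub (hHc.comp (continuous_id.sub continuous_const))).div_const _
  have hGsper : ∀ k, Function.Periodic (Gs k) (2 * Real.pi) := by
    intro k a
    simp only [hGs, hHper a]
    rw [add_sub_right_comm, hHper]
  have hGsC : ∀ k a, |Gs k a| ≤ C := by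
    intro k a
    simp only [hGs]
    rw [hHsub, abs_div, abs_of_pos (hεpos k), div_le_iff₀ (hεpos k)]
    have := intervalIntegral.norm_integral_le_of_norm_le_const (a := a - ε k) (b := a) (f := G)
      (C := C) fun s _ => hGC s
    simpa [abs_of_pos (hεpos k)] using this
  have hGsmean : ∀ k, ∫ s in (0 : ℝ)..2 * Real.pi, Gs k s = 0 := by
    intro k
    have hshift : IntervalIntegrable (fun s => H (s - ε k)) volume 0 (2 * Real.pi) :=
      (hHc.comp (continuous_id.sub continuous_const)).intervalIntegrable _ _
    simp only [hGs]
    rw [intervalIntegral.integral_div, intervalIntegral.integral_sub (hHc.intervalIntegrable _ _)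
      hshift,
      intervalIntegral.integral_comp_sub_right (fun s => H s)]
    have := hHper.intervalIntegral_add_eq (0 - ε k) 0
    rw [zero_add, show 0 - ε k + 2 * Real.pi = 2 * Real.pi - ε k by ring] at this
    rw [this, sub_self, zero_div]
  have hGslim : ∀ a, Tendsto (fun k => Gs k a) atTop (𝓝 (G a)) := by
    intro a
    have hd : HasDerivWithinAt H (G a) (Iic a) a :=
      intervalIntegral.integral_hasDerivWithinAt_right (hint 0 a)
        (hGm.stronglyMeasurable.stronglyMeasurableAtFilter) (hG a)
    rw [hasDerivWithinAt_iff_tendsto_slope] at hd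
    have hk : Tendsto (fun k => a - ε k) atTop (𝓝[Iic a \ {a}] a) := by
      refine tendsto_nhdsWithin_iff.2 ⟨by simpa using hεlim.const_sub a,
        Eventually.of_forall fun k => ⟨?_, ?_⟩⟩
      · simpa using (hεpos k).le
      · simpa using (hεpos k).ne'
    refine (hd.comp hk).congr fun k => ?_
    simp only [Function.comp_apply, slope_def_field, hGs]
    rw [← neg_sub (H a), sub_sub_cancel_left, neg_div_neg_eq]
  refine HasWeakPartial.of_tendsto_dominated
    (us := fun k x => ∫ s in (0 : ℝ)..Complex.arg (u x), Gs k s)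
    (gs := fun k x => Gs k (Complex.arg (u x)) * X x)
    (b := fun _ => C * Real.pi) (b' := fun x => C * ‖X x‖)
    (fun k => hu.comp_primitive_of_continuous hΩ hfin (hGsc k) (hGsper k) (hGsmean k))
    (integrable_const _) (hu.integrableOn.norm.const_mul _) ?_ ?_ ?_ ?_
  · intro k
    refine Eventually.of_forall fun x => ?_
    have := intervalIntegral.norm_integral_le_of_norm_le_const (a := 0) (b := Complex.arg (u x))
      (f := Gs k) (C := C) fun s _ => hGsC k s
    rw [sub_zero] at this
    exact this.trans (mul_le_mul_of_nonneg_left (Complex.abs_arg_le_pi _) hC0)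
  · intro k
    refine Eventually.of_forall fun x => ?_
    rw [norm_mul]
    exact mul_le_mul_of_nonneg_right (hGsC k _) (norm_nonneg _)
  · refine Eventually.of_forall fun x => ?_
    exact intervalIntegral.tendsto_integral_filter_of_dominated_convergence (fun _ => C)
      (Eventually.of_forall fun k => (hGsc k).aestronglyMeasurable)
      (Eventually.of_forall fun k => Eventually.of_forall fun s _ => hGsC k s)
      intervalIntegrable_const (Eventually.of_forall fun s _ => hGslim s)
  · exact Eventually.of_forall fun x => (hGslim _).mul_const _

end CircleChainRule

/-! ### Double integrals of differences controlled by the gradient -/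

section Oscillation

variable {N : ℕ} {F : Type*} [NormedAddCommGroup F] [NormedSpace ℝ F]

/-- The double integral `∫_A ∫_B ‖φ y - φ z‖ dz dy`. -/
noncomputable def oscillation (φ : EuclideanSpace ℝ (Fin N) → F)
    (A B : Set (EuclideanSpace ℝ (Fin N))) : ENNReal :=
  ∫⁻ y in A, ∫⁻ z in B, ‖φ y - φ z‖ₑ

/-- The substitution has Jacobian `t^{-N}`, and `t ≥ 1/2` bounds it by `2^N`. -/
lemma lintegral_comp_add_smul (f : EuclideanSpace ℝ (Fin N) → ENNReal) (hf : Measurable f)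
    (c : EuclideanSpace ℝ (Fin N)) {t : ℝ} (ht : 1 / 2 ≤ t) :
    ∫⁻ y, f (c + t • y) ≤ 2 ^ N * ∫⁻ y, f y := by
  have ht0 : 0 < t := by linarith
  have h1 : ∫⁻ y, f (c + t • y) = ∫⁻ y, f (c + y)
      ∂(Measure.map (fun y : EuclideanSpace ℝ (Fin N) => t • y) volume) := by
    exact (lintegral_map (f := fun y => f (c + y)) (hf.comp (measurable_const_add c))
      (measurable_const_smul t)).symm
  have h2 := Measure.map_addHaar_smul (volume : Measure (EuclideanSpace ℝ (Fin N))) ht0.ne'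
  rw [h1, h2, lintegral_smul_measure, lintegral_add_left_eq_self, smul_eq_mul]
  gcongr
  rw [finrank_euclideanSpace_fin, abs_of_pos (by positivity)]
  have h3 : (t ^ N)⁻¹ ≤ 2 ^ N := by
    rw [← inv_pow]
    gcongr
    rw [inv_le_comm₀ ht0 two_pos]
    linarith
  calc ENNReal.ofReal (t ^ N)⁻¹ ≤ ENNReal.ofReal (2 ^ N) := ENNReal.ofReal_le_ofReal h3
    _ = 2 ^ N := by rw [ENNReal.ofReal_pow zero_le_two, ENNReal.ofReal_ofNat]

lemma enorm_fderiv_apply_le (φ : EuclideanSpace ℝ (Fin N) → F) (x w : EuclideanSpace ℝ (Fin N)) :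
    ‖fderiv ℝ φ x w‖ₑ ≤ ‖w‖ₑ * ∑ i, ‖fderiv ℝ φ x (EuclideanSpace.single i 1)‖ₑ := by
  have hw : w = ∑ i, w i • EuclideanSpace.single i (1 : ℝ) := by
    have := (EuclideanSpace.basisFun (Fin N) ℝ).sum_repr w
    simpa using this.symm
  conv_lhs => rw [hw]
  rw [map_sum, Finset.mul_sum]
  refine (enorm_sum_le _ _).trans (Finset.sum_le_sum fun i _ => ?_)
  rw [map_smul, enorm_smul]
  gcongr
  rw [← ofReal_norm, ← ofReal_norm]
  exact ENNReal.ofReal_le_ofReal (PiLp.norm_apply_le w i)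

lemma enorm_sub_le_lintegral_segment [CompleteSpace F] {φ : EuclideanSpace ℝ (Fin N) → F}
    (hφ : ContDiff ℝ ∞ φ) (y z : EuclideanSpace ℝ (Fin N)) :
    ‖φ y - φ z‖ₑ ≤ ∫⁻ t in Ioc (0 : ℝ) 1,
      ‖y - z‖ₑ * ∑ i, ‖fderiv ℝ φ (z + t • (y - z)) (EuclideanSpace.single i 1)‖ₑ := by
  have hd : ∀ t : ℝ, HasDerivAt (fun t : ℝ => φ (z + t • (y - z)))
      (fderiv ℝ φ (z + t • (y - z)) (y - z)) t := by
    intro t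
    have h1 : HasDerivAt (fun t : ℝ => z + t • (y - z)) (y - z) t := by
      simpa using ((hasDerivAt_id t).smul_const (y - z)).const_add z
    exact ((hφ.differentiable (by simp)) _).hasFDerivAt.comp_hasDerivAt t h1
  have hc : Continuous fun t : ℝ => fderiv ℝ φ (z + t • (y - z)) (y - z) :=
    ((hφ.continuous_fderiv (by simp)).comp (by fun_prop)).clm_apply continuous_const
  have h := intervalIntegral.integral_eq_sub_of_hasDerivAt (fun t _ => hd t)
    (hc.intervalIntegrable 0 1)
  simp only [one_smul, add_sub_cancel, zero_smul, add_zero] at h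
  rw [← h, intervalIntegral.integral_of_le zero_le_one]
  exact (enorm_integral_le_lintegral_enorm _).trans
    (lintegral_mono fun t => enorm_fderiv_apply_le _ _ _)

/-- Integrate the gradient along segments and exchange integrals. The point `z + t (y - z)` depends
on `y` with factor `t` and on `z` with factor `1 - t`; one of them is at least `1/2`, and that
variable is changed first. -/
lemma oscillation_le_of_contDiff [CompleteSpace F] {φ : EuclideanSpace ℝ (Fin N) → F}
    (hφ : ContDiff ℝ ∞ φ) {A B L : Set (EuclideanSpace ℝ (Fin N))} (hA : MeasurableSet A)
    (hB : MeasurableSet B) (hL : MeasurableSet L)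
    (hseg : ∀ y ∈ A, ∀ z ∈ B, ∀ t ∈ Ioc (0 : ℝ) 1, z + t • (y - z) ∈ L) {R : ENNReal}
    (hRfin : R ≠ ⊤) (hR : ∀ y ∈ A, ∀ z ∈ B, ‖y - z‖ₑ ≤ R) :
    oscillation φ A B ≤ R * (2 ^ N * (volume A + volume B)) *
      ∫⁻ x in L, ∑ i, ‖fderiv ℝ φ x (EuclideanSpace.single i 1)‖ₑ := by
  set D : EuclideanSpace ℝ (Fin N) → ENNReal :=
    L.indicator fun x => ∑ i, ‖fderiv ℝ φ x (EuclideanSpace.single i 1)‖ₑ with hD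
  have hDm : Measurable D := by
    refine Measurable.indicator ?_ hL
    refine Finset.measurable_sum _ fun i _ => ?_
    exact (((hφ.continuous_fderiv (by simp)).clm_apply continuous_const).enorm).measurable
  have hjoint : Measurable fun p : (EuclideanSpace ℝ (Fin N) × EuclideanSpace ℝ (Fin N)) × ℝ =>
      D (p.1.2 + p.2 • (p.1.1 - p.1.2)) := by
    refine hDm.comp (Continuous.measurable ?_)
    fun_prop
  have step : ∀ y ∈ A, ∀ z ∈ B,
      ‖φ y - φ z‖ₑ ≤ R * ∫⁻ t in Ioc (0 : ℝ) 1, D (z + t • (y - z)) := by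
    intro y hy z hz
    refine (enorm_sub_le_lintegral_segment hφ y z).trans ?_
    rw [← lintegral_const_mul' _ _ hRfin]
    refine setLIntegral_mono' measurableSet_Ioc fun t ht => ?_
    rw [hD, indicator_of_mem (hseg y hy z hz t ht)]
    gcongr
    exact hR y hy z hz
  have hslice : ∀ t ∈ Ioc (0 : ℝ) 1, ∫⁻ y in A, ∫⁻ z in B, D (z + t • (y - z)) ≤
      2 ^ N * (volume A + volume B) * ∫⁻ x, D x := by
    intro t ht
    have hm : Measurable fun p : EuclideanSpace ℝ (Fin N) × EuclideanSpace ℝ (Fin N) =>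
        D (p.2 + t • (p.1 - p.2)) := by
      refine hDm.comp (Continuous.measurable ?_)
      fun_prop
    rcases le_total (1 / 2) t with h | h
    · rw [lintegral_lintegral_swap hm.aemeasurable]
      calc ∫⁻ z in B, ∫⁻ y in A, D (z + t • (y - z))
          ≤ ∫⁻ z in B, 2 ^ N * ∫⁻ x, D x := by
            refine lintegral_mono fun z => (setLIntegral_le_lintegral _ _).trans ?_
            have : ∀ y, z + t • (y - z) = (z - t • z) + t • y := fun y => by
              rw [smul_sub]; abel
            simp only [this]
            exact lintegral_comp_add_smul D hDm _ h
        _ = 2 ^ N * volume B * ∫⁻ x, D x := by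
            rw [setLIntegral_const]; ring
        _ ≤ _ := by gcongr; exact le_add_self
    · calc ∫⁻ y in A, ∫⁻ z in B, D (z + t • (y - z))
          ≤ ∫⁻ y in A, 2 ^ N * ∫⁻ x, D x := by
            refine lintegral_mono fun y => (setLIntegral_le_lintegral _ _).trans ?_
            have : ∀ z, z + t • (y - z) = t • y + (1 - t) • z := fun z => by
              rw [smul_sub, sub_smul, one_smul]; abel
            simp only [this]
            exact lintegral_comp_add_smul D hDm _ (by linarith)
        _ = 2 ^ N * volume A * ∫⁻ x, D x := by
            rw [setLIntegral_const]; ring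
        _ ≤ _ := by gcongr; exact le_self_add
  have hinner : Measurable fun p : EuclideanSpace ℝ (Fin N) × EuclideanSpace ℝ (Fin N) =>
      ∫⁻ t in Ioc (0 : ℝ) 1, D (p.2 + t • (p.1 - p.2)) := hjoint.lintegral_prod_right'
  calc oscillation φ A B
      ≤ ∫⁻ y in A, ∫⁻ z in B, R * ∫⁻ t in Ioc (0 : ℝ) 1, D (z + t • (y - z)) :=
        setLIntegral_mono' hA fun y hy => setLIntegral_mono' hB fun z hz => step y hy z hz
    _ = R * ∫⁻ y in A, ∫⁻ z in B, ∫⁻ t in Ioc (0 : ℝ) 1, D (z + t • (y - z)) := by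
        rw [← lintegral_const_mul' _ _ hRfin]
        refine lintegral_congr fun y => ?_
        rw [lintegral_const_mul' _ _ hRfin]
    _ = R * ∫⁻ t in Ioc (0 : ℝ) 1, ∫⁻ y in A, ∫⁻ z in B, D (z + t • (y - z)) := by
        congr 1
        have h1 : ∀ y, ∫⁻ z in B, ∫⁻ t in Ioc (0 : ℝ) 1, D (z + t • (y - z)) =
            ∫⁻ t in Ioc (0 : ℝ) 1, ∫⁻ z in B, D (z + t • (y - z)) := by
          intro y
          refine lintegral_lintegral_swap (Measurable.aemeasurable ?_)
          exact hjoint.comp ((measurable_const.prodMk measurable_fst).prodMk measurable_snd)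
        simp only [h1]
        refine lintegral_lintegral_swap (Measurable.aemeasurable ?_)
        have h2 : Measurable fun p : (EuclideanSpace ℝ (Fin N) × ℝ) × EuclideanSpace ℝ (Fin N) =>
            D (p.2 + p.1.2 • (p.1.1 - p.2)) :=
          hjoint.comp (((measurable_fst.comp measurable_fst).prodMk measurable_snd).prodMk
            (measurable_snd.comp measurable_fst))
        exact h2.lintegral_prod_right'
    _ ≤ R * ∫⁻ t in Ioc (0 : ℝ) 1, 2 ^ N * (volume A + volume B) * ∫⁻ x, D x := by
        gcongr R * ?_
        exact setLIntegral_mono' measurableSet_Ioc hslice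
    _ = _ := by
        rw [setLIntegral_const, Real.volume_Ioc, hD, lintegral_indicator hL]
        simp
        ring

variable {Ω : Set (EuclideanSpace ℝ (Fin N))}

/-- The oscillation between `A` and `B` of every function in `W^{1,1}(Ω; F)` is controlled by the
`L¹` norm of its weak gradient. -/
def OscillationControlled (F : Type*) [NormedAddCommGroup F] [NormedSpace ℝ F]
    (Ω A B : Set (EuclideanSpace ℝ (Fin N))) : Prop :=
  ∃ C : ENNReal, C ≠ ⊤ ∧ ∀ (φ : EuclideanSpace ℝ (Fin N) → F)
    (g : Fin N → EuclideanSpace ℝ (Fin N) → F), IntegrableOn φ Ω →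
    (∀ i, HasWeakPartial Ω i φ (g i)) →
      oscillation φ A B ≤ C * ∑ i, ∫⁻ x in Ω, ‖g i x‖ₑ

-- The cost of replacing `φ` by a mollification, expressed by `L¹` distances on `A` and `B` only.
omit [NormedSpace ℝ F] in
lemma oscillation_le_add {φ ψ : EuclideanSpace ℝ (Fin N) → F} (hψ : Continuous ψ)
    (A : Set (EuclideanSpace ℝ (Fin N))) {B : Set (EuclideanSpace ℝ (Fin N))}
    (hB : volume B ≠ ⊤) :
    oscillation φ A B ≤ oscillation ψ A B + (volume B * (∫⁻ x in A, ‖ψ x - φ x‖ₑ) +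
      volume A * ∫⁻ x in B, ‖ψ x - φ x‖ₑ) := by
  have hcont : Continuous fun p : EuclideanSpace ℝ (Fin N) × EuclideanSpace ℝ (Fin N) =>
      ‖ψ p.1 - ψ p.2‖ₑ :=
    ((hψ.comp continuous_fst).sub (hψ.comp continuous_snd)).enorm
  have hy : ∀ y, Measurable fun z => ‖ψ y - ψ z‖ₑ := fun y =>
    ((continuous_const.sub hψ).enorm).measurable
  set J : ENNReal := ∫⁻ x in B, ‖ψ x - φ x‖ₑ with hJ
  have h1 : ∀ y, ∫⁻ z in B, ‖φ y - φ z‖ₑ ≤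
      (∫⁻ z in B, ‖ψ y - ψ z‖ₑ) + (volume B * ‖ψ y - φ y‖ₑ + J) := by
    intro y
    calc ∫⁻ z in B, ‖φ y - φ z‖ₑ
        ≤ ∫⁻ z in B, (‖ψ y - ψ z‖ₑ + (‖ψ y - φ y‖ₑ + ‖ψ z - φ z‖ₑ)) := by
          refine lintegral_mono fun z => ?_
          have : φ y - φ z = (ψ y - ψ z) + (-(ψ y - φ y) + (ψ z - φ z)) := by abel
          simp only
          rw [this]
          refine (enorm_add_le _ _).trans (add_le_add_right ?_ _)
          refine (enorm_add_le _ _).trans ?_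
          rw [enorm_neg]
      _ = (∫⁻ z in B, ‖ψ y - ψ z‖ₑ) + ∫⁻ z in B, (‖ψ y - φ y‖ₑ + ‖ψ z - φ z‖ₑ) :=
          lintegral_add_left (hy y) _
      _ = (∫⁻ z in B, ‖ψ y - ψ z‖ₑ) + (volume B * ‖ψ y - φ y‖ₑ + J) := by
          rw [lintegral_add_left measurable_const, setLIntegral_const, mul_comm (volume B)]
  have hm : Measurable fun y => ∫⁻ z in B, ‖ψ y - ψ z‖ₑ :=
    hcont.measurable.lintegral_prod_right'
  calc oscillation φ A B
      ≤ ∫⁻ y in A, ((∫⁻ z in B, ‖ψ y - ψ z‖ₑ) + (volume B * ‖ψ y - φ y‖ₑ + J)) :=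
        lintegral_mono h1
    _ = oscillation ψ A B + ∫⁻ y in A, (volume B * ‖ψ y - φ y‖ₑ + J) := lintegral_add_left hm _
    _ = _ := by
        rw [lintegral_add_right _ measurable_const, setLIntegral_const,
          lintegral_const_mul' _ _ hB, mul_comm J]

/-- The union of the segments joining compact sets is a compact subset of `Ω`, on which gradients of
mollifications converge in `L¹`; the smooth estimate then passes to the limit. -/
lemma oscillation_le_of_isCompact [CompleteSpace F] {φ : EuclideanSpace ℝ (Fin N) → F}
    {g : Fin N → EuclideanSpace ℝ (Fin N) → F} (hΩ : IsOpen Ω) (hφ : IntegrableOn φ Ω)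
    (hg : ∀ i, HasWeakPartial Ω i φ (g i)) {A B : Set (EuclideanSpace ℝ (Fin N))}
    (hA : IsCompact A) (hB : IsCompact B) (hAΩ : A ⊆ Ω) (hBΩ : B ⊆ Ω)
    (hseg : ∀ y ∈ A, ∀ z ∈ B, ∀ t ∈ Icc (0 : ℝ) 1, z + t • (y - z) ∈ Ω) {R : ENNReal}
    (hRfin : R ≠ ⊤) (hR : ∀ y ∈ A, ∀ z ∈ B, ‖y - z‖ₑ ≤ R) :
    oscillation φ A B ≤ R * (2 ^ N * (volume A + volume B)) * ∑ i, ∫⁻ x in Ω, ‖g i x‖ₑ := by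
  set L : Set (EuclideanSpace ℝ (Fin N)) :=
    (fun p : (EuclideanSpace ℝ (Fin N) × EuclideanSpace ℝ (Fin N)) × ℝ =>
      p.1.2 + p.2 • (p.1.1 - p.1.2)) '' ((A ×ˢ B) ×ˢ Icc (0 : ℝ) 1) with hLdef
  have hL : IsCompact L := ((hA.prod hB).prod isCompact_Icc).image (by fun_prop)
  have hLΩ : L ⊆ Ω := by
    rintro _ ⟨⟨⟨y, z⟩, t⟩, ⟨⟨hy, hz⟩, ht⟩, rfl⟩
    exact hseg y hy z hz t ht
  have hφi := hφ.integrable_indicator hΩ.measurableSet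
  set φs : ℕ → EuclideanSpace ℝ (Fin N) → F := fun k => mollify k (Ω.indicator φ) with hφs
  have hsm : ∀ k, ContDiff ℝ ∞ (φs k) := fun k => contDiff_mollify k hφi
  set d : ℕ → ENNReal := fun k => ∫⁻ x, ‖φs k x - Ω.indicator φ x‖ₑ with hddef
  have hd : Tendsto d atTop (𝓝 0) := tendsto_lintegral_mollify_sub hφi
  set C : ENNReal := R * (2 ^ N * (volume A + volume B)) with hC
  have hCfin : C ≠ ⊤ := ENNReal.mul_ne_top hRfin (ENNReal.mul_ne_top (by simp)
    (ENNReal.add_ne_top.2 ⟨hA.measure_ne_top, hB.measure_ne_top⟩))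
  set δ : Fin N → ℕ → ENNReal := fun i k =>
    ∫⁻ x in L, ‖fderiv ℝ (φs k) x (EuclideanSpace.single i 1) - g i x‖ₑ with hδdef
  have hδ : ∀ i, Tendsto (δ i) atTop (𝓝 0) := fun i =>
    (hg i).tendsto_fderiv_mollify hΩ hL hLΩ
  have hloc : ∀ k, ∀ K : Set (EuclideanSpace ℝ (Fin N)),
      ∫⁻ x in K, ‖φs k x - Ω.indicator φ x‖ₑ ≤ d k := fun k K => setLIntegral_le_lintegral _ _
  have hbound : ∀ k, oscillation φ A B ≤
      C * (∑ i, (δ i k + ∫⁻ x in Ω, ‖g i x‖ₑ)) + (volume B * d k + volume A * d k) := by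
    intro k
    have h1 : oscillation φ A B = oscillation (Ω.indicator φ) A B :=
      setLIntegral_congr_fun hA.measurableSet fun y hy =>
        setLIntegral_congr_fun hB.measurableSet fun z hz => by
          simp only [indicator_of_mem (hAΩ hy), indicator_of_mem (hBΩ hz)]
    rw [h1]
    refine (oscillation_le_add (hsm k).continuous A hB.measure_ne_top).trans ?_
    refine add_le_add ?_ (add_le_add (mul_le_mul_right (hloc k A) _)
      (mul_le_mul_right (hloc k B) _))
    · refine (oscillation_le_of_contDiff (hsm k) hA.measurableSet hB.measurableSet
        hL.measurableSet (fun y hy z hz t ht =>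
          ⟨⟨⟨y, z⟩, t⟩, ⟨⟨hy, hz⟩, ⟨ht.1.le, ht.2⟩⟩, rfl⟩) hRfin hR).trans ?_
      gcongr C * ?_
      have hm : ∀ i, Measurable fun x => ‖fderiv ℝ (φs k) x (EuclideanSpace.single i 1)‖ₑ :=
        fun i => ((((hsm k).continuous_fderiv (by simp)).clm_apply
          continuous_const).enorm).measurable
      rw [lintegral_finsetSum _ fun i _ => hm i]
      refine Finset.sum_le_sum fun i _ => ?_
      calc ∫⁻ x in L, ‖fderiv ℝ (φs k) x (EuclideanSpace.single i 1)‖ₑ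
          ≤ ∫⁻ x in L, (‖fderiv ℝ (φs k) x (EuclideanSpace.single i 1) - g i x‖ₑ + ‖g i x‖ₑ) := by
            refine lintegral_mono fun x => ?_
            conv_lhs => rw [← sub_add_cancel (fderiv ℝ (φs k) x (EuclideanSpace.single i 1)) (g i x)]
            exact enorm_add_le _ _
        _ = δ i k + ∫⁻ x in L, ‖g i x‖ₑ :=
            lintegral_add_right' _ ((hg i).integrableOn_grad.mono_set hLΩ).1.enorm
        _ ≤ _ := by gcongr
  refine ge_of_tendsto' (x := atTop) ?_ hbound
  have l1 : Tendsto (fun k => ∑ i, (δ i k + ∫⁻ x in Ω, ‖g i x‖ₑ)) atTop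
      (𝓝 (∑ i, ∫⁻ x in Ω, ‖g i x‖ₑ)) := by
    refine tendsto_finsetSum _ fun i _ => ?_
    simpa using (hδ i).add_const (∫⁻ x in Ω, ‖g i x‖ₑ)
  have l2 : ∀ K : Set (EuclideanSpace ℝ (Fin N)), IsCompact K →
      Tendsto (fun k => volume K * d k) atTop (𝓝 0) := fun K hK => by
    simpa using ENNReal.Tendsto.const_mul hd (Or.inr hK.measure_ne_top)
  simpa using (ENNReal.Tendsto.const_mul l1 (Or.inr hCfin)).add ((l2 B hB).add (l2 A hA))

omit [NormedSpace ℝ F] in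
lemma aemeasurable_enorm_sub {φ : EuclideanSpace ℝ (Fin N) → F} (hφ : IntegrableOn φ Ω)
    {A B : Set (EuclideanSpace ℝ (Fin N))} (hAΩ : A ⊆ Ω) (hBΩ : B ⊆ Ω) :
    AEMeasurable (fun p : EuclideanSpace ℝ (Fin N) × EuclideanSpace ℝ (Fin N) =>
      ‖φ p.1 - φ p.2‖ₑ) ((volume.restrict A).prod (volume.restrict B)) :=
  (((hφ.mono_set hAΩ).1.comp_quasiMeasurePreserving Measure.quasiMeasurePreserving_fst).sub
    ((hφ.mono_set hBΩ).1.comp_quasiMeasurePreserving Measure.quasiMeasurePreserving_snd)).enorm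

/-- Exhaust `A` and `B` by increasing compact sets. The constant depends only on a bound for
distances in `Ω` and on the two volumes, so it survives the monotone limit. -/
lemma oscillationControlled_of_segment [CompleteSpace F] (hΩ : IsOpen Ω)
    (hbdd : Bornology.IsBounded Ω) {A B : Set (EuclideanSpace ℝ (Fin N))}
    (hA : IsOpen A) (hB : IsOpen B) (hAΩ : A ⊆ Ω) (hBΩ : B ⊆ Ω)
    (hseg : ∀ y ∈ A, ∀ z ∈ B, ∀ t ∈ Icc (0 : ℝ) 1, z + t • (y - z) ∈ Ω) :
    OscillationControlled F Ω A B := by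
  obtain ⟨r, hr⟩ := Metric.isBounded_iff.1 hbdd
  set R : ENNReal := ENNReal.ofReal r
  have hR : ∀ y ∈ Ω, ∀ z ∈ Ω, ‖y - z‖ₑ ≤ R := by
    intro y hy z hz
    rw [← ofReal_norm, ← dist_eq_norm]
    exact ENNReal.ofReal_le_ofReal (hr hy hz)
  have hAfin : volume A ≠ ⊤ := (hbdd.subset hAΩ).measure_lt_top.ne
  have hBfin : volume B ≠ ⊤ := (hbdd.subset hBΩ).measure_lt_top.ne
  refine ⟨R * (2 ^ N * (volume A + volume B)), ENNReal.mul_ne_top ENNReal.ofReal_ne_top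
    (ENNReal.mul_ne_top (by simp) (ENNReal.add_ne_top.2 ⟨hAfin, hBfin⟩)), fun φ g hφ hg => ?_⟩
  obtain ⟨As, hAs, hAsub, hAU, hAmono⟩ := hA.exists_iUnion_isClosed
  obtain ⟨Bs, hBs, hBsub, hBU, hBmono⟩ := hB.exists_iUnion_isClosed
  have hcA : ∀ n, IsCompact (As n) := fun n =>
    Metric.isCompact_of_isClosed_isBounded (hAs n) (hbdd.subset ((hAsub n).trans hAΩ))
  have hcB : ∀ n, IsCompact (Bs n) := fun n =>
    Metric.isCompact_of_isClosed_isBounded (hBs n) (hbdd.subset ((hBsub n).trans hBΩ))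
  have hprod : ∀ A' B' : Set (EuclideanSpace ℝ (Fin N)), A' ⊆ Ω → B' ⊆ Ω →
      oscillation φ A' B' = ∫⁻ p in A' ×ˢ B', ‖φ p.1 - φ p.2‖ₑ ∂(volume.prod volume) := by
    intro A' B' hA' hB'
    rw [← Measure.prod_restrict, lintegral_prod _ (aemeasurable_enorm_sub hφ hA' hB')]
    rfl
  have hUnion : A ×ˢ B = ⋃ n, As n ×ˢ Bs n := by
    rw [← hAU, ← hBU, iUnion_prod_of_monotone hAmono hBmono]
  rw [hprod A B hAΩ hBΩ, hUnion, setLIntegral_iUnion_of_directed]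
  · refine iSup_le fun n => ?_
    rw [← hprod _ _ ((hAsub n).trans hAΩ) ((hBsub n).trans hBΩ)]
    refine (oscillation_le_of_isCompact hΩ hφ hg (hcA n) (hcB n) ((hAsub n).trans hAΩ)
      ((hBsub n).trans hBΩ) (fun y hy z hz => hseg y (hAsub n hy) z (hBsub n hz))
      ENNReal.ofReal_ne_top fun y hy z hz => hR y (hAΩ (hAsub n hy)) z
        (hBΩ (hBsub n hz))).trans ?_
    gcongr
    · exact hAsub n
    · exact hBsub n
  · exact (Monotone.directed_le fun m n h => prod_mono (hAmono h) (hBmono h))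

namespace OscillationControlled

variable {A A' B B' D : Set (EuclideanSpace ℝ (Fin N))}

lemma mono (h : OscillationControlled F Ω A B) (hA : A' ⊆ A) (hB : B' ⊆ B) :
    OscillationControlled F Ω A' B' := by
  obtain ⟨C, hC, h⟩ := h
  refine ⟨C, hC, fun φ g hφ hg => le_trans ?_ (h φ g hφ hg)⟩
  exact (lintegral_mono fun y => lintegral_mono_set hB).trans (lintegral_mono_set hA)

lemma union_left (h : OscillationControlled F Ω A B) (h' : OscillationControlled F Ω A' B) :
    OscillationControlled F Ω (A ∪ A') B := by
  obtain ⟨C, hC, h⟩ := h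
  obtain ⟨C', hC', h'⟩ := h'
  refine ⟨C + C', ENNReal.add_ne_top.2 ⟨hC, hC'⟩, fun φ g hφ hg => ?_⟩
  rw [add_mul]
  exact (lintegral_union_le _ _ _).trans (add_le_add (h φ g hφ hg) (h' φ g hφ hg))

lemma empty_left : OscillationControlled F Ω ∅ B :=
  ⟨0, ENNReal.zero_ne_top, fun φ g _ _ => by simp [oscillation]⟩

/-- Insert an intermediate point `z ∈ B` between `y ∈ A` and `w ∈ D` by the triangle inequality and
average over `z`; this is where `B` must have positive volume. -/
lemma trans (hfin : volume Ω ≠ ⊤) (hAΩ : A ⊆ Ω) (hBΩ : B ⊆ Ω) (hDΩ : D ⊆ Ω)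
    (hB : volume B ≠ 0) (h : OscillationControlled F Ω A B)
    (h' : OscillationControlled F Ω D B) : OscillationControlled F Ω A D := by
  obtain ⟨C, hC, h⟩ := h
  obtain ⟨C', hC', h'⟩ := h'
  have hfin' : ∀ {S : Set (EuclideanSpace ℝ (Fin N))}, S ⊆ Ω → volume S ≠ ⊤ := fun hS =>
    ne_top_of_le_ne_top hfin (measure_mono hS)
  refine ⟨(volume B)⁻¹ * (volume D * C + volume A * C'), ENNReal.mul_ne_top
    (ENNReal.inv_ne_top.2 hB) (ENNReal.add_ne_top.2 ⟨ENNReal.mul_ne_top (hfin' hDΩ) hC,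
      ENNReal.mul_ne_top (hfin' hAΩ) hC'⟩), fun φ g hφ hg => ?_⟩
  have hmB : ∀ y, AEMeasurable (fun z => ‖φ y - φ z‖ₑ) (volume.restrict B) := fun y =>
    (aestronglyMeasurable_const.sub (hφ.mono_set hBΩ).1).enorm
  have key : volume B * oscillation φ A D ≤
      volume D * oscillation φ A B + volume A * oscillation φ D B := by
    calc volume B * oscillation φ A D
        = ∫⁻ y in A, ∫⁻ w in D, ∫⁻ _z in B, ‖φ y - φ w‖ₑ := by
          rw [oscillation, ← lintegral_const_mul' _ _ (hfin' hBΩ)]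
          refine lintegral_congr fun y => ?_
          rw [← lintegral_const_mul' _ _ (hfin' hBΩ)]
          refine lintegral_congr fun w => ?_
          rw [setLIntegral_const, mul_comm]
      _ ≤ ∫⁻ y in A, ∫⁻ w in D, ((∫⁻ z in B, ‖φ y - φ z‖ₑ) + ∫⁻ z in B, ‖φ w - φ z‖ₑ) := by
          refine lintegral_mono fun y => lintegral_mono fun w => ?_
          rw [← lintegral_add_left' (hmB y)]
          refine lintegral_mono fun z => ?_
          simp only
          rw [show φ y - φ w = (φ y - φ z) - (φ w - φ z) by abel]
          exact enorm_sub_le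
      _ = ∫⁻ y in A, (volume D * (∫⁻ z in B, ‖φ y - φ z‖ₑ) + oscillation φ D B) := by
          refine lintegral_congr fun y => ?_
          rw [lintegral_add_left measurable_const, setLIntegral_const, mul_comm]
          rfl
      _ = volume D * oscillation φ A B + volume A * oscillation φ D B := by
          rw [lintegral_add_right _ measurable_const, setLIntegral_const,
            lintegral_const_mul' _ _ (hfin' hDΩ), mul_comm (oscillation φ D B)]
          rfl
  have hb : oscillation φ A D = (volume B)⁻¹ * (volume B * oscillation φ A D) := by
    rw [← mul_assoc, ENNReal.inv_mul_cancel hB (hfin' hBΩ), one_mul]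
  rw [hb, mul_assoc, add_mul, mul_assoc, mul_assoc]
  gcongr
  refine key.trans ?_
  gcongr
  · exact h φ g hφ hg
  · exact h' φ g hφ hg

lemma symm (hAΩ : A ⊆ Ω) (hBΩ : B ⊆ Ω) (h : OscillationControlled F Ω A B) :
    OscillationControlled F Ω B A := by
  obtain ⟨C, hC, h⟩ := h
  refine ⟨C, hC, fun φ g hφ hg => le_trans (le_of_eq ?_) (h φ g hφ hg)⟩
  rw [oscillation, oscillation, lintegral_lintegral_swap (aemeasurable_enorm_sub hφ hBΩ hAΩ)]
  simp only [enorm_sub_rev]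

end OscillationControlled

end Oscillation

/-! ### Poincaré–Wirtinger inequality on smooth bounded domains -/

section Poincare

variable {N : ℕ} {F : Type*} [NormedAddCommGroup F] [NormedSpace ℝ F]
  {Ω : Set (EuclideanSpace ℝ (Fin N))}

/-- Near a boundary point, a domain with smooth boundary is star-shaped with respect to a ball. -/
lemma HasSmoothBoundary.exists_segment_subset (hb : HasSmoothBoundary Ω)
    {x : EuclideanSpace ℝ (Fin N)} (hx : x ∈ frontier Ω) :
    ∃ δ > 0, ∃ p ∈ Ω, ∃ r > 0, Metric.ball p r ⊆ Ω ∧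
      ∀ y ∈ Metric.ball x δ ∩ Ω, ∀ z ∈ Metric.ball p r, ∀ t ∈ Icc (0 : ℝ) 1,
        z + t • (y - z) ∈ Ω := by
  obtain ⟨U, hU, ρ, hρ, hρx, hρΩ⟩ := hb x hx
  obtain ⟨e, he⟩ : ∃ e, 0 < fderiv ℝ ρ x e := by
    obtain ⟨e, he⟩ : ∃ e, fderiv ℝ ρ x e ≠ 0 := by
      by_contra! h
      exact hρx (ContinuousLinearMap.ext h)
    rcases he.lt_or_gt with h | h
    · exact ⟨-e, by simpa using h⟩
    · exact ⟨e, h⟩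
  have hcont : Continuous fun q : EuclideanSpace ℝ (Fin N) × EuclideanSpace ℝ (Fin N) =>
      fderiv ℝ ρ q.1 q.2 :=
    ((hρ.continuous_fderiv (by simp)).comp continuous_fst).clm_apply continuous_snd
  have hnhds : {q : EuclideanSpace ℝ (Fin N) × EuclideanSpace ℝ (Fin N) |
      0 < fderiv ℝ ρ q.1 q.2} ∈ 𝓝 (x, e) :=
    (isOpen_lt continuous_const hcont).mem_nhds he
  obtain ⟨κ, hκ, hκsub⟩ := Metric.mem_nhds_iff.1 hnhds
  obtain ⟨r₀, hr₀, hr₀U⟩ := Metric.mem_nhds_iff.1 hU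
  set r := min r₀ κ with hr
  have hrpos : 0 < r := lt_min hr₀ hκ
  have hpos : ∀ y ∈ Metric.ball x r, ∀ w ∈ Metric.ball e κ, 0 < fderiv ℝ ρ y w := by
    intro y hy w hw
    have : (y, w) ∈ Metric.ball (x, e) κ := by
      rw [← ball_prod_same]
      exact ⟨Metric.ball_subset_ball (min_le_right _ _) hy, hw⟩
    exact hκsub this
  -- Near `x` the function `ρ` increases in every direction close to `e`, so moving backwards along
  -- such a direction keeps it negative, hence stays in `Ω`.
  have hdown : ∀ y ∈ Metric.ball x r ∩ Ω, ∀ w ∈ Metric.ball e κ, ∀ t : ℝ, 0 ≤ t →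
      y - t • w ∈ Metric.ball x r → y - t • w ∈ Ω := by
    intro y hy w hw t ht hyt
    have hseg : ∀ s ∈ Icc (0 : ℝ) t, y - s • w ∈ Metric.ball x r := by
      intro s hs
      rcases ht.eq_or_lt with h0 | h0
      · have : s = 0 := le_antisymm (h0 ▸ hs.2) hs.1
        simpa [this] using hy.1
      have := (convex_ball x r) hy.1 hyt (a := 1 - s / t) (b := s / t)
        (by rw [sub_nonneg, div_le_one h0]; exact hs.2) (div_nonneg hs.1 ht) (by ring)
      convert this using 1
      rw [smul_sub, smul_smul, div_mul_cancel₀ _ h0.ne', sub_smul, one_smul]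
      abel
    have hd : ∀ s : ℝ, HasDerivAt (fun s : ℝ => ρ (y - s • w))
        (fderiv ℝ ρ (y - s • w) (-w)) s := by
      intro s
      have h1 : HasDerivAt (fun s : ℝ => y - s • w) (-w) s := by
        simpa using ((hasDerivAt_id s).smul_const w).const_sub y
      exact ((hρ.differentiable (by simp)) _).hasFDerivAt.comp_hasDerivAt s h1
    have hanti : AntitoneOn (fun s : ℝ => ρ (y - s • w)) (Icc 0 t) := by
      refine antitoneOn_of_deriv_nonpos (convex_Icc _ _)
        (fun s _ => (hd s).continuousAt.continuousWithinAt)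
        (fun s _ => (hd s).differentiableAt.differentiableWithinAt) fun s hs => ?_
      rw [(hd s).deriv, map_neg]
      exact (neg_neg_of_pos (hpos _ (hseg s (interior_subset hs)) w hw)).le
    have hle := hanti (left_mem_Icc.2 ht) (right_mem_Icc.2 ht) ht
    simp only [zero_smul, sub_zero] at hle
    have hyU : y ∈ U := hr₀U (Metric.ball_subset_ball (min_le_left _ _) hy.1)
    have hyU' : y - t • w ∈ U := hr₀U (Metric.ball_subset_ball (min_le_left _ _) hyt)
    exact (hρΩ _ hyU').2 (hle.trans_lt ((hρΩ y hyU).1 hy.2))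
  -- With this `s`, the balls of radius `s κ / 2` about `x` and about `x - s e` both lie in `ball x
  -- r`, and the difference of a point of the first and a point of the second is `s w` with `w`
  -- within `κ` of `e`.
  set s : ℝ := r / (2 * (‖e‖ + κ)) with hs
  have hden : 0 < ‖e‖ + κ := by positivity
  have hspos : 0 < s := by positivity
  have hsr : s * (‖e‖ + κ) = r / 2 := by
    rw [hs]; field_simp
  have hball_p : Metric.ball (x - s • e) (s * (κ / 2)) ⊆ Metric.ball x r := by
    intro z hz
    rw [Metric.mem_ball, dist_eq_norm] at hz ⊢
    have h1 : z - x = (z - (x - s • e)) - s • e := by abel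
    rw [h1]
    refine (norm_sub_le _ _).trans_lt ?_
    rw [norm_smul, Real.norm_of_nonneg hspos.le]
    nlinarith
  have hball_x : Metric.ball x (s * (κ / 2)) ⊆ Metric.ball x r := by
    refine Metric.ball_subset_ball ?_
    nlinarith [norm_nonneg e, mul_nonneg hspos.le (norm_nonneg e), mul_pos hspos hκ]
  have hseg : ∀ y ∈ Metric.ball x (s * (κ / 2)) ∩ Ω, ∀ z ∈ Metric.ball (x - s • e) (s * (κ / 2)),
      ∀ t ∈ Icc (0 : ℝ) 1, z + t • (y - z) ∈ Ω := by
    intro y hy z hz t ht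
    set w := s⁻¹ • (y - z) with hw
    have hsw : s • w = y - z := by rw [hw, smul_smul, mul_inv_cancel₀ hspos.ne', one_smul]
    have hwe : w ∈ Metric.ball e κ := by
      rw [Metric.mem_ball, dist_eq_norm]
      have h1 : w - e = s⁻¹ • ((y - x) - (z - (x - s • e))) := by
        have : e = s⁻¹ • (s • e) := by rw [smul_smul, inv_mul_cancel₀ hspos.ne', one_smul]
        conv_lhs => rw [this, hw, ← smul_sub]
        congr 1
        abel
      rw [h1, norm_smul, norm_inv, Real.norm_of_nonneg hspos.le, inv_mul_lt_iff₀ hspos]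
      have h2 := hy.1
      rw [Metric.mem_ball, dist_eq_norm] at h2 hz
      refine (norm_sub_le _ _).trans_lt ?_
      linarith
    have hrep : z + t • (y - z) = y - ((1 - t) * s) • w := by
      rw [mul_smul, hsw, sub_smul, one_smul]
      abel
    rw [hrep]
    refine hdown y ⟨hball_x hy.1, hy.2⟩ w hwe _ (mul_nonneg (by linarith [ht.2]) hspos.le) ?_
    rw [← hrep]
    have := (convex_ball x r) (hball_p hz) (hball_x hy.1) (a := 1 - t) (b := t)
      (by linarith [ht.2]) ht.1 (by ring)
    convert this using 1
    rw [smul_sub, sub_smul, one_smul]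
    abel
  have hδ : 0 < s * (κ / 2) := by positivity
  -- A single point of `Ω` near `x` suffices: the segments issuing from it start (`t = 0`) at
  -- arbitrary points of the second ball, which is therefore contained in `Ω`.
  obtain ⟨y, hyΩ, hyx⟩ := Metric.mem_closure_iff.1 (frontier_subset_closure hx) _ hδ
  have hsub : Metric.ball (x - s • e) (s * (κ / 2)) ⊆ Ω := by
    intro z hz
    have := hseg y ⟨by rwa [Metric.mem_ball, dist_comm], hyΩ⟩ z hz 0 (by simp)
    simpa using this
  exact ⟨_, hδ, x - s • e, hsub (Metric.mem_ball_self hδ), _, hδ, hsub, hseg⟩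

lemma oscillationControlled_ball [CompleteSpace F] (hΩ : IsOpen Ω)
    (hbdd : Bornology.IsBounded Ω) {p : EuclideanSpace ℝ (Fin N)} {r : ℝ}
    (hp : Metric.ball p r ⊆ Ω) :
    OscillationControlled F Ω (Metric.ball p r) (Metric.ball p r) := by
  refine oscillationControlled_of_segment hΩ hbdd Metric.isOpen_ball Metric.isOpen_ball hp hp
    fun y hy z hz t ht => hp ?_
  exact (convex_ball p r).add_smul_sub_mem hz hy ht

/-- Fix a reference ball `B`. The points with a surrounding ball controlled against `B` form a set
that is open and, relative to `Ω`, closed, so connectedness gives all of `Ω`. At the boundary,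
star-shapedness with respect to an interior ball takes over. Compactness of the closure leaves
finitely many pieces, and `B` then serves as the intermediate set linking `Ω` to itself. -/
lemma IsSmoothBoundedDomain.oscillationControlled [CompleteSpace F]
    (hΩ : IsSmoothBoundedDomain Ω) : OscillationControlled F Ω Ω Ω := by
  have hopen := hΩ.isOpen
  have hbdd := hΩ.isBounded
  have hfin : volume Ω ≠ ⊤ := hbdd.measure_lt_top.ne
  obtain ⟨p₀, hp₀⟩ := hΩ.isConnected.nonempty
  obtain ⟨r₀, hr₀, hB⟩ := Metric.isOpen_iff.1 hopen p₀ hp₀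
  set B := Metric.ball p₀ r₀ with hBdef
  have hBvol : volume B ≠ 0 := (Metric.measure_ball_pos _ _ hr₀).ne'
  set S : Set (EuclideanSpace ℝ (Fin N)) :=
    {p | ∃ r > 0, Metric.ball p r ⊆ Ω ∧ OscillationControlled F Ω (Metric.ball p r) B} with hS
  have hSopen : IsOpen S := by
    rw [Metric.isOpen_iff]
    rintro p ⟨r, hr, hrΩ, hc⟩
    refine ⟨r, hr, fun q hq => ?_⟩
    obtain ⟨r', hr', hsub⟩ := Metric.isOpen_iff.1 Metric.isOpen_ball q hq
    exact ⟨r', hr', hsub.trans hrΩ, hc.mono hsub subset_rfl⟩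
  have hSΩ : Ω ⊆ S := by
    refine hΩ.isConnected.isPreconnected.subset_of_closure_inter_subset hSopen
      ⟨p₀, hp₀, r₀, hr₀, hB, oscillationControlled_ball hopen hbdd hB⟩ ?_
    rintro q ⟨hqS, hqΩ⟩
    obtain ⟨r, hr, hrΩ⟩ := Metric.isOpen_iff.1 hopen q hqΩ
    obtain ⟨p, ⟨r', hr', hr'Ω, hc⟩, hpq⟩ := Metric.mem_closure_iff.1 hqS r hr
    -- The overlap of the two balls is the intermediate set: controlled against the new ball by
    -- convexity and against `B` by assumption.
    set W := Metric.ball q r ∩ Metric.ball p r' with hW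
    have hWvol : volume W ≠ 0 := by
      refine ((Metric.isOpen_ball.inter Metric.isOpen_ball).measure_pos volume ⟨p, ?_, ?_⟩).ne'
      · rwa [Metric.mem_ball, dist_comm]
      · exact Metric.mem_ball_self hr'
    have hWΩ : W ⊆ Ω := inter_subset_left.trans hrΩ
    refine ⟨r, hr, hrΩ, ?_⟩
    exact OscillationControlled.trans hfin hrΩ hWΩ hB hWvol
      ((oscillationControlled_ball hopen hbdd hrΩ).mono subset_rfl inter_subset_left)
      ((hc.mono inter_subset_right subset_rfl).symm hWΩ hB)
  have hcpt : IsCompact (closure Ω) := hbdd.isCompact_closure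
  have hall : OscillationControlled F Ω (closure Ω ∩ Ω) B := by
    refine hcpt.induction_on (p := fun s => OscillationControlled F Ω (s ∩ Ω) B) ?_ ?_ ?_ ?_
    · rw [empty_inter]; exact OscillationControlled.empty_left
    · exact fun s t hst h => h.mono (inter_subset_inter_left _ hst) subset_rfl
    · intro s t h h'
      rw [union_inter_distrib_right]
      exact h.union_left h'
    · intro x hx
      by_cases hxΩ : x ∈ Ω
      · obtain ⟨r, hr, hrΩ, hc⟩ := hSΩ hxΩ
        exact ⟨_, mem_nhdsWithin_of_mem_nhds (Metric.ball_mem_nhds x hr),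
          hc.mono inter_subset_left subset_rfl⟩
      · have hxf : x ∈ frontier Ω := ⟨hx, by rwa [hopen.interior_eq]⟩
        obtain ⟨δ, hδ, p, hp, r, hr, hrΩ, hseg⟩ :=
          hΩ.smoothBoundary.exists_segment_subset hxf
        obtain ⟨r', hr', hr'Ω, hc⟩ := hSΩ hp
        set W := Metric.ball p (min r r') with hW
        have hWΩ : W ⊆ Ω := (Metric.ball_subset_ball (min_le_left _ _)).trans hrΩ
        refine ⟨_, mem_nhdsWithin_of_mem_nhds (Metric.ball_mem_nhds x hδ), ?_⟩
        have h1 : OscillationControlled F Ω (Metric.ball x δ ∩ Ω) (Metric.ball p r) :=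
          oscillationControlled_of_segment hopen hbdd (Metric.isOpen_ball.inter hopen)
            Metric.isOpen_ball inter_subset_right hrΩ hseg
        exact OscillationControlled.trans hfin inter_subset_right hWΩ hB
          (Metric.measure_ball_pos _ _ (lt_min hr hr')).ne'
          (h1.mono subset_rfl (Metric.ball_subset_ball (min_le_left _ _)))
          ((hc.mono (Metric.ball_subset_ball (min_le_right _ _)) subset_rfl).symm hWΩ hB)
  rw [inter_eq_self_of_subset_right subset_closure] at hall
  exact OscillationControlled.trans hfin subset_rfl hB subset_rfl hBvol hall hall

/-- The Poincaré–Wirtinger inequality in `W^{1,1}` of a smooth bounded domain. -/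
lemma IsSmoothBoundedDomain.exists_poincare [CompleteSpace F] (hΩ : IsSmoothBoundedDomain Ω) :
    ∃ C : ENNReal, C ≠ ⊤ ∧ ∀ (φ : EuclideanSpace ℝ (Fin N) → F)
      (g : Fin N → EuclideanSpace ℝ (Fin N) → F), IntegrableOn φ Ω →
      (∀ i, HasWeakPartial Ω i φ (g i)) →
        ∫⁻ x in Ω, ‖φ x - ⨍ y in Ω, φ y‖ₑ ≤ C * ∑ i, ∫⁻ x in Ω, ‖g i x‖ₑ := by
  obtain ⟨C, hC, h⟩ := hΩ.oscillationControlled (F := F)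
  have hfin : volume Ω ≠ ⊤ := hΩ.isBounded.measure_lt_top.ne
  have hpos : volume Ω ≠ 0 := (hΩ.isOpen.measure_pos volume hΩ.isConnected.nonempty).ne'
  have : IsFiniteMeasure (volume.restrict Ω) := isFiniteMeasure_restrict.2 hfin
  have : NeZero (volume.restrict Ω) := ⟨by rwa [Ne, Measure.restrict_eq_zero]⟩
  refine ⟨(volume Ω)⁻¹ * C, ENNReal.mul_ne_top (ENNReal.inv_ne_top.2 hpos) hC,
    fun φ g hφ hg => ?_⟩
  -- The deviation from the mean is the mean of the differences, so the inequality reduces to the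
  -- oscillation over `Ω × Ω`.
  have key : ∀ x, ‖φ x - ⨍ y in Ω, φ y‖ₑ ≤ (volume Ω)⁻¹ * ∫⁻ y in Ω, ‖φ x - φ y‖ₑ := by
    intro x
    have h1 : φ x - ⨍ y in Ω, φ y = ⨍ y in Ω, (φ x - φ y) := by
      rw [average_eq, average_eq, integral_sub (integrable_const _) hφ, smul_sub, integral_const,
        smul_smul, inv_mul_cancel₀, one_smul]
      exact (measureReal_ne_zero_iff).2 (by rwa [Measure.restrict_apply_univ])
    rw [h1, average_eq, enorm_smul]
    refine mul_le_mul' (le_of_eq ?_) (enorm_integral_le_lintegral_enorm _)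
    rw [measureReal_restrict_apply_univ, enorm_inv, Measure.real]
    · congr 1
      rw [← ofReal_norm, Real.norm_of_nonneg ENNReal.toReal_nonneg, ENNReal.ofReal_toReal hfin]
    · exact (ENNReal.toReal_pos hpos hfin).ne'
  refine (lintegral_mono key).trans ?_
  rw [lintegral_const_mul' _ _ (ENNReal.inv_ne_top.2 hpos), mul_assoc]
  gcongr
  exact h φ g hφ hg

end Poincare

/-! ### Circle-valued Sobolev maps and the vanishing of `Σ` -/

section CircleGradient

variable {N : ℕ} {Ω : Set (EuclideanSpace ℝ (Fin N))}

lemma norm_toLp_le_of_norm_le {F F' : Type*} [NormedAddCommGroup F] [NormedAddCommGroup F']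
    {a : Fin N → F} {b : Fin N → F'} (h : ∀ i, ‖a i‖ ≤ ‖b i‖) :
    ‖WithLp.toLp 2 a‖ ≤ ‖WithLp.toLp 2 b‖ := by
  rw [PiLp.norm_eq_of_L2, PiLp.norm_eq_of_L2]
  refine Real.sqrt_le_sqrt (Finset.sum_le_sum fun i _ => ?_)
  exact pow_le_pow_left₀ (norm_nonneg _) (h i) 2

lemma norm_toLp_congr {F F' : Type*} [NormedAddCommGroup F] [NormedAddCommGroup F']
    {a : Fin N → F} {b : Fin N → F'} (h : ∀ i, ‖a i‖ = ‖b i‖) :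
    ‖WithLp.toLp 2 a‖ = ‖WithLp.toLp 2 b‖ :=
  le_antisymm (norm_toLp_le_of_norm_le fun i => (h i).le)
    (norm_toLp_le_of_norm_le fun i => (h i).ge)

variable {u v : EuclideanSpace ℝ (Fin N) → Circle} {X : Fin N → EuclideanSpace ℝ (Fin N) → ℝ}

lemma gradL1_circle (hΩ : IsOpen Ω) (hu : IntegrableOn (fun x => (u x : ℂ)) Ω)
    (hX : ∀ i, HasPhase Ω i u (X i)) :
    gradL1 Ω (fun x => (u x : ℂ)) = ∫ x in Ω, ‖WithLp.toLp 2 fun i => X i x‖ := by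
  rw [gradL1_eq hΩ hu fun i => (hX i).weakPartial]
  refine integral_congr_ae (Eventually.of_forall fun x => norm_toLp_congr fun i => ?_)
  rw [norm_phase, Real.norm_eq_abs]

lemma aestronglyMeasurable_circle_mul {μ : Measure (EuclideanSpace ℝ (Fin N))}
    (hu : AEStronglyMeasurable (fun x => (u x : ℂ)) μ)
    (hv : AEStronglyMeasurable (fun x => (v x : ℂ)) μ) :
    AEStronglyMeasurable (fun x => ((u x * v x : Circle) : ℂ)) μ := by
  simp only [Circle.coe_mul]
  exact hu.mul hv

lemma aestronglyMeasurable_circle_inv {μ : Measure (EuclideanSpace ℝ (Fin N))}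
    (hu : AEStronglyMeasurable (fun x => (u x : ℂ)) μ) :
    AEStronglyMeasurable (fun x => (((u x)⁻¹ : Circle) : ℂ)) μ := by
  simpa only [Circle.coe_inv_eq_conj] using Complex.continuous_conj.comp_aestronglyMeasurable hu

lemma aestronglyMeasurable_circle_exp {μ : Measure (EuclideanSpace ℝ (Fin N))}
    {φ : EuclideanSpace ℝ (Fin N) → ℝ} (hφ : AEStronglyMeasurable φ μ) :
    AEStronglyMeasurable (fun x => ((Circle.exp (φ x) : Circle) : ℂ)) μ :=
  (continuous_subtype_val.comp Circle.exp.continuous).comp_aestronglyMeasurable hφ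

lemma memW11_const (hfin : volume Ω ≠ ⊤) (c : ℝ) : MemW11 Ω (fun _ => c) :=
  memW11_of_hasWeakPartial (integrableOn_const hfin) fun i => HasWeakPartial.const hfin i c

lemma MemW11.add {φ ψ : EuclideanSpace ℝ (Fin N) → ℝ} (hφ : MemW11 Ω φ) (hψ : MemW11 Ω ψ) :
    MemW11 Ω (fun x => φ x + ψ x) := by
  obtain ⟨Z, hZ⟩ := hφ.exists_hasWeakPartial
  obtain ⟨W, hW⟩ := hψ.exists_hasWeakPartial
  exact memW11_of_hasWeakPartial (hφ.1.add hψ.1) fun i => (hZ i).add (hW i)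

lemma MemW11.neg {φ : EuclideanSpace ℝ (Fin N) → ℝ} (hφ : MemW11 Ω φ) :
    MemW11 Ω (fun x => -φ x) := by
  obtain ⟨Z, hZ⟩ := hφ.exists_hasWeakPartial
  exact memW11_of_hasWeakPartial hφ.1.neg fun i => (hZ i).neg

lemma memW11Circle_of_hasPhase (hu : IntegrableOn (fun x => (u x : ℂ)) Ω)
    (hX : ∀ i, HasPhase Ω i u (X i)) : u ∈ W11Circle Ω :=
  memW11_of_hasWeakPartial hu fun i => (hX i).weakPartial

lemma mul_mem_W11Circle (hΩ : IsOpen Ω) (hfin : volume Ω ≠ ⊤) (hu : u ∈ W11Circle Ω)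
    (hv : v ∈ W11Circle Ω) : (fun x => u x * v x) ∈ W11Circle Ω := by
  obtain ⟨X, hX⟩ := exists_hasPhase hΩ hfin hu
  obtain ⟨Y, hY⟩ := exists_hasPhase hΩ hfin hv
  exact memW11Circle_of_hasPhase
    (integrableOn_circle hfin (aestronglyMeasurable_circle_mul hu.1.1 hv.1.1))
    fun i => (hX i).mul hΩ hfin (hY i)

lemma inv_mem_W11Circle (hΩ : IsOpen Ω) (hfin : volume Ω ≠ ⊤) (hu : u ∈ W11Circle Ω) :
    (fun x => (u x)⁻¹) ∈ W11Circle Ω := by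
  obtain ⟨X, hX⟩ := exists_hasPhase hΩ hfin hu
  exact memW11Circle_of_hasPhase
    (integrableOn_circle hfin (aestronglyMeasurable_circle_inv hu.1.1)) fun i => (hX i).inv

lemma exp_mem_W11Circle (hΩ : IsOpen Ω) (hfin : volume Ω ≠ ⊤)
    {φ : EuclideanSpace ℝ (Fin N) → ℝ} (hφ : MemW11 Ω φ) :
    (fun x => Circle.exp (φ x)) ∈ W11Circle Ω := by
  obtain ⟨Z, hZ⟩ := hφ.exists_hasWeakPartial
  exact memW11Circle_of_hasPhase
    (integrableOn_circle hfin (aestronglyMeasurable_circle_exp hφ.1.1))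
    fun i => HasPhase.exp hΩ hfin (hZ i)

lemma mem_eqClass_self (hfin : volume Ω ≠ ⊤) (hu : u ∈ W11Circle Ω) : u ∈ eqClass Ω u :=
  ⟨hu, fun _ => 0, memW11_const hfin 0, Eventually.of_forall fun x => by simp⟩

lemma bddBelow_range_gradL1 {ι F : Type*} [NormedAddCommGroup F] [NormedSpace ℝ F]
    (f : ι → EuclideanSpace ℝ (Fin N) → F) : BddBelow (range fun j => gradL1 Ω (f j)) :=
  ⟨0, by rintro _ ⟨j, rfl⟩; exact gradL1_nonneg⟩

lemma Sigma_nonneg : 0 ≤ Sigma Ω u := Real.iInf_nonneg fun _ => gradL1_nonneg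

lemma exists_gradL1_lt_of_Sigma_lt (hfin : volume Ω ≠ ⊤) {t : ℝ} (h : Sigma Ω u < t) :
    ∃ φ, MemW11 Ω φ ∧
      gradL1 Ω (fun x => ((u x * Circle.exp (-φ x) : Circle) : ℂ)) < t := by
  have : Nonempty {φ : EuclideanSpace ℝ (Fin N) → ℝ // MemW11 Ω φ} := ⟨_, memW11_const hfin 0⟩
  obtain ⟨⟨φ, hφ⟩, h⟩ := exists_lt_of_ciInf_lt h
  exact ⟨φ, hφ, h⟩

lemma Sigma_le {φ : EuclideanSpace ℝ (Fin N) → ℝ} (hφ : MemW11 Ω φ) :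
    Sigma Ω u ≤ gradL1 Ω (fun x => ((u x * Circle.exp (-φ x) : Circle) : ℂ)) :=
  ciInf_le (bddBelow_range_gradL1 _) (⟨φ, hφ⟩ : {φ // MemW11 Ω φ})

lemma distToClass_le (hv : v ∈ eqClass Ω u) (w : EuclideanSpace ℝ (Fin N) → Circle) :
    distToClass Ω w u ≤ gradL1 Ω (fun x => (w x : ℂ) - (v x : ℂ)) :=
  ciInf_le (bddBelow_range_gradL1 _) (⟨v, hv⟩ : eqClass Ω u)

/-- `Σ(u v⁻¹)` vanishes only if `u` and `v` are equivalent. -/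
lemma equivalent_of_Sigma_eq_zero (hΩ : IsSmoothBoundedDomain Ω) (hu : u ∈ W11Circle Ω)
    (hv : v ∈ W11Circle Ω) (h0 : Sigma Ω (fun x => u x * (v x)⁻¹) = 0) : Equivalent Ω u v := by
  have hopen := hΩ.isOpen
  have hfin : volume Ω ≠ ⊤ := hΩ.isBounded.measure_lt_top.ne
  have hpos : volume Ω ≠ 0 := (hopen.measure_pos volume hΩ.isConnected.nonempty).ne'
  have : IsFiniteMeasure (volume.restrict Ω) := isFiniteMeasure_restrict.2 hfin
  have hne : NeZero (volume.restrict Ω) := ⟨by rwa [Ne, Measure.restrict_eq_zero]⟩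
  set w₀ : EuclideanSpace ℝ (Fin N) → Circle := fun x => u x * (v x)⁻¹ with hw₀
  have hw₀mem : w₀ ∈ W11Circle Ω := mul_mem_W11Circle hopen hfin hu (inv_mem_W11Circle hopen hfin hv)
  obtain ⟨X, hX⟩ := exists_hasPhase hopen hfin hw₀mem
  -- The infimum being zero, competitors can be chosen with geometrically decaying energy, so that
  -- the resulting `L¹` errors are summable.
  have hex : ∀ k : ℕ, ∃ φ, MemW11 Ω φ ∧
      gradL1 Ω (fun x => ((w₀ x * Circle.exp (-φ x) : Circle) : ℂ)) < (1 / 2 : ℝ) ^ k := fun k =>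
    exists_gradL1_lt_of_Sigma_lt hfin (by rw [h0]; positivity)
  choose φ hφ hφlt using hex
  have hex2 : ∀ k, ∃ G : Fin N → EuclideanSpace ℝ (Fin N) → ℝ,
      ∀ i, HasWeakPartial Ω i (φ k) (G i) := fun k => (hφ k).exists_hasWeakPartial
  choose Z hZ using hex2
  have hclose : ∀ k i, ∫⁻ x in Ω, ‖Z k i x - X i x‖ₑ ≤ ENNReal.ofReal ((1 / 2) ^ k) := by
    intro k i
    have hph : ∀ i, HasPhase Ω i (fun x => w₀ x * Circle.exp (-φ k x))
        (fun x => X i x + -Z k i x) := fun i =>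
      (hX i).mul hopen hfin (HasPhase.exp hopen hfin (hZ k i).neg)
    have hlt := hφlt k
    rw [gradL1_circle hopen (integrableOn_circle hfin (aestronglyMeasurable_circle_mul
      hw₀mem.1.1 (aestronglyMeasurable_circle_exp (hφ k).neg.1.1))) hph] at hlt
    have hint := (integrableOn_toLp fun i => (hph i).integrableOn).norm
    calc ∫⁻ x in Ω, ‖Z k i x - X i x‖ₑ
        ≤ ∫⁻ x in Ω, ENNReal.ofReal ‖WithLp.toLp 2 fun i => X i x + -Z k i x‖ := by
          refine lintegral_mono fun x => ?_
          simp only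
          rw [← ofReal_norm, norm_sub_rev, sub_eq_add_neg]
          exact ENNReal.ofReal_le_ofReal
            (PiLp.norm_apply_le (WithLp.toLp 2 fun i => X i x + -Z k i x) i)
      _ = ENNReal.ofReal (∫ x in Ω, ‖WithLp.toLp 2 fun i => X i x + -Z k i x‖) :=
          (ofReal_integral_eq_lintegral_ofReal hint
            (Eventually.of_forall fun _ => norm_nonneg _)).symm
      _ ≤ _ := ENNReal.ofReal_le_ofReal hlt.le
  obtain ⟨C, hC, hP⟩ := hΩ.exists_poincare (F := ℝ)
  -- The `φ k` are determined only up to additive constants. With means removed, the Poincaré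
  -- inequality turns convergence of the gradients `Z k` to `X` into the Cauchy property.
  set ψ : ℕ → EuclideanSpace ℝ (Fin N) → ℝ := fun k x => φ k x - ⨍ y in Ω, φ k y with hψ
  have hψZ : ∀ k i, HasWeakPartial Ω i (ψ k) (Z k i) := fun k i => by
    simpa using (hZ k i).sub (HasWeakPartial.const hfin i (⨍ y in Ω, φ k y))
  have hψint : ∀ k, IntegrableOn (ψ k) Ω := fun k => (hφ k).1.sub (integrable_const _)
  -- The extra `1` gives the strict inequality demanded by the completeness criterion.
  set D : ℝ := (C * N * 2).toReal + 1 with hD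
  have hDC : C * N * 2 ≤ ENNReal.ofReal (D - 1) := by
    rw [hD, add_sub_cancel_right, ENNReal.ofReal_toReal]
    exact ENNReal.mul_ne_top (ENNReal.mul_ne_top hC (by simp)) (by simp)
  have hcauchy : ∀ n k l : ℕ, n ≤ k → n ≤ l →
      eLpNorm (ψ k - ψ l) 1 (volume.restrict Ω) < ENNReal.ofReal (D * (1 / 2) ^ n) := by
    intro n k l hk hl
    rw [eLpNorm_one_eq_lintegral_enorm]
    have h1 := hP (fun x => φ k x - φ l x) (fun i x => Z k i x - Z l i x)
      ((hφ k).1.sub (hφ l).1) fun i => (hZ k i).sub (hZ l i)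
    have h2 : ∀ x, φ k x - φ l x - ⨍ y in Ω, (φ k y - φ l y) = (ψ k - ψ l) x := by
      intro x
      have : ⨍ y in Ω, (φ k y - φ l y) = (⨍ y in Ω, φ k y) - ⨍ y in Ω, φ l y := by
        rw [average_eq, average_eq, average_eq, integral_sub (hφ k).1 (hφ l).1, smul_sub]
      rw [this, Pi.sub_apply]
      simp only [hψ]
      ring
    simp only [h2] at h1
    have h3 : ∀ i, ∫⁻ x in Ω, ‖Z k i x - Z l i x‖ₑ ≤ 2 * ENNReal.ofReal ((1 / 2) ^ n) := by
      intro i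
      have hpow : ∀ m, n ≤ m → ENNReal.ofReal ((1 / 2 : ℝ) ^ m) ≤ ENNReal.ofReal ((1 / 2) ^ n) :=
        fun m hm => ENNReal.ofReal_le_ofReal
          (pow_le_pow_of_le_one (by norm_num) (by norm_num) hm)
      calc ∫⁻ x in Ω, ‖Z k i x - Z l i x‖ₑ
          ≤ ∫⁻ x in Ω, (‖Z k i x - X i x‖ₑ + ‖Z l i x - X i x‖ₑ) := by
            refine lintegral_mono fun x => ?_
            simp only
            rw [show Z k i x - Z l i x = (Z k i x - X i x) - (Z l i x - X i x) by ring]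
            exact enorm_sub_le
        _ = (∫⁻ x in Ω, ‖Z k i x - X i x‖ₑ) + ∫⁻ x in Ω, ‖Z l i x - X i x‖ₑ :=
            lintegral_add_left' ((hZ k i).integrableOn_grad.1.sub (hX i).integrableOn.1).enorm _
        _ ≤ _ := by
            rw [two_mul]
            exact add_le_add ((hclose k i).trans (hpow k hk)) ((hclose l i).trans (hpow l hl))
    calc ∫⁻ x in Ω, ‖(ψ k - ψ l) x‖ₑ
        ≤ C * ∑ i : Fin N, 2 * ENNReal.ofReal ((1 / 2) ^ n) :=
          h1.trans (mul_le_mul_right (Finset.sum_le_sum fun i _ => h3 i) _)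
      _ = C * N * 2 * ENNReal.ofReal ((1 / 2) ^ n) := by
          rw [Finset.sum_const, Finset.card_univ, Fintype.card_fin, nsmul_eq_mul]
          ring
      _ ≤ ENNReal.ofReal ((D - 1) * (1 / 2) ^ n) := by
          rw [ENNReal.ofReal_mul (by rw [hD, add_sub_cancel_right]; exact ENNReal.toReal_nonneg)]
          exact mul_le_mul_left hDC _
      _ < ENNReal.ofReal (D * (1 / 2) ^ n) := by
          have hp : (0 : ℝ) < (1 / 2) ^ n := by positivity
          have hDpos : 0 < D := by rw [hD]; positivity
          exact (ENNReal.ofReal_lt_ofReal_iff (mul_pos hDpos hp)).2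
            (mul_lt_mul_of_pos_right (by linarith) hp)
  have hsum : ∑' n : ℕ, ENNReal.ofReal (D * (1 / 2) ^ n) ≠ ⊤ :=
    (summable_geometric_two.mul_left D).tsum_ofReal_ne_top
  obtain ⟨ψ', hψ', hlim⟩ := Lp.cauchy_complete_eLpNorm le_rfl
    (fun k => memLp_one_iff_integrable.2 (hψint k)) hsum hcauchy
  have hψ'int : IntegrableOn ψ' Ω := memLp_one_iff_integrable.1 hψ'
  simp only [eLpNorm_one_eq_lintegral_enorm, Pi.sub_apply] at hlim
  have hgeo : Tendsto (fun k : ℕ => ENNReal.ofReal ((1 / 2 : ℝ) ^ k)) atTop (𝓝 0) := by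
    simpa using ENNReal.tendsto_ofReal
      (tendsto_pow_atTop_nhds_zero_of_lt_one (r := (1 / 2 : ℝ)) (by norm_num) (by norm_num))
  have hψ'X : ∀ i, HasWeakPartial Ω i ψ' (X i) := fun i =>
    HasWeakPartial.of_tendsto (fun k => hψZ k i) hψ'int (hX i).integrableOn hlim
      (tendsto_of_tendsto_of_tendsto_of_le_of_le tendsto_const_nhds hgeo
        (fun _ => zero_le) fun k => hclose k i)
  have hψ'mem : MemW11 Ω ψ' := memW11_of_hasWeakPartial hψ'int hψ'X
  -- The limit `ψ'` has weak gradient exactly `X`, so removing it from `w₀` leaves a map with zero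
  -- gradient. A second use of the Poincaré inequality, now for complex values, makes that map
  -- constant.
  have hw : ∀ i, HasPhase Ω i (fun x => w₀ x * Circle.exp (-ψ' x)) (fun _ => 0) := fun i =>
    ((hX i).mul hopen hfin (HasPhase.exp hopen hfin (hψ'X i).neg)).congr_phase fun x => by ring
  have hwmem : (fun x => w₀ x * Circle.exp (-ψ' x)) ∈ W11Circle Ω :=
    mul_mem_W11Circle hopen hfin hw₀mem (exp_mem_W11Circle hopen hfin hψ'mem.neg)
  obtain ⟨C', hC', hP'⟩ := hΩ.exists_poincare (F := ℂ)
  have hzero := hP' _ _ hwmem.1 fun i => (hw i).weakPartial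
  simp only [Complex.ofReal_zero, mul_zero, enorm_zero, lintegral_zero, Finset.sum_const_zero,
    nonpos_iff_eq_zero] at hzero
  replace hzero := (lintegral_eq_zero_iff' (hwmem.1.1.sub aestronglyMeasurable_const).enorm).1 hzero
  obtain ⟨x₀, hx₀⟩ := hzero.exists
  set c : Circle := w₀ x₀ * Circle.exp (-ψ' x₀) with hc
  -- The constant `c` is absorbed into the phase by adding its argument.
  refine ⟨fun x => ψ' x + Complex.arg c, hψ'mem.add (memW11_const hfin _), ?_⟩
  filter_upwards [hzero] with x hx
  have h1 : ((w₀ x * Circle.exp (-ψ' x) : Circle) : ℂ) = (c : ℂ) := by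
    simp only [Pi.zero_apply, enorm_eq_zero] at hx hx₀
    exact (sub_eq_zero.1 hx).trans (sub_eq_zero.1 hx₀).symm
  have h2 : w₀ x * Circle.exp (-ψ' x) = c := Circle.ext h1
  rw [Circle.exp_add, Circle.exp_arg, ← h2, Circle.exp_neg, hw₀]
  simp only
  rw [mul_comm (Circle.exp (ψ' x)), mul_assoc (u x * (v x)⁻¹), inv_mul_cancel, mul_one, mul_assoc,
    inv_mul_cancel, mul_one]

end CircleGradient

/-! ### The angle in `(0, 2π]` and the chain rule for its primitives -/

section Angle

/-- The argument of a complex number, normalized to lie in `(0, 2π]`. -/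
noncomputable def posAngle (c : ℂ) : ℝ := toIocMod Real.two_pi_pos 0 (Complex.arg c)

lemma posAngle_mem (c : ℂ) : posAngle c ∈ Ioc 0 (2 * Real.pi) := by
  have h := toIocMod_mem_Ioc Real.two_pi_pos 0 (Complex.arg c)
  rw [zero_add] at h
  exact h

lemma exp_posAngle (z : Circle) : Circle.exp (posAngle z) = z := by
  have h := toIocMod_add_toIocDiv_zsmul Real.two_pi_pos 0 (Complex.arg z)
  have h2 : Circle.exp (posAngle z) = Circle.exp (Complex.arg z) := by
    conv_rhs => rw [← h, zsmul_eq_mul]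
    rw [Circle.periodic_exp.int_mul _ _]
    rfl
  rw [h2, Circle.exp_arg]

lemma measurable_toIocMod : Measurable (toIocMod Real.two_pi_pos 0) := by
  have : toIocMod Real.two_pi_pos 0 =
      fun t : ℝ => t - ((-⌊(0 + 2 * Real.pi - t) / (2 * Real.pi)⌋ : ℤ) : ℝ) * (2 * Real.pi) := by
    funext t
    rw [toIocMod, toIocDiv_eq_neg_floor, zsmul_eq_mul]
  rw [this]
  have h1 : Measurable fun t : ℝ => ⌊(0 + 2 * Real.pi - t) / (2 * Real.pi)⌋ :=
    Int.measurable_floor.comp (by fun_prop)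
  exact measurable_id.sub (((measurable_from_top (f := fun m : ℤ => ((-m : ℤ) : ℝ))).comp h1).mul_const _)

lemma measurable_posAngle : Measurable posAngle :=
  measurable_toIocMod.comp Complex.measurable_arg

/-- With representatives in `(0, 2π]` the jump takes place just after a multiple of `2π`, so to the
left of any point the reduction is a translation. This choice of interval preserves left continuity
under periodic extension. -/
lemma toIocMod_eventuallyEq (s : ℝ) :
    ∀ᶠ y in 𝓝[≤] s, toIocMod Real.two_pi_pos 0 y =
      y - (s - toIocMod Real.two_pi_pos 0 s) := by
  have hs := toIocMod_mem_Ioc Real.two_pi_pos 0 s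
  rw [zero_add] at hs
  have h1 : ∀ᶠ y in 𝓝[≤] s, s - toIocMod Real.two_pi_pos 0 s < y :=
    mem_nhdsWithin_of_mem_nhds (lt_mem_nhds (by linarith [hs.1]))
  filter_upwards [h1, self_mem_nhdsWithin] with y hy hys
  rw [toIocMod_eq_iff]
  refine ⟨⟨by linarith, ?_⟩, toIocDiv Real.two_pi_pos 0 s, ?_⟩
  · have : y ≤ s := hys
    linarith [hs.2]
  · have := toIocMod_add_toIocDiv_zsmul Real.two_pi_pos 0 s
    linarith

lemma integral_comp_toIocMod {h : ℝ → ℝ} {θ : ℝ} (hθ : θ ∈ Ioc 0 (2 * Real.pi)) :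
    ∫ s in (0 : ℝ)..θ, h (toIocMod Real.two_pi_pos 0 s) = ∫ s in (0 : ℝ)..θ, h s := by
  rw [intervalIntegral.integral_of_le hθ.1.le, intervalIntegral.integral_of_le hθ.1.le]
  refine setIntegral_congr_fun measurableSet_Ioc fun s hs => ?_
  have : toIocMod Real.two_pi_pos 0 s = s :=
    (toIocMod_eq_self Real.two_pi_pos).2 ⟨hs.1, by rw [zero_add]; exact hs.2.trans hθ.2⟩
  simp only [this]

variable {N : ℕ} {Ω : Set (EuclideanSpace ℝ (Fin N))} {i : Fin N}
  {u : EuclideanSpace ℝ (Fin N) → Circle} {X : EuclideanSpace ℝ (Fin N) → ℝ}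

/-- Chain rule for a primitive on `(0, 2π]` of a bounded left-continuous function of mean zero. -/
lemma HasPhase.comp_primitive_posAngle (hΩ : IsOpen Ω) (hfin : volume Ω ≠ ⊤)
    (hu : HasPhase Ω i u X) {h : ℝ → ℝ} (hm : Measurable h) {C : ℝ} (hC : ∀ s, |h s| ≤ C)
    (hh : ∀ s, ContinuousWithinAt h (Iic s) s)
    (hmean : ∫ s in (0 : ℝ)..2 * Real.pi, h s = 0) :
    HasWeakPartial Ω i (fun x => ∫ s in (0 : ℝ)..posAngle (u x), h s)
      (fun x => h (posAngle (u x)) * X x) := by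
  set G : ℝ → ℝ := fun s => h (toIocMod Real.two_pi_pos 0 s) with hG
  have hGm : Measurable G := hm.comp measurable_toIocMod
  have hper : Function.Periodic G (2 * Real.pi) := fun s => by
    simp only [hG, toIocMod_add_right]
  have hGC : ∀ s, |G s| ≤ C := fun s => hC _
  have hGmean : ∫ s in (0 : ℝ)..2 * Real.pi, G s = 0 := by
    rw [integral_comp_toIocMod ⟨Real.two_pi_pos, le_rfl⟩, hmean]
  have hGc : ∀ s, ContinuousWithinAt G (Iic s) s := by
    intro s
    set m := s - toIocMod Real.two_pi_pos 0 s with hm'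
    have h1 : ContinuousWithinAt (fun y => h (y - m)) (Iic s) s := by
      refine ContinuousWithinAt.comp (t := Iic (s - m)) (hh _)
        (continuous_id.sub continuous_const).continuousWithinAt fun y hy => ?_
      simpa using hy
    refine h1.congr_of_eventuallyEq ?_ ?_
    · filter_upwards [toIocMod_eventuallyEq s] with y hy
      simp only [hG, hy, hm']
    · simp only [hG, hm', sub_sub_cancel]
  have hint := intervalIntegrable_of_bounded hGm hGC
  have key := hu.comp_primitive_of_leftContinuous hΩ hfin hGm hGC hper hGc hGmean
  refine key.congr_ae (Eventually.of_forall fun x => ?_) (Eventually.of_forall fun x => rfl)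
  have hHper : Function.Periodic (fun a => ∫ s in (0 : ℝ)..a, G s) (2 * Real.pi) := by
    intro a
    simp only
    rw [← intervalIntegral.integral_add_adjacent_intervals (hint 0 a) (hint a _),
      hper.intervalIntegral_add_eq a 0, zero_add, hGmean, add_zero]
  simp only
  rw [← integral_comp_toIocMod (posAngle_mem _)]
  have h := toIocMod_add_toIocDiv_zsmul Real.two_pi_pos 0 (Complex.arg (u x))
  conv_lhs => rw [← h, zsmul_eq_mul]
  exact hHper.int_mul _ _

/-- Intervals open on the left and closed on the right have left-continuous indicators; hence the
slopes of the arc maps and of the zigzag are left-continuous. -/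
lemma eventually_mem_Ioc_iff (a b s : ℝ) :
    ∀ᶠ y in 𝓝[≤] s, (y ∈ Ioc a b ↔ s ∈ Ioc a b) := by
  rcases le_or_gt s a with h | h
  · filter_upwards [self_mem_nhdsWithin] with y hy
    have hy' : y ≤ s := hy
    constructor
    · rintro ⟨h1, -⟩; exact absurd (hy'.trans h) (not_le.2 h1)
    · rintro ⟨h1, -⟩; exact absurd h (not_le.2 h1)
  · rcases le_or_gt s b with h' | h'
    · filter_upwards [self_mem_nhdsWithin, mem_nhdsWithin_of_mem_nhds (lt_mem_nhds h)] with y hy hya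
      exact ⟨fun _ => ⟨h, h'⟩, fun _ => ⟨hya, le_trans hy h'⟩⟩
    · filter_upwards [mem_nhdsWithin_of_mem_nhds (lt_mem_nhds h')] with y hy
      constructor
      · rintro ⟨-, h1⟩; exact absurd hy (not_lt.2 h1)
      · rintro ⟨-, h1⟩; exact absurd h' (not_lt.2 h1)

end Angle

/-! ### Upper bound: collapsing all but one of `k` arcs -/

section UpperBound

variable {N : ℕ} {Ω : Set (EuclideanSpace ℝ (Fin N))}

/-- The `j`-th of the `k` arcs of equal length into which `(0, 2π]` is cut. -/
def arc (k j : ℕ) : Set ℝ := Ioc (2 * Real.pi * j / k) (2 * Real.pi * (j + 1) / k)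

open Classical in
/-- The slope of the map collapsing the complement of the `j`-th arc, minus one. -/
noncomputable def arcSlope (k j : ℕ) (s : ℝ) : ℝ := if s ∈ arc k j then (k : ℝ) - 1 else -1

lemma measurable_arcSlope (k j : ℕ) : Measurable (arcSlope k j) :=
  Measurable.ite measurableSet_Ioc measurable_const measurable_const

lemma abs_arcSlope_le (k j : ℕ) (s : ℝ) : |arcSlope k j s| ≤ k + 1 := by
  have : (0 : ℝ) ≤ k := Nat.cast_nonneg k
  rw [arcSlope]
  split_ifs <;> rw [abs_le] <;> constructor <;> linarith

open Classical in
lemma continuousWithinAt_arcSlope (k j : ℕ) (s : ℝ) :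
    ContinuousWithinAt (arcSlope k j) (Iic s) s := by
  refine (continuousWithinAt_const (b := arcSlope k j s)).congr_of_eventuallyEq ?_ rfl
  filter_upwards [eventually_mem_Ioc_iff (2 * Real.pi * j / k) (2 * Real.pi * (j + 1) / k) s]
    with y hy
  unfold arcSlope
  exact if_congr hy rfl rfl

/-- The left side is the lift of the collapsing map: it advances at speed `k` on the arc and stands
still elsewhere. -/
lemma integral_arcSlope (k j : ℕ) {θ : ℝ} (hθ : 0 ≤ θ) :
    θ + ∫ s in (0 : ℝ)..θ, arcSlope k j s = k * volume.real (Ioc 0 θ ∩ arc k j) := by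
  have h1 : ∀ s, arcSlope k j s = (arc k j).indicator (fun _ => (k : ℝ)) s - 1 := by
    intro s
    by_cases h : s ∈ arc k j <;> simp [arcSlope, h]
  have hm : MeasurableSet (arc k j) := measurableSet_Ioc
  have hi : IntegrableOn ((arc k j).indicator fun _ => (k : ℝ)) (Ioc 0 θ) :=
    (integrable_const _).indicator hm
  simp only [h1]
  rw [intervalIntegral.integral_of_le hθ, integral_sub hi (integrable_const _),
    setIntegral_indicator hm, setIntegral_const]
  simp [Measure.real, ENNReal.toReal_ofReal hθ, mul_comm]

lemma volume_arc {k j : ℕ} (hk : k ≠ 0) :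
    (k : ℝ) * volume.real (arc k j) = 2 * Real.pi := by
  have hk' : (0 : ℝ) < k := by positivity
  have hle : 2 * Real.pi * j / k ≤ 2 * Real.pi * (j + 1) / k := by
    gcongr
    linarith
  rw [arc, Real.volume_real_Ioc_of_le hle]
  field_simp
  ring

lemma arc_subset {k j : ℕ} (hj : j < k) : arc k j ⊆ Ioc 0 (2 * Real.pi) := by
  have hk' : (0 : ℝ) < k := by exact_mod_cast (Nat.zero_le j).trans_lt hj
  refine Ioc_subset_Ioc (by positivity) ?_
  rw [div_le_iff₀ hk']
  gcongr
  exact_mod_cast hj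

/-- Before the arc the lift is `0`, after it `2π`; both represent the point `1`. -/
lemma exp_integral_arcSlope {k j : ℕ} (hj : j < k) {θ : ℝ} (hθ : θ ∈ Ioc 0 (2 * Real.pi))
    (hθj : θ ∉ arc k j) : Circle.exp (θ + ∫ s in (0 : ℝ)..θ, arcSlope k j s) = 1 := by
  rw [integral_arcSlope k j hθ.1.le]
  rcases le_or_gt θ (2 * Real.pi * j / k) with h | h
  · have : Ioc 0 θ ∩ arc k j = ∅ := by
      rw [eq_empty_iff_forall_notMem]
      rintro s ⟨hs, hs'⟩
      exact absurd (hs.2.trans h) (not_le.2 hs'.1)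
    rw [this]
    simp
  · have h' : 2 * Real.pi * (j + 1) / k < θ := by
      by_contra! h2
      exact hθj ⟨h, h2⟩
    have : Ioc 0 θ ∩ arc k j = arc k j :=
      inter_eq_self_of_subset_right fun s hs => ⟨(arc_subset hj hs).1, hs.2.trans h'.le⟩
    rw [this, volume_arc (Nat.ne_of_gt ((Nat.zero_le j).trans_lt hj)), Circle.exp_two_pi]

open Classical in
lemma sum_arc_le_one (k : ℕ) (s : ℝ) :
    ∑ j ∈ Finset.range k, (if s ∈ arc k j then (1 : ℝ) else 0) ≤ 1 := by
  by_cases h : ∃ j ∈ Finset.range k, s ∈ arc k j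
  · obtain ⟨j, hj, hs⟩ := h
    have hk' : (0 : ℝ) < k := by
      exact_mod_cast (Nat.zero_le j).trans_lt (Finset.mem_range.1 hj)
    rw [Finset.sum_eq_single_of_mem j hj, if_pos hs]
    intro l _ hlj
    refine if_neg fun hl => hlj ?_
    have hlt : ∀ {a b : ℕ}, s ∈ arc k a → s ∈ arc k b → a < b + 1 := by
      intro a b ha hb
      have := ha.1.trans_le hb.2
      rw [div_lt_div_iff_of_pos_right hk', mul_lt_mul_iff_right₀ Real.two_pi_pos] at this
      exact_mod_cast this
    have h1 := hlt hl hs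
    have h2 := hlt hs hl
    omega
  · rw [Finset.sum_eq_zero]
    · exact zero_le_one
    · intro j hj
      exact if_neg fun hs => h ⟨j, hj, hs⟩

lemma norm_toLp_le_add {a : Fin N → ℂ} {b c : Fin N → ℝ} {α β : ℝ} (hα : 0 ≤ α) (hβ : 0 ≤ β)
    (h : ∀ i, ‖a i‖ ≤ α * |b i| + β * |c i|) :
    ‖WithLp.toLp 2 a‖ ≤ α * ‖WithLp.toLp 2 b‖ + β * ‖WithLp.toLp 2 c‖ := by
  have h1 : ‖WithLp.toLp 2 a‖ ≤ ‖α • WithLp.toLp 2 (fun i => |b i|) +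
      β • WithLp.toLp 2 (fun i => |c i|)‖ := by
    refine norm_toLp_le_of_norm_le fun i => (h i).trans ?_
    exact le_abs_self _
  refine h1.trans ((norm_add_le _ _).trans ?_)
  rw [norm_smul, norm_smul, Real.norm_of_nonneg hα, Real.norm_of_nonneg hβ,
    norm_toLp_congr (a := fun i => |b i|) (b := b) fun i => by simp,
    norm_toLp_congr (a := fun i => |c i|) (b := c) fun i => by simp]

lemma integrableOn_circle_sub {u v : EuclideanSpace ℝ (Fin N) → Circle}
    (hu : u ∈ W11Circle Ω) (hv : v ∈ W11Circle Ω) :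
    IntegrableOn (fun x => (u x : ℂ) - (v x : ℂ)) Ω :=
  hu.1.sub hv.1

/-- The distance of a map to a class is at most `Σ` of the quotient. -/
lemma distToClass_le_Sigma (hΩ : IsOpen Ω) (hfin : volume Ω ≠ ⊤)
    {u u₀ v₀ : EuclideanSpace ℝ (Fin N) → Circle} (hu : u ∈ eqClass Ω u₀)
    (hu₀ : u₀ ∈ W11Circle Ω) (hv₀ : v₀ ∈ W11Circle Ω) :
    distToClass Ω u v₀ ≤ Sigma Ω (fun x => u₀ x * (v₀ x)⁻¹) := by
  classical
  have : Nonempty {φ : EuclideanSpace ℝ (Fin N) → ℝ // MemW11 Ω φ} := ⟨_, memW11_const hfin 0⟩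
  refine le_ciInf fun ⟨φ, hφ⟩ => ?_
  obtain ⟨huW, φu, hφu, huu₀⟩ := hu
  set w : EuclideanSpace ℝ (Fin N) → Circle := fun x => u₀ x * (v₀ x)⁻¹ * Circle.exp (-φ x)
    with hw
  have hwW : w ∈ W11Circle Ω := mul_mem_W11Circle hΩ hfin
    (mul_mem_W11Circle hΩ hfin hu₀ (inv_mem_W11Circle hΩ hfin hv₀))
    (exp_mem_W11Circle hΩ hfin hφ.neg)
  obtain ⟨W, hW⟩ := exists_hasPhase hΩ hfin hwW
  obtain ⟨U, hU⟩ := exists_hasPhase hΩ hfin huW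
  change distToClass Ω u v₀ ≤ gradL1 Ω (fun x => (w x : ℂ))
  rw [gradL1_circle hΩ hwW.1 hW]
  set A : ℝ := ∫ x in Ω, ‖WithLp.toLp 2 fun i => W i x‖ with hA
  set B : ℝ := ∫ x in Ω, ‖WithLp.toLp 2 fun i => U i x‖ with hB
  have hWi := (integrableOn_toLp fun i => (hW i).integrableOn).norm
  have hUi := (integrableOn_toLp fun i => (hU i).integrableOn).norm
  have hang : AEMeasurable (fun x => posAngle (w x)) (volume.restrict Ω) :=
    measurable_posAngle.comp_aemeasurable hwW.1.1.aemeasurable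
  -- Each of the `k` arcs produces a competitor supporting the same lower bound, and the arcs are
  -- disjoint, so the competing energies sum to a single integral over `Ω`.
  have key : ∀ k : ℕ, k ≠ 0 → (k : ℝ) * distToClass Ω u v₀ ≤ 2 * B + k * A := by
    intro k hk
    set f : EuclideanSpace ℝ (Fin N) → ℝ := fun x =>
      2 * ‖WithLp.toLp 2 fun i => U i x‖ + k * ‖WithLp.toLp 2 fun i => W i x‖ with hf
    have hfi : IntegrableOn f Ω := (hUi.const_mul 2).add (hWi.const_mul k)
    set f' : ℕ → EuclideanSpace ℝ (Fin N) → ℝ := fun j x =>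
      (if posAngle (w x) ∈ arc k j then (1 : ℝ) else 0) * f x with hf'
    have hf'i : ∀ j, IntegrableOn (f' j) Ω := by
      intro j
      refine hfi.bdd_mul (c := 1) ?_ (Eventually.of_forall fun x => ?_)
      · have : Measurable fun s : ℝ => if s ∈ arc k j then (1 : ℝ) else 0 :=
          Measurable.ite measurableSet_Ioc measurable_const measurable_const
        exact (this.comp_aemeasurable hang).aestronglyMeasurable
      · split_ifs <;> simp
    have hone : ∀ j < k, distToClass Ω u v₀ ≤ ∫ x in Ω, f' j x := by
      intro j hj
      set H : EuclideanSpace ℝ (Fin N) → ℝ := fun x =>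
        ∫ s in (0 : ℝ)..posAngle (w x), arcSlope k j s with hH
      have hmean : ∫ s in (0 : ℝ)..2 * Real.pi, arcSlope k j s = 0 := by
        have := integral_arcSlope k j Real.two_pi_pos.le
        rw [inter_eq_self_of_subset_right (arc_subset hj), volume_arc hk] at this
        linarith
      have hHp : ∀ i, HasWeakPartial Ω i H (fun x => arcSlope k j (posAngle (w x)) * W i x) :=
        fun i => (hW i).comp_primitive_posAngle hΩ hfin (measurable_arcSlope k j)
          (abs_arcSlope_le k j) (continuousWithinAt_arcSlope k j) hmean
      have hHi : IntegrableOn H Ω := by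
        have : IsFiniteMeasure (volume.restrict Ω) := isFiniteMeasure_restrict.2 hfin
        have hcont : Continuous fun a => ∫ s in (0 : ℝ)..a, arcSlope k j s :=
          intervalIntegral.continuous_primitive
            (intervalIntegrable_of_bounded (measurable_arcSlope k j) (abs_arcSlope_le k j)) 0
        refine Integrable.mono' (integrable_const ((k + 1) * (2 * Real.pi)))
          (hcont.measurable.comp_aemeasurable hang).aestronglyMeasurable
          (Eventually.of_forall fun x => ?_)
        have h1 := intervalIntegral.norm_integral_le_of_norm_le_const (a := 0)
          (b := posAngle (w x)) (f := arcSlope k j) (C := k + 1) fun s _ => abs_arcSlope_le k j s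
        refine h1.trans (mul_le_mul_of_nonneg_left ?_ (by positivity))
        rw [sub_zero, abs_of_pos (posAngle_mem _).1]
        exact (posAngle_mem _).2
      have hHW : MemW11 Ω H := memW11_of_hasWeakPartial hHi hHp
      -- `w e^{iH}` is the image of `w` under the collapsing map. Since `H` is in `W^{1,1}`,
      -- dividing `u` by it has the same effect on classes as dividing by `u₀ v₀⁻¹`.
      set v : EuclideanSpace ℝ (Fin N) → Circle := fun x =>
        u x * (w x * Circle.exp (H x))⁻¹ with hv
      have hvW : v ∈ W11Circle Ω := mul_mem_W11Circle hΩ hfin huW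
        (inv_mem_W11Circle hΩ hfin (mul_mem_W11Circle hΩ hfin hwW
          (exp_mem_W11Circle hΩ hfin hHW)))
      have hvph : ∀ i, HasPhase Ω i v (fun x => U i x +
          -(W i x + arcSlope k j (posAngle (w x)) * W i x)) := fun i =>
        (hU i).mul hΩ hfin ((hW i).mul hΩ hfin (HasPhase.exp hΩ hfin (hHp i))).inv
      have hveq : v ∈ eqClass Ω v₀ := by
        refine ⟨hvW, fun x => φu x + φ x + -H x, (hφu.add hφ).add hHW.neg, ?_⟩
        filter_upwards [huu₀] with x hx
        simp only [hv, hw, hx, Circle.exp_add, Circle.exp_neg, mul_inv, inv_inv]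
        calc _ = (u₀ x * (u₀ x)⁻¹) * (Circle.exp (φu x) * Circle.exp (φ x) *
              (Circle.exp (H x))⁻¹ * v₀ x) := by
              simp only [mul_comm, mul_left_comm, mul_assoc]
          _ = _ := by rw [mul_inv_cancel, one_mul]
      refine (distToClass_le hveq u).trans ?_
      rw [gradL1_eq hΩ (integrableOn_circle_sub huW hvW)
        fun i => (hU i).weakPartial.sub (hvph i).weakPartial]
      refine integral_mono_of_nonneg (Eventually.of_forall fun _ => norm_nonneg _) (hf'i j)
        (Eventually.of_forall fun x => ?_)
      by_cases hx : posAngle (w x) ∈ arc k j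
      · simp only [hf', if_pos hx, one_mul, hf]
        refine norm_toLp_le_add zero_le_two (Nat.cast_nonneg k) fun i => ?_
        -- On the arc the slope plus one is `k`, so the phase of `v` is `U - k W`. The coefficient
        -- of `U` is `u - v`, of modulus at most `2`.
        have h1 : Complex.I * (u x : ℂ) * (U i x : ℂ) - Complex.I * (v x : ℂ) *
            ((U i x + -(W i x + arcSlope k j (posAngle (w x)) * W i x) : ℝ) : ℂ) =
            Complex.I * ((u x : ℂ) - (v x : ℂ)) * (U i x : ℂ) +
              Complex.I * (v x : ℂ) * ((k * W i x : ℝ) : ℂ) := by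
          simp only [arcSlope, if_pos hx]
          push_cast
          ring
        rw [h1]
        refine (norm_add_le _ _).trans (add_le_add ?_ ?_)
        · rw [norm_mul, norm_mul, Complex.norm_I, one_mul, Complex.norm_real, Real.norm_eq_abs]
          refine mul_le_mul_of_nonneg_right ?_ (abs_nonneg _)
          refine (norm_sub_le _ _).trans ?_
          rw [Circle.norm_coe, Circle.norm_coe]
          norm_num
        · rw [norm_phase, abs_mul, Nat.abs_cast]
      -- Off the arc `v = u`, and the slope `-1` cancels the phase of `w`, so the chosen
      -- representative of the gradient of `u - v` is zero there.
      · have hS : w x * Circle.exp (H x) = 1 := by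
          have := exp_integral_arcSlope hj (posAngle_mem (w x)) hx
          rwa [Circle.exp_add, exp_posAngle] at this
        have hvx : v x = u x := by
          simp only [hv, hS, inv_one, mul_one]
        simp only [hf', if_neg hx, zero_mul, hvx, arcSlope]
        refine le_of_eq ?_
        rw [norm_eq_zero]
        ext i
        simp
    calc (k : ℝ) * distToClass Ω u v₀
        = ∑ j ∈ Finset.range k, distToClass Ω u v₀ := by simp
      _ ≤ ∑ j ∈ Finset.range k, ∫ x in Ω, f' j x :=
          Finset.sum_le_sum fun j hj => hone j (Finset.mem_range.1 hj)
      _ = ∫ x in Ω, ∑ j ∈ Finset.range k, f' j x :=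
          (integral_finsetSum _ fun j _ => hf'i j).symm
      _ ≤ ∫ x in Ω, f x := by
          refine integral_mono (integrable_finsetSum _ fun j _ => hf'i j) hfi fun x => ?_
          simp only [hf', ← Finset.sum_mul]
          exact mul_le_of_le_one_left (by positivity) (sum_arc_le_one k _)
      _ = 2 * B + k * A := by
          simp only [hf]
          rw [integral_add (hUi.const_mul 2) (hWi.const_mul k), integral_const_mul,
            integral_const_mul]
  -- Dividing by `k` and letting `k → ∞` removes the contribution of `∇u`.
  have hlim : Tendsto (fun k : ℕ => 2 * B * (1 / ((k : ℝ) + 1)) + A) atTop (𝓝 A) := by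
    simpa using ((tendsto_one_div_add_atTop_nhds_zero_nat (𝕜 := ℝ)).const_mul (2 * B)).add_const A
  refine ge_of_tendsto' hlim fun k => ?_
  have h1 := key (k + 1) (Nat.succ_ne_zero k)
  push_cast at h1
  have hk : (0 : ℝ) < (k : ℝ) + 1 := by positivity
  have h2 : 2 * B * (1 / ((k : ℝ) + 1)) + A = (2 * B + (k + 1) * A) / (k + 1) := by
    field_simp
  rw [h2, le_div_iff₀ hk]
  linarith

end UpperBound

/-! ### The zigzag map as a small perturbation of the identity -/

section Zigzag

variable {n : ℕ}

lemma measurable_tauSlope (n : ℕ) : Measurable (tauSlope n) := by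
  refine Measurable.ite ?_ measurable_const measurable_const
  have : {θ : ℝ | ∃ j : ℕ, j < n ^ 2 ∧ θ ∈ Ioc (2 * j * Real.pi / (n : ℝ) ^ 2)
      ((2 * j + 1) * Real.pi / (n : ℝ) ^ 2)} = ⋃ j : ℕ, ⋃ _ : j < n ^ 2,
        Ioc (2 * j * Real.pi / (n : ℝ) ^ 2) ((2 * j + 1) * Real.pi / (n : ℝ) ^ 2) := by
    ext θ
    simp only [mem_ofPred_eq, mem_iUnion, exists_prop]
  rw [this]
  exact MeasurableSet.iUnion fun j => MeasurableSet.iUnion fun _ => measurableSet_Ioc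

lemma tauSlope_eq_or (n : ℕ) (s : ℝ) : tauSlope n s = n ∨ tauSlope n s = -((n : ℝ) - 2) := by
  unfold tauSlope
  split_ifs <;> simp

lemma abs_tauSlope_sub_one (hn : 3 ≤ n) (s : ℝ) : |tauSlope n s - 1| = n - 1 := by
  have hn' : (3 : ℝ) ≤ n := by exact_mod_cast hn
  rcases tauSlope_eq_or n s with h | h <;> rw [h]
  · exact abs_of_nonneg (by linarith)
  · rw [abs_of_nonpos (by linarith)]
    ring

lemma abs_tauSlope_ge (n : ℕ) (s : ℝ) : (n : ℝ) - 2 ≤ |tauSlope n s| := by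
  rcases tauSlope_eq_or n s with h | h <;> rw [h]
  · rw [Nat.abs_cast]
    linarith
  · rw [abs_neg]
    exact le_abs_self _

lemma continuousWithinAt_tauSlope (n : ℕ) (s : ℝ) :
    ContinuousWithinAt (tauSlope n) (Iic s) s := by
  have h : ∀ᶠ y in 𝓝[≤] s, ∀ j ∈ Finset.range (n ^ 2),
      (y ∈ Ioc (2 * j * Real.pi / (n : ℝ) ^ 2) ((2 * j + 1) * Real.pi / (n : ℝ) ^ 2) ↔
        s ∈ Ioc (2 * j * Real.pi / (n : ℝ) ^ 2) ((2 * j + 1) * Real.pi / (n : ℝ) ^ 2)) :=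
    (eventually_all_finset _).2 fun j _ => eventually_mem_Ioc_iff _ _ s
  refine (continuousWithinAt_const (b := tauSlope n s)).congr_of_eventuallyEq ?_ rfl
  filter_upwards [h] with y hy
  have : (∃ j : ℕ, j < n ^ 2 ∧
      y ∈ Ioc (2 * j * Real.pi / (n : ℝ) ^ 2) ((2 * j + 1) * Real.pi / (n : ℝ) ^ 2)) ↔
      ∃ j : ℕ, j < n ^ 2 ∧
      s ∈ Ioc (2 * j * Real.pi / (n : ℝ) ^ 2) ((2 * j + 1) * Real.pi / (n : ℝ) ^ 2) :=
    exists_congr fun j => and_congr_right fun hj => hy j (Finset.mem_range.2 hj)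
  unfold tauSlope
  split_ifs with h1 h2 h2
  · rfl
  · exact absurd (this.1 h1) h2
  · exact absurd (this.2 h2) h1
  · rfl

lemma abs_tauSlope_sub_one_le (hn : 3 ≤ n) (s : ℝ) : |tauSlope n s - 1| ≤ n - 1 :=
  (abs_tauSlope_sub_one hn s).le

lemma intervalIntegrable_tauSlope_sub_one (hn : 3 ≤ n) (a b : ℝ) :
    IntervalIntegrable (fun s => tauSlope n s - 1) volume a b :=
  intervalIntegrable_of_bounded ((measurable_tauSlope n).sub_const 1)
    (abs_tauSlope_sub_one_le hn) a b

/-- The deviation `τₙ(θ) - θ` of the zigzag from the identity. -/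
noncomputable def tauDev (n : ℕ) (θ : ℝ) : ℝ := ∫ s in (0 : ℝ)..θ, (tauSlope n s - 1)

lemma tau_eq_add_tauDev (hn : 3 ≤ n) (θ : ℝ) : tau n θ = θ + tauDev n θ := by
  have h := intervalIntegral.integral_add (intervalIntegrable_tauSlope_sub_one hn 0 θ)
    (intervalIntegrable_const (c := (1 : ℝ)) (μ := volume) (a := 0) (b := θ))
  simp only [sub_add_cancel, intervalIntegral.integral_const, sub_zero, smul_eq_mul,
    mul_one] at h
  rw [tau, tauDev, h, add_comm]

/-- A cell consists of two intervals of equal length on which the slope minus one is `n - 1` and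
`-(n - 1)`. -/
lemma integral_tauSlope_cell (hn : 3 ≤ n) {j : ℕ} (hj : j < n ^ 2) :
    ∫ s in (2 * j * Real.pi / (n : ℝ) ^ 2)..(2 * (j + 1) * Real.pi / (n : ℝ) ^ 2),
      (tauSlope n s - 1) = 0 := by
  have hn' : (0 : ℝ) < (n : ℝ) ^ 2 := by positivity
  set a := Real.pi / (n : ℝ) ^ 2 with ha
  have ha0 : 0 < a := by positivity
  have e1 : 2 * (j : ℝ) * Real.pi / (n : ℝ) ^ 2 = 2 * j * a := by rw [ha]; ring
  have e2 : 2 * ((j : ℝ) + 1) * Real.pi / (n : ℝ) ^ 2 = (2 * j + 2) * a := by rw [ha]; ring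
  have e3 : ∀ l : ℕ, (2 * (l : ℝ) + 1) * Real.pi / (n : ℝ) ^ 2 = (2 * l + 1) * a := fun l => by
    rw [ha]; ring
  have e4 : ∀ l : ℕ, 2 * (l : ℝ) * Real.pi / (n : ℝ) ^ 2 = 2 * l * a := fun l => by
    rw [ha]; ring
  rw [e1, e2, ← intervalIntegral.integral_add_adjacent_intervals
    (intervalIntegrable_tauSlope_sub_one hn _ ((2 * j + 1) * a))
    (intervalIntegrable_tauSlope_sub_one hn _ _)]
  have i1 : ∫ s in (2 * j * a)..((2 * j + 1) * a), (tauSlope n s - 1) = a * (n - 1) := by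
    have hle : 2 * j * a ≤ (2 * j + 1) * a := by nlinarith
    rw [intervalIntegral.integral_of_le hle]
    rw [setIntegral_congr_fun (g := fun _ => (n : ℝ) - 1) measurableSet_Ioc fun s hs => ?_]
    · rw [setIntegral_const, Real.volume_real_Ioc_of_le hle, smul_eq_mul]
      ring
    · have : tauSlope n s = n := by
        unfold tauSlope
        rw [if_pos ⟨j, hj, by rw [e4, e3]; exact hs⟩]
      simp only [this]
  have i2 : ∫ s in ((2 * j + 1) * a)..((2 * j + 2) * a), (tauSlope n s - 1) = -(a * (n - 1)) := by
    have hle : (2 * j + 1) * a ≤ (2 * j + 2) * a := by nlinarith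
    rw [intervalIntegral.integral_of_le hle]
    rw [setIntegral_congr_fun (g := fun _ => -((n : ℝ) - 1)) measurableSet_Ioc fun s hs => ?_]
    · rw [setIntegral_const, Real.volume_real_Ioc_of_le hle, smul_eq_mul]
      ring
    · have : tauSlope n s = -((n : ℝ) - 2) := by
        unfold tauSlope
        rw [if_neg]
        rintro ⟨l, -, hl⟩
        rw [e4, e3] at hl
        have h1 : 2 * (l : ℝ) < 2 * j + 2 := lt_of_mul_lt_mul_right (hl.1.trans_le hs.2) ha0.le
        have h2 : 2 * (j : ℝ) + 1 < 2 * l + 1 := lt_of_mul_lt_mul_right (hs.1.trans_le hl.2) ha0.le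
        have h1' : 2 * l < 2 * j + 2 := by exact_mod_cast h1
        have h2' : 2 * j + 1 < 2 * l + 1 := by exact_mod_cast h2
        omega
      simp only [this]
      ring
  rw [i1, i2, add_neg_cancel]

lemma tauDev_node (hn : 3 ≤ n) {j : ℕ} (hj : j ≤ n ^ 2) :
    tauDev n (2 * j * Real.pi / (n : ℝ) ^ 2) = 0 := by
  induction j with
  | zero => simp [tauDev]
  | succ j ih =>
    have h := intervalIntegral.integral_add_adjacent_intervals
      (intervalIntegrable_tauSlope_sub_one hn 0 (2 * j * Real.pi / (n : ℝ) ^ 2))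
      (intervalIntegrable_tauSlope_sub_one hn _ (2 * (j + 1) * Real.pi / (n : ℝ) ^ 2))
    have h0 := ih (Nat.le_of_succ_le hj)
    rw [tauDev] at h0
    rw [h0, integral_tauSlope_cell hn hj, add_zero] at h
    push_cast
    exact h.symm

lemma tauDev_two_pi (hn : 3 ≤ n) : tauDev n (2 * Real.pi) = 0 := by
  have hn' : (n : ℝ) ≠ 0 := by positivity
  have h := tauDev_node hn (j := n ^ 2) le_rfl
  have e : 2 * ((n ^ 2 : ℕ) : ℝ) * Real.pi / (n : ℝ) ^ 2 = 2 * Real.pi := by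
    push_cast
    field_simp
  rwa [e] at h

/-- The deviation vanishes at a node at distance at most `2π/n²` below `θ`, and its slope is at most
`n - 1` in modulus. -/
lemma abs_tauDev_le (hn : 3 ≤ n) {θ : ℝ} (hθ : θ ∈ Ioc 0 (2 * Real.pi)) :
    |tauDev n θ| ≤ 2 * Real.pi / n := by
  have hn3 : (3 : ℝ) ≤ n := by exact_mod_cast hn
  have hn' : (0 : ℝ) < (n : ℝ) ^ 2 := by positivity
  set b := 2 * Real.pi / (n : ℝ) ^ 2 with hb
  have hb0 : 0 < b := by positivity
  set j := ⌊θ / b⌋₊ with hj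
  have h1 : (j : ℝ) ≤ θ / b := Nat.floor_le (div_nonneg hθ.1.le hb0.le)
  have h2 : θ / b < j + 1 := Nat.lt_floor_add_one _
  rw [le_div_iff₀ hb0] at h1
  rw [div_lt_iff₀ hb0] at h2
  have hjn : j ≤ n ^ 2 := by
    have : (j : ℝ) ≤ (n : ℝ) ^ 2 := by
      refine le_of_mul_le_mul_right (h1.trans (hθ.2.trans ?_)) hb0
      rw [hb, mul_div_cancel₀ _ hn'.ne']
    exact_mod_cast this
  have h0 := tauDev_node hn hjn
  have e : 2 * (j : ℝ) * Real.pi / (n : ℝ) ^ 2 = j * b := by rw [hb]; ring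
  rw [e] at h0
  have h := intervalIntegral.integral_add_adjacent_intervals
    (intervalIntegrable_tauSlope_sub_one hn 0 (j * b))
    (intervalIntegrable_tauSlope_sub_one hn _ θ)
  rw [← tauDev, ← tauDev, h0, zero_add] at h
  rw [← h]
  have h3 := intervalIntegral.norm_integral_le_of_norm_le_const (a := j * b) (b := θ)
    (f := fun s => tauSlope n s - 1) (C := n - 1) fun s _ => abs_tauSlope_sub_one_le hn s
  refine h3.trans ?_
  rw [abs_of_nonneg (by linarith)]
  have h4 : θ - j * b ≤ b := by linarith
  calc ((n : ℝ) - 1) * (θ - j * b) ≤ n * b :=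
        mul_le_mul (by linarith) h4 (by linarith) (by linarith)
    _ = 2 * Real.pi / n := by rw [hb]; field_simp

lemma continuous_tauDev (hn : 3 ≤ n) : Continuous (tauDev n) :=
  intervalIntegral.continuous_primitive (intervalIntegrable_tauSlope_sub_one hn) 0

/-- Representatives in `[0, 2π)` and `(0, 2π]` differ only at `z = 1`, where the deviation vanishes
at both `0` and `2π`. The second choice makes the left-continuous chain rule applicable. -/
lemma zigzag_eq (hn : 3 ≤ n) (z : Circle) :
    zigzag n z = z * Circle.exp (tauDev n (posAngle z)) := by
  have h : Circle.exp (tau n (toIcoMod Real.two_pi_pos 0 (Complex.arg (z : ℂ)))) =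
      Circle.exp (tau n (posAngle z)) := by
    set φ := Complex.arg (z : ℂ) with hφ
    have hm := toIcoMod_mem_Ico Real.two_pi_pos 0 φ
    rw [zero_add] at hm
    have hd := toIcoMod_add_toIcoDiv_zsmul Real.two_pi_pos 0 φ
    rcases hm.1.eq_or_lt with h0 | h0
    · have : posAngle z = 2 * Real.pi := by
        rw [posAngle, ← hφ, toIocMod_eq_iff]
        refine ⟨⟨Real.two_pi_pos, by rw [zero_add]⟩, toIcoDiv Real.two_pi_pos 0 φ - 1, ?_⟩
        rw [← h0, zero_add] at hd
        rw [sub_smul, hd, one_smul]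
        ring
      rw [this, ← h0, tau_eq_add_tauDev hn (2 * Real.pi), tauDev_two_pi hn, add_zero]
      simp [tau]
    · have : posAngle z = toIcoMod Real.two_pi_pos 0 φ := by
        rw [posAngle, ← hφ, toIocMod_eq_iff]
        exact ⟨⟨h0, by rw [zero_add]; exact hm.2.le⟩, toIcoDiv Real.two_pi_pos 0 φ, hd.symm⟩
      rw [this]
  rw [zigzag, h, tau_eq_add_tauDev hn, Circle.exp_add, exp_posAngle]

variable {N : ℕ} {Ω : Set (EuclideanSpace ℝ (Fin N))} {i : Fin N}
  {u : EuclideanSpace ℝ (Fin N) → Circle}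

lemma hasWeakPartial_tauDev (hn : 3 ≤ n) (hΩ : IsOpen Ω) (hfin : volume Ω ≠ ⊤)
    {X : EuclideanSpace ℝ (Fin N) → ℝ} (hu : HasPhase Ω i u X) :
    HasWeakPartial Ω i (fun x => tauDev n (posAngle (u x)))
      (fun x => (tauSlope n (posAngle (u x)) - 1) * X x) :=
  hu.comp_primitive_posAngle hΩ hfin ((measurable_tauSlope n).sub_const 1)
    (abs_tauSlope_sub_one_le hn)
    (fun s => (continuousWithinAt_tauSlope n s).sub continuousWithinAt_const)
    (tauDev_two_pi hn)

lemma memW11_tauDev (hn : 3 ≤ n) (hΩ : IsOpen Ω) (hfin : volume Ω ≠ ⊤) (hu : u ∈ W11Circle Ω) :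
    MemW11 Ω (fun x => tauDev n (posAngle (u x))) := by
  obtain ⟨X, hX⟩ := exists_hasPhase hΩ hfin hu
  have : IsFiniteMeasure (volume.restrict Ω) := isFiniteMeasure_restrict.2 hfin
  refine memW11_of_hasWeakPartial ?_ fun i => hasWeakPartial_tauDev hn hΩ hfin (hX i)
  have hang : AEMeasurable (fun x => posAngle (u x)) (volume.restrict Ω) :=
    measurable_posAngle.comp_aemeasurable hu.1.1.aemeasurable
  exact Integrable.mono' (integrable_const (2 * Real.pi / n))
    ((continuous_tauDev hn).measurable.comp_aemeasurable hang).aestronglyMeasurable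
    (Eventually.of_forall fun x => abs_tauDev_le hn (posAngle_mem _))

lemma zigzag_comp_mem_eqClass (hn : 3 ≤ n) (hΩ : IsOpen Ω) (hfin : volume Ω ≠ ⊤)
    (hu : u ∈ W11Circle Ω) : zigzag n ∘ u ∈ eqClass Ω u := by
  have hD := memW11_tauDev hn hΩ hfin hu
  have he : zigzag n ∘ u = fun x => u x * Circle.exp (tauDev n (posAngle (u x))) :=
    funext fun x => zigzag_eq hn (u x)
  refine ⟨?_, _, hD, Eventually.of_forall fun x => ?_⟩
  · rw [he]
    exact mul_mem_W11Circle hΩ hfin hu (exp_mem_W11Circle hΩ hfin hD)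
  · rw [he]
    exact mul_comm _ _

/-- The phase gradient is multiplied by a slope of modulus at least `n - 2`, although the map moves
by an angle of at most `2π/n`. This contrast drives the lower bound. -/
lemma hasPhase_zigzag_comp (hn : 3 ≤ n) (hΩ : IsOpen Ω) (hfin : volume Ω ≠ ⊤)
    {X : EuclideanSpace ℝ (Fin N) → ℝ} (hu : HasPhase Ω i u X) :
    HasPhase Ω i (zigzag n ∘ u) (fun x => tauSlope n (posAngle (u x)) * X x) := by
  have he : zigzag n ∘ u = fun x => u x * Circle.exp (tauDev n (posAngle (u x))) :=
    funext fun x => zigzag_eq hn (u x)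
  rw [he]
  exact (hu.mul hΩ hfin (HasPhase.exp hΩ hfin (hasWeakPartial_tauDev hn hΩ hfin hu))).congr_phase
    fun x => by ring

end Zigzag

/-! ### A kernel on the circle vanishing near the real points -/

section Kernel

/-- There are `C¹` kernels on the circle of mean one, nearly bounded by one, which vanish near
the two points of the real axis. -/
lemma exists_kernel {ε : ℝ} (hε : 0 < ε) :
    ∃ (κ κ' : ℝ → ℝ) (d M : ℝ), 0 < d ∧ 0 ≤ M ∧ Continuous κ' ∧ (∀ t, HasDerivAt κ (κ' t) t) ∧
      Function.Periodic κ (2 * Real.pi) ∧ (∀ t, 0 ≤ κ t ∧ κ t ≤ 1 + ε) ∧ (∀ t, |κ' t| ≤ M) ∧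
      (∀ t, |Real.sin t| ≤ d → κ t = 0 ∧ κ' t = 0) ∧
      ∫ t in (0 : ℝ)..2 * Real.pi, κ t = 2 * Real.pi := by
  -- Smooth cutoffs in `sin² t` that tend to `1` off the countable zero set of `sin`. Their
  -- integrals tend to `2π`, so for large `k` normalizing the mean costs a factor of at most `1 +
  -- ε`.
  set f : ℕ → ℝ → ℝ := fun k t => Real.smoothTransition ((k + 1) * Real.sin t ^ 2 - 1) with hf
  have hfs : ∀ k, ContDiff ℝ 1 (f k) := fun k =>
    Real.smoothTransition.contDiff.comp
      ((contDiff_const.mul (Real.contDiff_sin.pow 2)).sub contDiff_const)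
  have hlim : Tendsto (fun k => ∫ t in (0 : ℝ)..2 * Real.pi, f k t) atTop
      (𝓝 (∫ t in (0 : ℝ)..2 * Real.pi, (1 : ℝ))) := by
    refine intervalIntegral.tendsto_integral_filter_of_dominated_convergence (fun _ => (1 : ℝ))
      (Eventually.of_forall fun k => (hfs k).continuous.aestronglyMeasurable)
      (Eventually.of_forall fun k => Eventually.of_forall fun t _ => ?_)
      intervalIntegrable_const ?_
    · rw [Real.norm_of_nonneg (Real.smoothTransition.nonneg _)]
      exact Real.smoothTransition.le_one _
    · have hc : {t : ℝ | Real.sin t = 0}.Countable := by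
        refine (countable_range fun m : ℤ => (m : ℝ) * Real.pi).mono fun t ht => ?_
        exact Real.sin_eq_zero_iff.1 ht
      filter_upwards [hc.ae_notMem volume] with t ht _
      have hpos : 0 < Real.sin t ^ 2 := by
        have : Real.sin t ≠ 0 := ht
        positivity
      refine tendsto_const_nhds.congr' ?_
      filter_upwards [eventually_ge_atTop ⌈2 / Real.sin t ^ 2⌉₊] with k hk
      have h1 : 2 / Real.sin t ^ 2 ≤ k := (Nat.le_ceil _).trans (by exact_mod_cast hk)
      rw [div_le_iff₀ hpos] at h1
      exact (Real.smoothTransition.one_of_one_le (by linarith)).symm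
  have hlt : 2 * Real.pi / (1 + ε) < ∫ t in (0 : ℝ)..2 * Real.pi, (1 : ℝ) := by
    rw [intervalIntegral.integral_const, sub_zero, smul_eq_mul, mul_one,
      div_lt_iff₀ (by positivity)]
    nlinarith [Real.two_pi_pos]
  obtain ⟨k, hk⟩ := (hlim.eventually_const_lt hlt).exists
  set J := ∫ t in (0 : ℝ)..2 * Real.pi, f k t with hJ
  have hJ0 : 0 < J := lt_trans (by positivity) hk
  set c := 2 * Real.pi / J with hc
  have hc0 : 0 < c := by positivity
  have hcε : c ≤ 1 + ε := by
    rw [hc, div_le_iff₀ hJ0]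
    rw [div_lt_iff₀ (by positivity)] at hk
    linarith
  have hper : Function.Periodic (f k) (2 * Real.pi) := fun t => by
    simp only [hf, Real.sin_add_two_pi]
  have hd : ∀ t, HasDerivAt (f k) (deriv (f k) t) t := fun t =>
    ((hfs k).differentiable one_ne_zero t).hasDerivAt
  have hcont : Continuous (deriv (f k)) := (hfs k).continuous_deriv le_rfl
  have hper' : Function.Periodic (deriv (f k)) (2 * Real.pi) := fun t => by
    rw [← deriv_comp_add_const]
    exact congrArg (fun g => deriv g t) (funext hper)
  obtain ⟨M, hM⟩ : ∃ M, ∀ t, ‖deriv (f k) t‖ ≤ M := by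
    obtain ⟨M, hM⟩ := isCompact_Icc (a := (0 : ℝ)) (b := 0 + 2 * Real.pi)
      |>.exists_bound_of_continuousOn hcont.continuousOn
    refine ⟨M, fun t => ?_⟩
    obtain ⟨y, hy, hty⟩ := hper'.exists_mem_Ico Real.two_pi_pos t 0
    rw [hty]
    exact hM y (Ico_subset_Icc_self hy)
  -- The width `√(1/(k+1))` is the range of `|sin t|` on which the argument of the cutoff is
  -- nonpositive.
  refine ⟨fun t => c * f k t, fun t => c * deriv (f k) t, Real.sqrt (1 / (k + 1)), c * M,
    by positivity, mul_nonneg hc0.le ((norm_nonneg _).trans (hM 0)), continuous_const.mul hcont,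
    fun t => (hd t).const_mul c, fun t => ?_, fun t => ⟨?_, ?_⟩, fun t => ?_, fun t ht => ?_, ?_⟩
  · simp only [hper t]
  · exact mul_nonneg hc0.le (Real.smoothTransition.nonneg _)
  · exact (mul_le_of_le_one_right hc0.le (Real.smoothTransition.le_one _)).trans hcε
  · rw [abs_mul, abs_of_pos hc0]
    exact mul_le_mul_of_nonneg_left (hM t) hc0.le
  · have h0 : f k t = 0 := by
      refine Real.smoothTransition.zero_of_nonpos ?_
      have h1 := pow_le_pow_left₀ (abs_nonneg _) ht 2
      rw [sq_abs, Real.sq_sqrt (by positivity), le_div_iff₀ (by positivity)] at h1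
      linarith
    -- Where the nonnegative cutoff vanishes it has a minimum, so its derivative vanishes too,
    -- including at the endpoints of the range.
    have h1 : IsLocalMin (f k) t := Eventually.of_forall fun y => by
      rw [h0]
      exact Real.smoothTransition.nonneg _
    simp only [h0, h1.deriv_eq_zero, mul_zero, and_self]
  · rw [intervalIntegral.integral_const_mul, ← hJ, hc, div_mul_cancel₀ _ hJ0.ne']

end Kernel

/-! ### Pointwise comparison of the two gradients -/

section Pointwise

/-- A linear form in `(Y, A)` against the quadratic form `|A e^{iα} - Y|²`. -/
lemma sq_linear_le {q p c σ L A Y : ℝ} (hcσ : c ^ 2 + σ ^ 2 = 1)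
    (h : q ^ 2 * σ ^ 2 + (p + q * c) ^ 2 ≤ L ^ 2 * σ ^ 2) (hσ : σ ≠ 0) :
    (q * Y + p * A) ^ 2 ≤ L ^ 2 * (A ^ 2 + Y ^ 2 - 2 * A * Y * c) := by
  have hσ2 : 0 < σ ^ 2 := by positivity
  have e : A ^ 2 + Y ^ 2 - 2 * A * Y * c = (Y - c * A) ^ 2 + σ ^ 2 * A ^ 2 := by
    have : σ ^ 2 = 1 - c ^ 2 := by linarith
    rw [this]; ring
  rw [e]
  refine le_of_mul_le_mul_left ?_ hσ2
  have hB : 0 ≤ (Y - c * A) ^ 2 + σ ^ 2 * A ^ 2 := by positivity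
  have h1 := mul_le_mul_of_nonneg_right h hB
  -- Cauchy–Schwarz: `qY + pA = q (Y - cA) + (p + qc) A` against `(Y - cA)² + (σA)²`. The hinted
  -- square is the defect after multiplication by `σ²`.
  nlinarith [sq_nonneg (q * σ ^ 2 * A - (p + q * c) * (Y - c * A))]

/-- Quantitative smallness making `sq_linear_le` applicable. -/
lemma exists_threshold {κ κ' : ℝ → ℝ} {d M ε : ℝ} (hd : 0 < d) (hM : 0 ≤ M) (hε : 0 < ε)
    (hε1 : ε ≤ 1) (hκ : ∀ t, 0 ≤ κ t ∧ κ t ≤ 1 + ε / 2) (hκ' : ∀ t, |κ' t| ≤ M)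
    (h0 : ∀ t, |Real.sin t| ≤ d → κ t = 0 ∧ κ' t = 0) :
    ∃ η > 0, ∀ g m t A Y : ℝ, |g| ≤ η → |m| ≤ η →
      ((g * (κ' t * Real.cos t - κ t * Real.sin t) - κ t) * Y +
        (κ t * Real.cos t + m * (-(g * (κ' t * Real.cos t - κ t * Real.sin t) - κ t) -
          κ t * Real.cos t)) * A) ^ 2 ≤
      (1 + ε) ^ 2 * (A ^ 2 + Y ^ 2 - 2 * A * Y * Real.cos (g - t)) := by
  set D : ℝ := 2 * M + 10 with hD
  have hD0 : 0 < D := by positivity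
  -- The bound `d / 2` keeps `|sin (g - t)|` above `d / 2`; `ε d / (8 D)` makes `p + q cos (g - t)`
  -- at most `ε d / 4`; `ε / (4 D)` keeps `|q|` below `1 + 3ε/4`.
  refine ⟨min (min 1 (d / 2)) (min (ε * d / (8 * D)) (ε / (4 * D))), by positivity, ?_⟩
  intro g m t A Y hg hm
  rw [le_min_iff, le_min_iff, le_min_iff] at hg hm
  obtain ⟨⟨-, hg2⟩, hg3, hg4⟩ := hg
  obtain ⟨-, hm3, -⟩ := hm
  rw [le_div_iff₀ (by positivity)] at hg2 hg3 hg4 hm3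
  have hQ : 0 ≤ A ^ 2 + Y ^ 2 - 2 * A * Y * Real.cos (g - t) := by
    nlinarith [sq_nonneg (Y - Real.cos (g - t) * A), sq_nonneg (Real.sin (g - t) * A),
      Real.sin_sq_add_cos_sq (g - t)]
  -- Where `sin t` is small the kernel kills the left side. Elsewhere `sin (g - t)` is bounded
  -- below, and the perturbation can be absorbed.
  rcases le_or_gt |Real.sin t| d with ht | ht
  · obtain ⟨h1, h2⟩ := h0 t ht
    rw [h1, h2]
    simp only [zero_mul, sub_zero, mul_zero, neg_zero, add_zero]
    rw [zero_pow two_ne_zero]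
    positivity
  set P := κ t * Real.cos t with hP
  set P' := κ' t * Real.cos t - κ t * Real.sin t with hP'
  set q := g * P' - κ t with hq
  have hκa : |κ t| ≤ 1 + ε / 2 := by rw [abs_of_nonneg (hκ t).1]; exact (hκ t).2
  have hPb : |P| ≤ 2 := by
    rw [hP, abs_mul]
    nlinarith [Real.abs_cos_le_one t, abs_nonneg (κ t), abs_nonneg (Real.cos t)]
  have hPb' : |P'| ≤ M + 2 := by
    have h1 : |κ' t * Real.cos t| ≤ M := by
      rw [abs_mul]
      nlinarith [Real.abs_cos_le_one t, abs_nonneg (κ' t), abs_nonneg (Real.cos t), hκ' t]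
    have h2 : |κ t * Real.sin t| ≤ 2 := by
      rw [abs_mul]
      nlinarith [Real.abs_sin_le_one t, abs_nonneg (κ t), abs_nonneg (Real.sin t)]
    exact (abs_sub _ _).trans (add_le_add h1 h2)
  have hgP : |g * P'| ≤ |g| * (M + 2) := by
    rw [abs_mul]
    exact mul_le_mul_of_nonneg_left hPb' (abs_nonneg _)
  have hgD : |g| * (M + 2) ≤ ε / 4 := by
    nlinarith [abs_nonneg g]
  have hqb : |q| ≤ 1 + 3 * ε / 4 := by
    refine (abs_sub _ _).trans ?_
    linarith
  have hσ : d / 2 ≤ |Real.sin (g - t)| := by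
    have h1 := Real.abs_sin_sub_sin_le (g - t) (-t)
    rw [sub_neg_eq_add, sub_add_cancel, Real.sin_neg] at h1
    have h2 := abs_sub_abs_le_abs_sub (-Real.sin t) (Real.sin (g - t))
    rw [abs_neg, abs_sub_comm] at h2
    linarith
  have hsum : |(P + m * (-q - P)) + q * Real.cos (g - t)| ≤ ε * d / 4 := by
    -- The leading terms `κ cos t` and `-κ cos (g - t)` nearly cancel; every remaining term carries
    -- a factor `g` or `m`.
    have e : (P + m * (-q - P)) + q * Real.cos (g - t) =
        κ t * (Real.cos t - Real.cos (g - t)) + g * P' * Real.cos (g - t) + m * (-q - P) := by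
      rw [hq, hP]; ring
    have h1 : |κ t * (Real.cos t - Real.cos (g - t))| ≤ 2 * |g| := by
      have h := Real.abs_cos_sub_cos_le (-t) (g - t)
      rw [Real.cos_neg, show -t - (g - t) = -g by ring, abs_neg] at h
      rw [abs_mul]
      exact mul_le_mul (by linarith) h (abs_nonneg _) (by norm_num)
    have h2 : |g * P' * Real.cos (g - t)| ≤ |g| * (M + 2) := by
      rw [abs_mul]
      exact (mul_le_of_le_one_right (abs_nonneg _) (Real.abs_cos_le_one _)).trans hgP
    have h3 : |m * (-q - P)| ≤ |m| * 4 := by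
      rw [abs_mul]
      refine mul_le_mul_of_nonneg_left ((abs_sub _ _).trans ?_) (abs_nonneg _)
      rw [abs_neg]
      linarith
    rw [e]
    refine (abs_add_three _ _ _).trans ((add_le_add (add_le_add h1 h2) h3).trans ?_)
    nlinarith [abs_nonneg g, abs_nonneg m, mul_nonneg (abs_nonneg m) hM,
      mul_nonneg (abs_nonneg g) hM]
  refine sq_linear_le (σ := Real.sin (g - t)) (by rw [add_comm]; exact Real.sin_sq_add_cos_sq _)
    ?_ fun h => ?_
  · have h1 : ((P + m * (-q - P)) + q * Real.cos (g - t)) ^ 2 ≤ (ε * d / 4) ^ 2 := by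
      rw [← sq_abs]
      exact pow_le_pow_left₀ (abs_nonneg _) hsum 2
    have h2 : q ^ 2 ≤ (1 + 3 * ε / 4) ^ 2 := by
      rw [← sq_abs]
      exact pow_le_pow_left₀ (abs_nonneg _) hqb 2
    have h3 : (d / 2) ^ 2 ≤ Real.sin (g - t) ^ 2 := by
      rw [← sq_abs (Real.sin _)]
      exact pow_le_pow_left₀ (by positivity) hσ 2
    have h4 : ε ^ 2 / 4 ≤ (1 + ε) ^ 2 - (1 + 3 * ε / 4) ^ 2 := by nlinarith
    have h5 : (ε * d / 4) ^ 2 ≤ ε ^ 2 / 4 * Real.sin (g - t) ^ 2 := by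
      calc (ε * d / 4) ^ 2 = ε ^ 2 / 4 * (d / 2) ^ 2 := by ring
        _ ≤ _ := mul_le_mul_of_nonneg_left h3 (by positivity)
    have h6 := mul_le_mul_of_nonneg_right h4 (sq_nonneg (Real.sin (g - t)))
    have h7 := mul_le_mul_of_nonneg_right h2 (sq_nonneg (Real.sin (g - t)))
    linarith
  · rw [h, abs_zero] at hσ
    linarith

/-- The law of cosines for two vectors tangent to the circle at points separated by the angle `g -
t`. -/
lemma norm_sq_circle_exp_sub (g t A Y : ℝ) (u : Circle) :
    ‖Complex.I * ((u * Circle.exp g : Circle) : ℂ) * (A : ℂ) -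
      Complex.I * ((u * Circle.exp t : Circle) : ℂ) * (Y : ℂ)‖ ^ 2 =
      A ^ 2 + Y ^ 2 - 2 * A * Y * Real.cos (g - t) := by
  have e : Complex.I * ((u * Circle.exp g : Circle) : ℂ) * (A : ℂ) -
      Complex.I * ((u * Circle.exp t : Circle) : ℂ) * (Y : ℂ) =
      Complex.I * (u : ℂ) * (((Circle.exp g : Circle) : ℂ) * A - ((Circle.exp t : Circle) : ℂ) * Y) := by
    rw [Circle.coe_mul, Circle.coe_mul]
    ring
  rw [e, norm_mul, norm_mul, Complex.norm_I, Circle.norm_coe, one_mul, one_mul,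
    ← Complex.normSq_eq_norm_sq, Circle.coe_exp, Circle.coe_exp, Complex.normSq_apply]
  simp only [Complex.sub_re, Complex.sub_im, Complex.re_mul_ofReal, Complex.im_mul_ofReal,
    Complex.exp_ofReal_mul_I_re, Complex.exp_ofReal_mul_I_im, Real.cos_sub]
  linear_combination A ^ 2 * Real.sin_sq_add_cos_sq g + Y ^ 2 * Real.sin_sq_add_cos_sq t

end Pointwise

/-! ### Lower bound for the distance of `Tₙ ∘ u₀` to a class -/

section LowerBound

variable {N : ℕ} {Ω : Set (EuclideanSpace ℝ (Fin N))}

lemma abs_inv_tauSlope_le {n : ℕ} (hn : 3 ≤ n) (s : ℝ) : |(tauSlope n s)⁻¹| ≤ 1 / ((n : ℝ) - 2) := by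
  have hn' : (3 : ℝ) ≤ n := by exact_mod_cast hn
  rw [abs_inv, ← one_div]
  exact one_div_le_one_div_of_le (by linarith) (abs_tauSlope_ge n s)

/-- Composing with the zigzag makes the distance to any class nearly as large as `Σ`. -/
lemma eventually_Sigma_le (hN : 0 < N) (hΩ : IsOpen Ω) (hfin : volume Ω ≠ ⊤) {ε : ℝ} (hε : 0 < ε)
    (hε1 : ε ≤ 1) : ∀ᶠ n : ℕ in atTop, ∀ u₀ ∈ W11Circle Ω, ∀ v₀ ∈ W11Circle Ω,
      Sigma Ω (fun x => u₀ x * (v₀ x)⁻¹) ≤ (1 + ε) * distToClass Ω (zigzag n ∘ u₀) v₀ := by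
  obtain ⟨κ, κ', d, M, hd, hM, hκ'c, hder, hper, hκ, hκ'M, h0, hmean⟩ := exists_kernel (half_pos hε)
  obtain ⟨η, hη, key⟩ := exists_threshold hd hM hε hε1 hκ hκ'M h0
  have hlim1 : Tendsto (fun n : ℕ => 2 * Real.pi / (n : ℝ)) atTop (𝓝 0) :=
    tendsto_const_nhds.div_atTop tendsto_natCast_atTop_atTop
  have hlim2 : Tendsto (fun n : ℕ => 1 / ((n : ℝ) - 2)) atTop (𝓝 0) :=
    tendsto_const_nhds.div_atTop (tendsto_atTop_add_const_right _ (-2) tendsto_natCast_atTop_atTop)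
  -- The threshold `η` comes from the kernel and `ε` alone, so the admissible `n` are chosen before
  -- the pair `(u₀, v₀)`.
  filter_upwards [hlim1.eventually_lt_const hη, hlim2.eventually_lt_const hη,
    eventually_ge_atTop 3] with n hn1 hn2 hn u₀ hu₀ v₀ hv₀
  have hκc : Continuous κ := continuous_iff_continuousAt.2 fun t => (hder t).continuousAt
  set P : ℝ → ℝ := fun t => κ t * Real.cos t with hP
  set P' : ℝ → ℝ := fun t => κ' t * Real.cos t - κ t * Real.sin t with hP'
  have hPd : ∀ t, HasDerivAt P (P' t) t := fun t => by
    refine ((hder t).mul (Real.hasDerivAt_cos t)).congr_deriv ?_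
    simp only [hP']
    ring
  have hP'c : Continuous P' := by fun_prop
  have hPper : Function.Periodic P (2 * Real.pi) := fun t => by
    simp only [hP, hper t, Real.cos_add_two_pi]
  have hPb : ∀ t, |P t| ≤ 2 := fun t => by
    rw [hP, abs_mul, abs_of_nonneg (hκ t).1]
    nlinarith [Real.abs_cos_le_one t, hκ t, abs_nonneg (Real.cos t)]
  -- Mean one of `κ` makes `χ` periodic, so `χ (arg w)` is weakly differentiable although `arg w`
  -- need not be.
  set χ : ℝ → ℝ := fun t => t - ∫ s in (0 : ℝ)..t, κ s with hχ
  have hχd : ∀ t, HasDerivAt χ (1 - κ t) t := fun t =>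
    (hasDerivAt_id t).sub (intervalIntegral.integral_hasDerivAt_right (hκc.intervalIntegrable _ _)
      (hκc.stronglyMeasurableAtFilter _ _) hκc.continuousAt)
  have hχper : Function.Periodic χ (2 * Real.pi) := fun t => by
    simp only [hχ]
    rw [← intervalIntegral.integral_add_adjacent_intervals (hκc.intervalIntegrable 0 t)
      (hκc.intervalIntegrable t _), hper.intervalIntegral_add_eq t 0, zero_add, hmean]
    ring
  obtain ⟨X, hX⟩ := exists_hasPhase hΩ hfin hu₀
  have hε0 : 0 < 1 + ε := by linarith
  have hne : Nonempty (eqClass Ω v₀) := ⟨⟨v₀, mem_eqClass_self hfin hv₀⟩⟩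
  rw [← div_le_iff₀' hε0]
  refine le_ciInf fun ⟨v, hvW, φv, hφv, hvv⟩ => ?_
  rw [div_le_iff₀' hε0]
  simp only
  obtain ⟨Y, hY⟩ := exists_hasPhase hΩ hfin hvW
  set w : EuclideanSpace ℝ (Fin N) → Circle := fun x => v x * (u₀ x)⁻¹ with hw
  have hwp : ∀ i, HasPhase Ω i w (fun x => Y i x + -X i x) := fun i =>
    (hY i).mul hΩ hfin (hX i).inv
  set g : EuclideanSpace ℝ (Fin N) → ℝ := fun x => tauDev n (posAngle (u₀ x)) with hg
  set s : EuclideanSpace ℝ (Fin N) → ℝ := fun x => tauSlope n (posAngle (u₀ x)) with hs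
  set t : EuclideanSpace ℝ (Fin N) → ℝ := fun x => Complex.arg (w x) with ht
  have hgb : ∀ x, |g x| ≤ 2 * Real.pi / n := fun x => abs_tauDev_le hn (posAngle_mem _)
  have hgη : ∀ x, |g x| ≤ η := fun x => (hgb x).trans hn1.le
  -- The phase correction. The term `g P(t)` contributes `P(t) A` to leading order, because `g` is
  -- small but has the large slope `s - 1`; the term `χ(t)` turns the coefficient of `Y` from `-1`
  -- into `-κ(t)`.
  set ψ : EuclideanSpace ℝ (Fin N) → ℝ := fun x => g x * P (t x) + χ (t x) with hψ
  have hψp : ∀ i, HasWeakPartial Ω i ψ (fun x =>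
      (g x * (P' (t x) * (Y i x + -X i x)) + (s x - 1) * X i x * P (t x)) +
        (1 - κ (t x)) * (Y i x + -X i x)) := fun i => by
    refine HasWeakPartial.add ?_ ((hwp i).comp_periodic hΩ hfin hχd (by fun_prop) hχper)
    refine HasWeakPartial.mul hΩ hfin (hasWeakPartial_tauDev hn hΩ hfin (hX i))
      ((hwp i).comp_periodic hΩ hfin hPd hP'c hPper) (M := max η 2) (by positivity)
      (Eventually.of_forall fun x => ?_) (Eventually.of_forall fun x => ?_)
    · exact (hgη x).trans (le_max_left _ _)
    · exact (hPb _).trans (le_max_right _ _)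
  -- Integrability of `ψ` itself is read off from one of its partial derivatives, which requires a
  -- coordinate to exist.
  have hψW : MemW11 Ω ψ := memW11_of_hasWeakPartial (hψp ⟨0, hN⟩).integrableOn_fun hψp
  set z : EuclideanSpace ℝ (Fin N) → Circle := fun x =>
    u₀ x * (v₀ x)⁻¹ * Circle.exp (-(φv x + -ψ x)) with hz
  have hφW : MemW11 Ω (fun x => φv x + -ψ x) := hφv.add hψW.neg
  have hzW : z ∈ W11Circle Ω := mul_mem_W11Circle hΩ hfin
    (mul_mem_W11Circle hΩ hfin hu₀ (inv_mem_W11Circle hΩ hfin hv₀))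
    (exp_mem_W11Circle hΩ hfin hφW.neg)
  have hz' : (fun x => (w x)⁻¹ * Circle.exp (ψ x)) =ᵐ[volume.restrict Ω] z := by
    filter_upwards [hvv] with x hx
    simp only [hz, hw, hx, Circle.exp_add, Circle.exp_neg, mul_inv, inv_inv, neg_add_rev, neg_neg]
    simp only [mul_comm, mul_left_comm, mul_assoc]
  have hzp : ∀ i, HasPhase Ω i z (fun x => -(Y i x + -X i x) +
      ((g x * (P' (t x) * (Y i x + -X i x)) + (s x - 1) * X i x * P (t x)) +
        (1 - κ (t x)) * (Y i x + -X i x))) := fun i =>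
    ((hwp i).inv.mul hΩ hfin (HasPhase.exp hΩ hfin (hψp i))).congr_fun_ae hz'
  have hTW := (zigzag_comp_mem_eqClass hn hΩ hfin hu₀).1
  have hTp : ∀ i, HasPhase Ω i (zigzag n ∘ u₀) (fun x => s x * X i x) := fun i =>
    hasPhase_zigzag_comp hn hΩ hfin (hX i)
  refine (Sigma_le hφW).trans ?_
  change gradL1 Ω (fun x => (z x : ℂ)) ≤ _
  have hdp := fun i => (hTp i).weakPartial.sub (hY i).weakPartial
  rw [gradL1_circle hΩ hzW.1 hzp, gradL1_eq hΩ (integrableOn_circle_sub hTW hvW) hdp,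
    ← integral_const_mul]
  refine integral_mono (integrableOn_toLp fun i => (hzp i).integrableOn).norm
    ((integrableOn_toLp fun i => (hdp i).integrableOn_grad).norm.const_mul _) fun x => ?_
  simp only
  rw [← Real.norm_of_nonneg hε0.le, ← norm_smul, ← WithLp.toLp_smul]
  -- The comparison holds in each coordinate direction separately, hence for the Euclidean norms.
  refine norm_toLp_le_of_norm_le fun i => ?_
  rw [Pi.smul_apply, norm_smul, Real.norm_of_nonneg hε0.le, Real.norm_eq_abs]
  refine abs_le_of_sq_le_sq ?_ (by positivity)
  have hsm : |(s x)⁻¹| ≤ η := (abs_inv_tauSlope_le hn _).trans hn2.le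
  have hs0 : s x ≠ 0 := by
    have hn' : (3 : ℝ) ≤ n := by exact_mod_cast hn
    have h := abs_tauSlope_ge n (posAngle (u₀ x))
    intro h1
    rw [show tauSlope n (posAngle (u₀ x)) = 0 from h1, abs_zero] at h
    linarith
  have hT : (zigzag n ∘ u₀) x = u₀ x * Circle.exp (g x) := zigzag_eq hn _
  have hv : v x = u₀ x * Circle.exp (t x) := by
    rw [ht, Circle.exp_arg, hw, mul_comm, inv_mul_cancel_right]
  -- Here `A = s X` is the phase of `Tₙ ∘ u₀`, so the phase of `u₀` is `m A` with `m = s⁻¹`.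
  have h := key (g x) (s x)⁻¹ (t x) (s x * X i x) (Y i x) (hgη x) hsm
  rw [hT, hv, mul_pow, norm_sq_circle_exp_sub]
  refine le_trans (le_of_eq ?_) h
  simp only [hP, hP']
  field_simp
  ring

end LowerBound

end CircleSobolev

theorem proposition1p3 {N : ℕ} (hN : 2 ≤ N) (Ω : Set (EuclideanSpace ℝ (Fin N)))
    (hΩ : CircleSobolev.IsSmoothBoundedDomain Ω) :
    (∀ n : ℕ, 3 ≤ n → ∀ u₀ ∈ CircleSobolev.W11Circle Ω,
      CircleSobolev.zigzag n ∘ u₀ ∈ CircleSobolev.W11Circle Ω) ∧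
    TendstoUniformlyOn
      (fun (n : ℕ) (p : (EuclideanSpace ℝ (Fin N) → Circle) ×
          (EuclideanSpace ℝ (Fin N) → Circle)) =>
        CircleSobolev.distToClass Ω (CircleSobolev.zigzag n ∘ p.1) p.2 /
          CircleSobolev.Sigma Ω (fun x => p.1 x * (p.2 x)⁻¹))
      (fun _ => (1 : ℝ)) atTop
      {p | p.1 ∈ CircleSobolev.W11Circle Ω ∧ p.2 ∈ CircleSobolev.W11Circle Ω ∧
        ¬ CircleSobolev.Equivalent Ω p.1 p.2} ∧
    ∀ u₀ ∈ CircleSobolev.W11Circle Ω, ∀ v₀ ∈ CircleSobolev.W11Circle Ω,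
      ((CircleSobolev.Sigma Ω (fun x => u₀ x * (v₀ x)⁻¹) : ℝ) : EReal) ≤
        CircleSobolev.DistClasses Ω u₀ v₀ := by
  have hopen := hΩ.isOpen
  have hfin : volume Ω ≠ ⊤ := hΩ.isBounded.measure_lt_top.ne
  have hN0 : 0 < N := by omega
  refine ⟨fun n hn u₀ hu₀ => (CircleSobolev.zigzag_comp_mem_eqClass hn hopen hfin hu₀).1, ?_, ?_⟩
  · rw [Metric.tendstoUniformlyOn_iff]
    intro ε hε
    -- Half of `ε` yields the strict inequality: `S ≤ D + (ε/2) D ≤ D + (ε/2) S < D + ε S`.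
    have hδ : 0 < min 1 (ε / 2) := by positivity
    filter_upwards [CircleSobolev.eventually_Sigma_le hN0 hopen hfin hδ (min_le_left _ _),
      eventually_ge_atTop 3] with n hn hn3
    rintro ⟨u₀, v₀⟩ ⟨hu₀, hv₀, hne⟩
    simp only at hu₀ hv₀ hne ⊢
    set S := CircleSobolev.Sigma Ω (fun x => u₀ x * (v₀ x)⁻¹) with hS
    set D := CircleSobolev.distToClass Ω (CircleSobolev.zigzag n ∘ u₀) v₀ with hD
    have hS0 : 0 < S := lt_of_le_of_ne CircleSobolev.Sigma_nonneg fun h =>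
      hne (CircleSobolev.equivalent_of_Sigma_eq_zero hΩ hu₀ hv₀ h.symm)
    have hle : D ≤ S := CircleSobolev.distToClass_le_Sigma hopen hfin
      (CircleSobolev.zigzag_comp_mem_eqClass hn3 hopen hfin hu₀) hu₀ hv₀
    have hge : S ≤ (1 + min 1 (ε / 2)) * D := hn u₀ hu₀ v₀ hv₀
    have hD0 : 0 ≤ D := Real.iInf_nonneg fun _ => CircleSobolev.gradL1_nonneg
    have hmin : min 1 (ε / 2) ≤ ε / 2 := min_le_right _ _
    rw [Real.dist_eq, abs_of_nonneg (sub_nonneg.2 ((div_le_one hS0).2 hle)), sub_lt_iff_lt_add,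
      ← sub_lt_iff_lt_add', lt_div_iff₀ hS0]
    nlinarith [mul_le_mul hmin hle hD0 (by positivity)]
  · intro u₀ hu₀ v₀ hv₀
    set S := CircleSobolev.Sigma Ω (fun x => u₀ x * (v₀ x)⁻¹) with hS
    have hS0 : 0 ≤ S := CircleSobolev.Sigma_nonneg
    -- The maps `Tₙ ∘ u₀` belong to the class of `u₀`, so one sufficiently large `n` bounds the
    -- supremum from below. Letting `ε` tend to zero also covers equivalent pairs, where no ratio is
    -- available.
    have hstep : ∀ ε : ℝ, 0 < ε → ε ≤ 1 →
        ((S / (1 + ε) : ℝ) : EReal) ≤ CircleSobolev.DistClasses Ω u₀ v₀ := by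
      intro ε hε hε1
      obtain ⟨n, hn, hn3⟩ := ((CircleSobolev.eventually_Sigma_le hN0 hopen hfin hε hε1).and
        (eventually_ge_atTop 3)).exists
      have h1 : S / (1 + ε) ≤ CircleSobolev.distToClass Ω (CircleSobolev.zigzag n ∘ u₀) v₀ := by
        rw [div_le_iff₀' (by linarith)]
        exact hn u₀ hu₀ v₀ hv₀
      exact (EReal.coe_le_coe_iff.2 h1).trans (le_iSup₂
        (f := fun u (_ : u ∈ CircleSobolev.eqClass Ω u₀) =>
          ((CircleSobolev.distToClass Ω u v₀ : ℝ) : EReal)) _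
        (CircleSobolev.zigzag_comp_mem_eqClass hn3 hopen hfin hu₀))
    have hlim : Tendsto (fun k : ℕ => ((S / (1 + 1 / ((k : ℝ) + 1)) : ℝ) : EReal)) atTop
        (𝓝 (S : EReal)) := by
      refine (continuous_coe_real_ereal.tendsto S).comp ?_
      have h := tendsto_one_div_add_atTop_nhds_zero_nat (𝕜 := ℝ)
      have h2 := (tendsto_const_nhds (x := S)).div (h.const_add 1) (by norm_num)
      rwa [add_zero, div_one] at h2
    refine le_of_tendsto' hlim fun k => hstep _ (by positivity) ?_
    rw [div_le_one (by positivity)]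
    linarith [(Nat.cast_nonneg k : (0 : ℝ) ≤ k)]
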